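/- **Proposition 2.1.** Let $a=(a_1,a_2,a_3)$ and $b=(b_1,b_2,b_3)$ be vectors whose entries are all integers (or all lie in $\tfrac12+\mathbb Z$), with $a_1\le a_2\le a_3$, $b_1\le b_2\le b_3$ and $a_1+b_1\ge 1$. Give the polynomial ring $\mathbb C[x_{ij} : 1\le i,j\le 3]$ the grading in which $x_{ij}$ has weight $a_i+b_j$, and let $$V(a,b)=\Bigl(\textstyle\bigwedge^2 (x_{ij})=0\Bigr)\subset \mathbb P^8(a_1+b_1,a_1+b_2,\dots,a_3+b_3)$$ be the subscheme of weighted projective space defined by the $2\times2$ minors of the $3\times 3$ matrix $(x_{ij})$, that is, $V(a,b)=\operatorname{Proj}$ of the quotient of $\mathbb C[x_{ij}]$ by the ideal of these minors. Then $V(a,b)$ is a $4$-dimensional, $\mathbb Q$-factorial, projective toric variety over $\mathbb C$ of Picard rank $\rho_V=\operatorname{rank}\operatorname{Pic}V(a,b)=2$. Here a toric variety is a normal complex variety containing a torus $(\mathbb C^*)^n$ as a dense open subscheme such that the multiplication of the torus extends to an action of the torus on the variety; $\mathbb Q$-factorial means normal and such that every Weil divisor has a positive multiple that is Cartier. -/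

import Mathlib

open AlgebraicGeometry CategoryTheory MonoidalCategory MonObj DirectSum

noncomputable section

namespace WeightedP2P2

/-! ### Gradings on quotient rings and `Proj` over `ℂ` -/

section QuotientGrading

variable {A : Type} [CommRing A] [Algebra ℂ A]

/-- The degree `n` part of `A ⧸ I`: the image of the degree `n` part of `A`. -/
def quotientGrading (𝒜 : ℕ → Submodule ℂ A) (I : Ideal A) (n : ℕ) : Submodule ℂ (A ⧸ I) :=
  (𝒜 n).map (Ideal.Quotient.mkₐ ℂ I).toLinearMap

variable (𝒜 : ℕ → Submodule ℂ A) (I : Ideal A)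

theorem mk_mem_quotientGrading {n : ℕ} {x : A} (hx : x ∈ 𝒜 n) :
    Ideal.Quotient.mk I x ∈ quotientGrading 𝒜 I n :=
  ⟨x, hx, rfl⟩

variable [GradedAlgebra 𝒜]

instance : SetLike.GradedMonoid (quotientGrading 𝒜 I) where
  one_mem := ⟨1, SetLike.GradedOne.one_mem, map_one (Ideal.Quotient.mk I)⟩
  mul_mem := by
    rintro i j _ _ ⟨x, hx, rfl⟩ ⟨y, hy, rfl⟩
    exact ⟨x * y, SetLike.GradedMul.mul_mem hx hy, map_mul (Ideal.Quotient.mk I) x y⟩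

/-- Splitting an element of `A` into homogeneous components and reducing them modulo `I`. -/
def toQuotientComponents : A →+ ⨁ n, quotientGrading 𝒜 I n :=
  (DirectSum.toAddMonoid fun n ↦
      (DirectSum.of (fun n ↦ quotientGrading 𝒜 I n) n).comp
        ({ toFun := fun x ↦ ⟨Ideal.Quotient.mk I x, mk_mem_quotientGrading 𝒜 I x.2⟩
           map_zero' := Subtype.ext (map_zero _)
           map_add' := fun _ _ ↦ Subtype.ext (map_add _ _ _) } :
          𝒜 n →+ quotientGrading 𝒜 I n)).comp
    (DirectSum.decomposeAddEquiv 𝒜).toAddMonoidHom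

theorem toQuotientComponents_of_mem {n : ℕ} {x : A} (hx : x ∈ 𝒜 n) :
    toQuotientComponents 𝒜 I x =
      DirectSum.of (fun n ↦ quotientGrading 𝒜 I n) n
        ⟨Ideal.Quotient.mk I x, mk_mem_quotientGrading 𝒜 I hx⟩ := by
  lift x to 𝒜 n using hx
  simp [toQuotientComponents]

theorem coe_toQuotientComponents (x : A) (n : ℕ) :
    (toQuotientComponents 𝒜 I x n : A ⧸ I) = Ideal.Quotient.mk I (decompose 𝒜 x n) := by
  induction x using DirectSum.Decomposition.inductionOn 𝒜 with
  | zero => simp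
  | @homogeneous i m =>
    rw [toQuotientComponents_of_mem 𝒜 I m.2, decompose_coe]
    by_cases h : i = n
    · subst h; simp
    · simp [DirectSum.of_eq_of_ne _ _ _ (Ne.symm h)]
  | add x y hx hy => simp [hx, hy]

/-- The quotient of a graded `ℂ`-algebra by a homogeneous ideal is a graded `ℂ`-algebra. -/
abbrev quotientGradedAlgebra (hI : I.IsHomogeneous 𝒜) : GradedAlgebra (quotientGrading 𝒜 I) :=
  have hker : I.toAddSubgroup ≤ (toQuotientComponents 𝒜 I).ker := by
    intro x hx
    refine DFinsupp.ext fun n ↦ Subtype.ext ?_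
    rw [coe_toQuotientComponents]
    exact Ideal.Quotient.eq_zero_iff_mem.2 (hI n hx)
  { toDecomposition := Decomposition.ofAddHom _
      (QuotientAddGroup.lift I.toAddSubgroup (toQuotientComponents 𝒜 I) hker)
      (by
        ext x
        obtain ⟨x, rfl⟩ := Ideal.Quotient.mk_surjective x
        change DirectSum.coeAddMonoidHom _ (toQuotientComponents 𝒜 I x) = Ideal.Quotient.mk I x
        induction x using DirectSum.Decomposition.inductionOn 𝒜 with
        | zero => simp
        | homogeneous m => simp [toQuotientComponents_of_mem 𝒜 I m.2]
        | add x y hx hy => simp [hx, hy])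
      (by
        ext n y : 2
        obtain ⟨_, x, hx, rfl⟩ := y
        change QuotientAddGroup.lift I.toAddSubgroup (toQuotientComponents 𝒜 I) hker
          (DirectSum.coeAddMonoidHom _ (DirectSum.of (fun n ↦ quotientGrading 𝒜 I n) n
            ⟨Ideal.Quotient.mk I x, mk_mem_quotientGrading 𝒜 I hx⟩)) = _
        exact (congrArg (QuotientAddGroup.lift I.toAddSubgroup (toQuotientComponents 𝒜 I) hker)
          (DirectSum.coeAddMonoidHom_of (quotientGrading 𝒜 I) n _)).trans
          (toQuotientComponents_of_mem 𝒜 I hx)) }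

end QuotientGrading

/-- The base `Spec ℂ`. -/
abbrev pt : Scheme.{0} := Spec (.of ℂ)

/-- `Proj` of a graded `ℂ`-algebra, as a scheme over `Spec ℂ`. -/
def projOver {A : Type} [CommRing A] [Algebra ℂ A] (𝒜 : ℕ → Submodule ℂ A) [GradedAlgebra 𝒜] :
    Over pt :=
  Over.mk (Proj.toSpecZero 𝒜 ≫ Spec.map (CommRingCat.ofHom (algebraMap ℂ (𝒜 0))))

/-! ### The weighted `ℙ² × ℙ²` -/

/-- The admissible weight vectors: the entries of `a` and `b` are all integers, or all lie in
`1/2 + ℤ`; both vectors are weakly increasing, and `a₁ + b₁ ≥ 1`. -/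
structure IsFormat (a b : Fin 3 → ℚ) : Prop where
  integral : (∀ i, ∃ m n : ℤ, a i = m ∧ b i = n) ∨
    (∀ i, ∃ m n : ℤ, a i = 1 / 2 + m ∧ b i = 1 / 2 + n)
  mono_a : Monotone a
  mono_b : Monotone b
  one_le : 1 ≤ a 0 + b 0

/-- The weight `aᵢ + bⱼ` of the variable in position `(i, j)` (a positive integer for an
admissible pair `a, b`, see `IsFormat.wt_cast` and `IsFormat.wt_pos`). -/
def wt (a b : Fin 3 → ℚ) (p : Fin 3 × Fin 3) : ℕ := ⌊a p.1 + b p.2⌋₊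

theorem IsFormat.one_le_add {a b : Fin 3 → ℚ} (h : IsFormat a b) (i j : Fin 3) :
    1 ≤ a i + b j :=
  h.one_le.trans (add_le_add (h.mono_a (Fin.zero_le i)) (h.mono_b (Fin.zero_le j)))

theorem IsFormat.wt_cast {a b : Fin 3 → ℚ} (h : IsFormat a b) (i j : Fin 3) :
    (wt a b (i, j) : ℚ) = a i + b j := by
  obtain ⟨k, hk⟩ : ∃ k : ℤ, a i + b j = k := by
    rcases h.integral with h' | h'
    · obtain ⟨m, -, hm, -⟩ := h' i
      obtain ⟨-, n, -, hn⟩ := h' j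
      exact ⟨m + n, by rw [hm, hn]; push_cast; ring⟩
    · obtain ⟨m, -, hm, -⟩ := h' i
      obtain ⟨-, n, -, hn⟩ := h' j
      exact ⟨1 + m + n, by rw [hm, hn]; push_cast; ring⟩
  have h1 := h.one_le_add i j
  rw [hk] at h1
  have hk0 : 0 ≤ k := by
    have : (1 : ℤ) ≤ k := by exact_mod_cast h1
    omega
  lift k to ℕ using hk0
  simp only [wt, hk, Int.cast_natCast, Nat.floor_natCast]

theorem IsFormat.wt_pos {a b : Fin 3 → ℚ} (h : IsFormat a b) (i j : Fin 3) :
    0 < wt a b (i, j) := by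
  have h1 := h.one_le_add i j
  rw [← h.wt_cast] at h1
  exact_mod_cast h1

/-- The polynomial ring in the entries `x i j` of the generic `3 × 3` matrix. -/
abbrev MatrixRing : Type := MvPolynomial (Fin 3 × Fin 3) ℂ

/-- The ideal of `2 × 2` minors of the generic `3 × 3` matrix (rows `i, k`, columns `j, l`). -/
def minorsIdeal : Ideal MatrixRing :=
  Ideal.span {f | ∃ i k j l : Fin 3,
    f = MvPolynomial.X (i, j) * MvPolynomial.X (k, l) -
      MvPolynomial.X (i, l) * MvPolynomial.X (k, j)}

/-- The grading of the polynomial ring in which `x i j` has weight `aᵢ + bⱼ`. -/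
abbrev weightGrading (a b : Fin 3 → ℚ) : ℕ → Submodule ℂ MatrixRing :=
  MvPolynomial.weightedHomogeneousSubmodule ℂ (wt a b)

instance (a b : Fin 3 → ℚ) : GradedAlgebra (weightGrading a b) :=
  MvPolynomial.weightedGradedAlgebra ℂ (wt a b)

theorem IsFormat.minorsIdeal_isHomogeneous {a b : Fin 3 → ℚ} (h : IsFormat a b) :
    minorsIdeal.IsHomogeneous (weightGrading a b) := by
  refine Ideal.homogeneous_span _ _ ?_
  rintro _ ⟨i, k, j, l, rfl⟩
  have hw : wt a b (i, l) + wt a b (k, j) = wt a b (i, j) + wt a b (k, l) := by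
    have : (wt a b (i, l) + wt a b (k, j) : ℚ) = wt a b (i, j) + wt a b (k, l) := by
      simp only [h.wt_cast]; ring
    exact_mod_cast this
  refine ⟨wt a b (i, j) + wt a b (k, l), Submodule.sub_mem _ ?_ ?_⟩
  · exact (MvPolynomial.isWeightedHomogeneous_X ℂ _ _).mul
      (MvPolynomial.isWeightedHomogeneous_X ℂ _ _)
  · rw [← hw]
    exact (MvPolynomial.isWeightedHomogeneous_X ℂ _ _).mul
      (MvPolynomial.isWeightedHomogeneous_X ℂ _ _)

/-- The weighted `ℙ² × ℙ²`: the closed subscheme of the weighted projective space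
`ℙ⁸(a₁ + b₁, …, a₃ + b₃) = Proj ℂ[x i j]` defined by the `2 × 2` minors of the matrix `(x i j)`,
that is, `Proj` of the quotient of the weighted polynomial ring by the ideal of minors. -/
def V {a b : Fin 3 → ℚ} (h : IsFormat a b) : Over pt :=
  letI := quotientGradedAlgebra (weightGrading a b) minorsIdeal h.minorsIdeal_isHomogeneous
  projOver (quotientGrading (weightGrading a b) minorsIdeal)

/-! ### Projective varieties -/

/-- Projective space `ℙⁿ` over `ℂ`. -/
def projectiveSpace (n : ℕ) : Over pt :=
  letI : GradedAlgebra (MvPolynomial.homogeneousSubmodule (Fin (n + 1)) ℂ) :=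
    MvPolynomial.gradedAlgebra
  projOver (MvPolynomial.homogeneousSubmodule (Fin (n + 1)) ℂ)

/-- A scheme over `ℂ` is projective if it is a closed subscheme of some `ℙⁿ`. -/
def IsProjective (X : Over pt) : Prop :=
  ∃ (n : ℕ) (i : X ⟶ projectiveSpace n), IsClosedImmersion i.left

/-- A complex variety: an integral separated scheme of finite type over `ℂ`. -/
structure IsVariety (X : Over pt) : Prop where
  isIntegral : IsIntegral X.left
  isSeparated : IsSeparated X.hom
  locallyOfFiniteType : LocallyOfFiniteType X.hom
  quasiCompact : QuasiCompact X.hom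

/-- All local rings are integrally closed (used for integral schemes, whose local rings are
domains). -/
def IsNormal (X : Scheme.{0}) : Prop := ∀ x : X, IsIntegrallyClosed (X.presheaf.stalk x)

/-! ### Toric varieties -/

/-- The `n`-dimensional torus `(ℂˣ)ⁿ = Spec ℂ[ℤⁿ]` over `ℂ`; the Hopf algebra structure of the
group algebra makes it a group scheme. -/
abbrev torus (n : ℕ) : Over pt :=
  (Spec (.of (AddMonoidAlgebra ℂ (Fin n → ℤ)))).asOver (Spec (.of ℂ))

/-- The group structure of the torus. -/
instance (n : ℕ) : MonObj (torus n) :=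
  inferInstanceAs (MonObj ((Spec (.of (AddMonoidAlgebra ℂ (Fin n → ℤ)))).asOver (Spec (.of ℂ))))

/-- A (normal) toric variety: a normal complex variety `X` containing a torus `T` as a dense open
subscheme, such that the multiplication of `T` extends to an algebraic action of `T` on `X`. -/
structure IsToric (X : Over pt) : Prop where
  isVariety : IsVariety X
  isNormal : IsNormal X.left
  exists_torus : ∃ (n : ℕ) (j : torus n ⟶ X) (act : torus n ⊗ X ⟶ X),
    IsOpenImmersion j.left ∧
    Dense (Set.range j.left) ∧
    (η[torus n] ▷ X) ≫ act = (λ_ X).hom ∧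
    (μ[torus n] ▷ X) ≫ act = (α_ (torus n) (torus n) X).hom ≫ (torus n ◁ act) ≫ act ∧
    (torus n ◁ j) ≫ act = μ[torus n] ≫ j

/-! ### `ℚ`-factoriality -/

/-- A Weil divisor: an algebraic cycle supported at points of codimension one. -/
def IsWeilDivisor {X : Scheme.{0}} (D : AlgebraicCycle X ℤ) : Prop :=
  ∀ x : X, D x ≠ 0 → Order.coheight x = 1

/-- The Weil divisor `m • D` is Cartier: locally it is the divisor of a nonzero rational
function. -/
def IsCartierMultiple {X : Scheme.{0}} [IsIntegral X] [IsLocallyNoetherian X]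
    (m : ℕ) (D : AlgebraicCycle X ℤ) : Prop :=
  ∀ x : X, ∃ U : X.Opens, x ∈ U ∧ ∃ f : X.functionField, f ≠ 0 ∧
    ∀ y ∈ U, (m : ℤ) * D y = Scheme.ord f y

/-- `ℚ`-factorial: a normal Noetherian integral scheme on which every Weil divisor has a positive
multiple that is Cartier. -/
def IsQFactorial (X : Scheme.{0}) : Prop :=
  IsNormal X ∧ ∃ (_ : IsIntegral X) (_ : IsNoetherian X),
    ∀ D : AlgebraicCycle X ℤ, IsWeilDivisor D → ∃ m : ℕ, 0 < m ∧ IsCartierMultiple m D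

/-! ### The Picard group -/

instance : CommGrpCat.toAddCommGrp.{0}.IsEquivalence :=
  inferInstanceAs commGroupAddCommGroupEquivalence.functor.IsEquivalence

/-- The functor sending a commutative ring to its group of units, written additively. -/
def unitsFunctor : CommRingCat.{0} ⥤ AddCommGrpCat.{0} :=
  forget₂ CommRingCat.{0} CommMonCat.{0} ⋙ CommMonCat.units.{0} ⋙ CommGrpCat.toAddCommGrp.{0}

instance : unitsFunctor.IsRightAdjoint := by
  unfold unitsFunctor
  infer_instance

/-- The sheaf `𝒪ˣ` of units of the structure sheaf, with its group law written additively. -/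
def unitsSheaf (X : Scheme.{0}) : Sheaf (Opens.grothendieckTopology X) AddCommGrpCat.{0} :=
  (sheafCompose (Opens.grothendieckTopology X) unitsFunctor).obj X.sheaf

/-- The Picard group `Pic X = H¹(X, 𝒪ˣ)` (the group of isomorphism classes of line bundles on
`X`), written additively. -/
abbrev Pic (X : Scheme.{0}) : Type := Sheaf.H.{0} (unitsSheaf X) 1

/-- The Picard rank of `X`: the rank of the abelian group `Pic X`. -/
def picardRank (X : Scheme.{0}) : Cardinal := Module.rank ℤ (Pic X)

end WeightedP2P2

end

/-! The coordinate ring `CoordRing` is the toric ring of the Segre cone. A monomial modulo the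
minors is determined by its row and column sums, so `param` embeds the ring in the Laurent ring
`ℂ[ℤ³ × ℤ³]`, with image spanned by the pairs of nonnegative vectors of equal sum
(`mem_range_margins`, `param_injective`). Everything else is read off from exponents.

On the chart `x p ≠ 0` the ring is `ℂ[chartMonoid]`: the exponents of degree zero that are
nonnegative outside the row and the column of `p`. These four remaining exponents determine the
other two, and they occur exactly when a weighted sum of them is divisible by `wt p`
(`IsFormat.mem_range_chartExpo`). So each chart is `ℂ⁴/μ_N` with `N = wt p` and a diagonal action.
Invariants of a finite group in a polynomial ring are normal, have dimension 4, and every height one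
prime is the radical of a principal ideal, generated by the norm of a prime element
(`cyclicQuotient_properties`). This gives the dimension, normality, and a positive principal
multiple of each prime divisor on each chart; the finite cover by charts then gives
`ℚ`-factoriality.

The torus is the locus where all coordinates are invertible. It lies in every chart, which makes the
variety irreducible, and the chartwise actions coming from the inclusions of monoids glue along it
(`exists_torus_action`).

For the Picard rank, `0 → 𝒪ˣ → Kˣ → Kˣ/𝒪ˣ → 0` with `Kˣ` flasque makes `Pic` the group of Cartier
divisors modulo principal ones, and normality identifies Cartier divisors with locally principal
Weil divisors (`exists_surjective_hom_pic`). The chart `x₀₀ ≠ 0` has torsion class group and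
constant units. Its complement is the union of two prime divisors, the vanishing of row 0 and of
column 0, because `x₀₀ = 0` forces `x₀ₗ xₖ₀ = 0`. Multiples of these two are Cartier, independent in
`Pic`, and span it up to torsion (`picardRank_eq_two`).

For projectivity, choose a degree `D` in which the monomials generate all chart monoids after
division by the power of `x p` of degree `D`. The morphism to `ℙⁿ` given by these monomials is a
closed immersion on each chart, and properness globalizes this (`isProjective_proj`). -/

noncomputable section

namespace WeightedP2P2

/-! ### First cohomology of abelian sheaves; vanishing for flasque sheaves -/

section SheafCohomology

open TopologicalSpace Opposite Abelian

variable {X : TopCat.{0}}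

/-- The stretch `H⁰(X₂) → H⁰(X₃) → H¹(X₁) → H¹(X₂) = 0` of the long exact sequence, with `H⁰`
replaced by global sections. -/
theorem exists_connecting_hom {S : ShortComplex (Sheaf (Opens.grothendieckTopology X) AddCommGrpCat.{0})}
    (hS : S.ShortExact) [Subsingleton (Sheaf.H.{0} S.X₂ 1)] :
    ∃ δ : S.X₃.obj.obj (op ⊤) →+ Sheaf.H.{0} S.X₁ 1, Function.Surjective δ ∧
      ∀ q, δ q = 0 ↔ ∃ t : S.X₂.obj.obj (op ⊤), S.g.hom.app (op ⊤) t = q := by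
  let e₃ := Sheaf.H.equiv₀ S.X₃ (T := (⊤ : Opens X)) Limits.isTerminalTop
  let e₂ := Sheaf.H.equiv₀ S.X₂ (T := (⊤ : Opens X)) Limits.isTerminalTop
  refine ⟨(hS.extClass.postcomp _ (zero_add 1)).comp e₃.symm.toAddMonoidHom, ?_, fun q ↦ ?_⟩
  · intro x
    obtain ⟨y, hy⟩ := Ext.covariant_sequence_exact₁ _ hS x (Subsingleton.elim (α := Sheaf.H S.X₂ 1) _ _) (zero_add 1)
    exact ⟨e₃ y, by simpa using hy⟩
  · constructor
    · intro h
      obtain ⟨y, hy⟩ := Ext.covariant_sequence_exact₃ _ hS (e₃.symm q) (zero_add 1) h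
      refine ⟨e₂ y, ?_⟩
      have := Sheaf.H.equiv₀_naturality (T := (⊤ : Opens X)) Limits.isTerminalTop S.g y
      rw [this, Sheaf.H.map_apply, hy]
      exact e₃.apply_symm_apply q
    · rintro ⟨t, rfl⟩
      have := Sheaf.H.equiv₀_symm_naturality (T := (⊤ : Opens X)) Limits.isTerminalTop S.g t
      change Ext.comp (e₃.symm _) hS.extClass (zero_add 1) = 0
      rw [← this, Sheaf.H.map_apply]
      rw [Ext.comp_assoc_of_second_deg_zero, ShortComplex.ShortExact.comp_extClass, Ext.comp_zero]

/-- Embed `G` in an injective sheaf, whose `H¹` vanishes. As `G` is flasque, global sections of the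
quotient lift, so the surjective connecting map onto `H¹(G)` is zero. -/
theorem subsingleton_H_one_of_isFlasque (G : Sheaf (Opens.grothendieckTopology X) AddCommGrpCat.{0})
    [TopCat.Sheaf.IsFlasque G] :
    Subsingleton (Sheaf.H.{0} G 1) := by
  let S : ShortComplex (Sheaf (Opens.grothendieckTopology X) AddCommGrpCat.{0}) :=
    ShortComplex.mk (Injective.ι G) (Limits.cokernel.π (Injective.ι G)) (Limits.cokernel.condition _)
  have hS : S.ShortExact :=
    { exact := ShortComplex.exact_cokernel _
      mono_f := inferInstanceAs (Mono (Injective.ι G))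
      epi_g := inferInstanceAs (Epi (Limits.cokernel.π (Injective.ι G))) }
  have : Injective S.X₂ := inferInstanceAs (Injective (Injective.under G))
  have : TopCat.Sheaf.IsFlasque S.X₁ := inferInstanceAs (TopCat.Sheaf.IsFlasque G)
  have h2 : Subsingleton (Sheaf.H.{0} S.X₂ 1) := by
    exact inferInstanceAs (Subsingleton (Sheaf.H.{0} S.X₂ (0 + 1)))
  obtain ⟨δ, hδ, hker⟩ := exists_connecting_hom hS
  refine subsingleton_of_forall_eq 0 fun x ↦ ?_
  obtain ⟨q, rfl⟩ := hδ x
  rw [hker]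
  exact (AddCommGrpCat.epi_iff_surjective _).mp
    (TopCat.Sheaf.IsFlasque.epi_of_shortExact (U := ⊤) hS) q

end SheafCohomology

/-! ### The constant sheaf on an irreducible space -/

section ConstantSections

open TopologicalSpace Opposite

variable (X : TopCat.{0}) (A : Type) [AddCommGroup A]

/-- The group of constant functions on an open set. -/
def constantSections (U : Opens X) : AddSubgroup (U → A) where
  carrier := {s | ∀ x y, s x = s y}
  add_mem' hs ht x y := by simp [hs x y, ht x y]
  zero_mem' _ _ := rfl
  neg_mem' hs x y := by simp [hs x y]

/-- Restriction of constant functions. -/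
def constantSectionsRes {U V : Opens X} (h : V ≤ U) :
    constantSections X A U →+ constantSections X A V where
  toFun s := ⟨fun x ↦ s.1 ⟨x, h x.2⟩, fun _ _ ↦ s.2 _ _⟩
  map_zero' := rfl
  map_add' _ _ := rfl

/-- The presheaf of constant functions with values in `A`. -/
def constantPresheaf : TopCat.Presheaf AddCommGrpCat.{0} X where
  obj U := AddCommGrpCat.of (constantSections X A U.unop)
  map i := AddCommGrpCat.ofHom (constantSectionsRes X A i.unop.le)

/-- Two nonempty open sets of an irreducible space meet, so compatible constants on a cover are all
equal and no sheafification is needed. -/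
theorem constantPresheaf_isSheaf [IrreducibleSpace X] : (constantPresheaf X A).IsSheaf := by
  rw [TopCat.Presheaf.isSheaf_iff_isSheaf_comp (forget AddCommGrpCat)]
  refine TopCat.Presheaf.isSheaf_of_isSheafUniqueGluing_types _ fun I U sf hsf ↦ ?_
  let f : ∀ i, constantSections X A (U i) := sf
  have hf : ∀ i j x (hi : x ∈ U i) (hj : x ∈ U j), (f i).1 ⟨x, hi⟩ = (f j).1 ⟨x, hj⟩ := by
    intro i j x hi hj
    exact congrFun (congrArg Subtype.val (hsf i j)) ⟨x, hi, hj⟩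
  have hmem : ∀ x : (iSup U : Opens X), ∃ i, x.1 ∈ U i := fun x ↦ Opens.mem_iSup.1 x.2
  choose idx hidx using hmem
  have hconst : ∀ i j (x : U i) (y : U j), (f i).1 x = (f j).1 y := by
    intro i j x y
    obtain ⟨z, -, hz⟩ := (IrreducibleSpace.isIrreducible_univ X).2 (U i) (U j) (U i).2 (U j).2
      ⟨x, trivial, x.2⟩ ⟨y, trivial, y.2⟩
    rw [(f i).2 x ⟨z, hz.1⟩, hf i j z hz.1 hz.2, (f j).2 ⟨z, hz.2⟩ y]
  refine ⟨(⟨fun x ↦ (f (idx x)).1 ⟨x, hidx x⟩, fun x y ↦ hconst _ _ _ _⟩ :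
    constantSections X A (iSup U)), fun i ↦ ?_, fun t ht ↦ ?_⟩
  · exact Subtype.ext (funext fun x ↦ hf _ _ _ _ _)
  · refine Subtype.ext (funext fun x ↦ ?_)
    exact congrFun (congrArg Subtype.val (ht (idx x))) ⟨x, hidx x⟩

/-- The sheaf of constant functions on an irreducible space. -/
def irreducibleConstantSheaf [IrreducibleSpace X] :
    Sheaf (Opens.grothendieckTopology X) AddCommGrpCat.{0} :=
  ⟨constantPresheaf X A, constantPresheaf_isSheaf X A⟩

instance [IrreducibleSpace X] : TopCat.Sheaf.IsFlasque (irreducibleConstantSheaf X A) where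
  epi {U V} i := by
    refine (AddCommGrpCat.epi_iff_surjective _).mpr fun s ↦ ?_
    let s' : constantSections X A V.unop := s
    by_cases h : Nonempty V.unop
    · obtain ⟨x⟩ := h
      exact ⟨(⟨fun _ ↦ s'.1 x, fun _ _ ↦ rfl⟩ : constantSections X A U.unop),
        Subtype.ext (funext fun y ↦ s'.2 x y)⟩
    -- On the empty set there is no value to extend; any section, here zero, restricts correctly.
    · exact ⟨0, Subtype.ext (funext fun y ↦ (h ⟨y⟩).elim)⟩

end ConstantSections

/-! ### Units inside the constant sheaf of rational functions -/

section CartierSheaf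

open TopologicalSpace Opposite

variable (X : Scheme.{0}) [IsIntegral X]

theorem genericPoint_mem {U : X.Opens} {x : X} (hx : x ∈ U) : genericPoint X ∈ U :=
  (genericPoint_specializes x).mem_open U.2 hx

/-- A unit of `𝒪_X(U)` as a constant function with values in the function field. -/
def unitsToConstant (U : X.Opens) :
    Additive Γ(X, U)ˣ →+ constantSections X (Additive X.functionFieldˣ) U where
  toFun u := ⟨fun x ↦ .ofMul (Units.map
    (X.presheaf.germ U (genericPoint X) (genericPoint_mem X x.2)).hom.toMonoidHom u.toMul),
    fun _ _ ↦ rfl⟩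
  map_zero' := Subtype.ext (funext fun _ ↦ congrArg Additive.ofMul (map_one _))
  map_add' _ _ := Subtype.ext (funext fun _ ↦ congrArg Additive.ofMul (map_mul _ _ _))

theorem unitsToConstant_injective (U : X.Opens) : Function.Injective (unitsToConstant X U) := by
  intro u v h
  by_cases hU : Nonempty U
  · obtain ⟨x⟩ := hU
    have := congrArg (fun w : Additive X.functionFieldˣ ↦ (w.toMul : X.functionField)) (congrFun (congrArg Subtype.val h) x)
    exact congrArg Additive.ofMul (Units.ext (germ_injective_of_isIntegral X (genericPoint X) _ this))
  · have : U = ⊥ := by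
      ext x
      simpa using fun hx ↦ hU ⟨⟨x, hx⟩⟩
    subst this
    have : Subsingleton Γ(X, ⊥) := inferInstance
    exact congrArg Additive.ofMul (Units.ext (Subsingleton.elim (α := Γ(X, ⊥)) _ _))

/-- The map from the sheaf of units to the constant sheaf of nonzero rational functions. -/
def unitsSheafToConstant :
    unitsSheaf X ⟶ irreducibleConstantSheaf X (Additive X.functionFieldˣ) where
  hom :=
    { app U := AddCommGrpCat.ofHom (unitsToConstant X U.unop)
      naturality U V i := by
        ext u
        refine Subtype.ext (funext fun x ↦ ?_)
        refine congrArg Additive.ofMul (Units.ext ?_)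
        exact X.presheaf.germ_res_apply i.unop _ _ _ }

end CartierSheaf

/-! ### Normal Noetherian domains are determined in codimension one -/

section Hartogs

/-- A rational function on a normal Noetherian domain that is regular in codimension one is
regular. -/
theorem exists_algebraMap_eq_of_forall_height_eq_one {A K : Type*} [CommRing A] [IsDomain A]
    [IsNoetherianRing A] [IsIntegrallyClosed A] [Field K] [Algebra A K] [IsFractionRing A K]
    (f : K) (hf : ∀ P : Ideal A, P.IsPrime → P.height = 1 →
      ∃ a s : A, s ∉ P ∧ f * algebraMap A K s = algebraMap A K a) :
    ∃ a, algebraMap A K a = f := by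
  have hinj := IsFractionRing.injective A K
  obtain ⟨a, b, hb, rfl⟩ := IsFractionRing.div_surjective (A := A) f
  have hb0 : b ≠ 0 := nonZeroDivisors.ne_zero hb
  have hbK : algebraMap A K b ≠ 0 := by simpa using hb0
  by_cases hab : a ∈ Ideal.span {b}
  · obtain ⟨c, rfl⟩ := Ideal.mem_span_singleton'.1 hab
    exact ⟨c, by rw [map_mul]; field_simp⟩
  exfalso
  have hx : (Ideal.Quotient.mk (Ideal.span {b}) a) ≠ 0 := by
    rwa [Ne, Ideal.Quotient.eq_zero_iff_mem]
  -- Write `f = a/b`. If `b ∤ a`, some associated prime `P = (b : d)` of `A/b` contains the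
  -- annihilator of `a`. It will be shown to have height one, so that the denominator `s ∉ P`
  -- supplied by the hypothesis kills `a` modulo `b`, a contradiction.
  obtain ⟨P, hP, hle⟩ := exists_le_isAssociatedPrime_of_isNoetherianRing A
    (Ideal.Quotient.mk (Ideal.span {b}) a) hx
  obtain ⟨hPp, y, hy⟩ := isAssociatedPrime_iff.1 hP
  obtain ⟨d, rfl⟩ := Ideal.Quotient.mk_surjective y
  have hmem : ∀ p, p ∈ P ↔ b ∣ p * d := by
    intro p
    rw [hy, Submodule.mem_colon_singleton, Submodule.mem_bot, ← Ideal.mem_span_singleton,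
      ← Ideal.Quotient.eq_zero_iff_mem, map_mul]
    rfl
  have hbP : b ∈ P := (hmem b).2 (dvd_mul_right _ _)
  have hP0 : P ≠ ⊥ := fun h ↦ hb0 (by simpa [h] using hbP)
  have hbd : ¬ b ∣ d := fun h ↦ hPp.ne_top ((Ideal.eq_top_iff_one _).2 ((hmem 1).2 (by simpa)))
  -- Otherwise `d/b` maps the finitely generated module `P` to itself, hence is integral over `A`,
  -- hence lies in `A`, contradicting `b ∤ d`.
  have key : ∃ p ∈ P, ∃ u, u ∉ P ∧ p * d = b * u := by
    by_contra hcon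
    push Not at hcon
    have hint : IsIntegral A (algebraMap A K d / algebraMap A K b) := by
      refine isIntegral_of_smul_mem_submodule (A := K) (M := K) (Submodule.map (Algebra.linearMap A K) P) ?_ ?_ _ ?_
      · intro h0
        refine hb0 (hinj ?_)
        have : algebraMap A K b ∈ Submodule.map (Algebra.linearMap A K) P := ⟨b, hbP, rfl⟩
        rw [h0] at this
        simpa using this
      · exact (IsNoetherian.noetherian P).map _
      · rintro _ ⟨p, hp, rfl⟩
        obtain ⟨u, hu⟩ := (hmem p).1 hp
        refine ⟨u, by_contra fun h ↦ hcon p hp u h hu, ?_⟩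
        simp only [Algebra.linearMap_apply, smul_eq_mul]
        rw [div_mul_eq_mul_div, eq_div_iff hbK, ← map_mul, ← map_mul, mul_comm d p, hu, mul_comm]
    obtain ⟨c, hc⟩ := IsIntegrallyClosed.isIntegral_iff.1 hint
    rw [eq_div_iff hbK, ← map_mul] at hc
    exact hbd ⟨c, by rw [mul_comm]; exact (hinj hc).symm⟩
  obtain ⟨p, hp, u, hu, hpu⟩ := key
  -- From `p d = b u` and `q d = b v` follows `u q = v p`. With `u ∉ P`, a prime inside `P`
  -- containing `p` therefore contains every `q ∈ P`, and Krull's theorem bounds the height of `P`.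
  have hmin : P ∈ (Ideal.span {p}).minimalPrimes := by
    refine ⟨⟨hPp, (Ideal.span_singleton_le_iff_mem _).2 hp⟩, fun Q hQ hQP q hq ↦ ?_⟩
    obtain ⟨v, hv⟩ := (hmem q).1 hq
    have : u * q = v * p := by
      apply mul_left_cancel₀ hb0
      calc b * (u * q) = (p * d) * q := by rw [hpu]; ring
        _ = (q * d) * p := by ring
        _ = b * (v * p) := by rw [hv]; ring
    have h1 : u * q ∈ Q := this ▸ Q.mul_mem_left _ (hQ.2 (Ideal.mem_span_singleton_self p))
    exact (hQ.1.mem_or_mem h1).resolve_left fun h ↦ hu (hQP h)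
  have hle1 := Ideal.height_le_one_of_isPrincipal_of_mem_minimalPrimes _ P hmin
  have hne0 : P.height ≠ 0 := by
    rw [Ne, Ideal.height_eq_zero_iff_eq_bot]
    exact hP0
  obtain ⟨a', s, hs, has⟩ := hf P hPp (le_antisymm hle1 (Order.one_le_iff_ne_zero.2 hne0))
  refine hs (hle ?_)
  rw [Submodule.mem_colon_singleton, Submodule.mem_bot]
  change Ideal.Quotient.mk (Ideal.span {b}) (s * a) = 0
  rw [Ideal.Quotient.eq_zero_iff_mem, Ideal.mem_span_singleton']
  refine ⟨a', hinj ?_⟩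
  rw [map_mul, map_mul, ← has]
  field_simp

end Hartogs

/-! ### Rings of invariants of finite groups -/

section Invariants

variable {A B : Type*} [CommRing A] [CommRing B] [Algebra A B]

/-- An integral fraction `a/s` over `A` lies in `B` because `B` is integrally closed. Cancelling `s`
in `s b = a` shows that `b` is invariant, hence comes from `A`. -/
theorem isIntegrallyClosed_of_isInvariant (G : Type*) [Group G] [MulSemiringAction G B]
    [SMulCommClass G A B] [Algebra.IsInvariant A B G] [IsDomain B] [IsIntegrallyClosed B] [IsDomain A]
    (hinj : Function.Injective (algebraMap A B)) : IsIntegrallyClosed A := by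
  let K := FractionRing A
  let L := FractionRing B
  let j : K →+* L := IsFractionRing.map (K := K) (L := L) hinj
  have hj : ∀ a : A, j (algebraMap A K a) = algebraMap B L (algebraMap A B a) := fun a ↦
    IsLocalization.map_eq _ _
  have hjinj : Function.Injective j := j.injective
  refine (isIntegrallyClosed_iff K).2 fun {x} hx ↦ ?_
  obtain ⟨a, s, hs, rfl⟩ := IsFractionRing.div_surjective (A := A) x
  have hs0 : s ≠ 0 := nonZeroDivisors.ne_zero hs
  have hsB : algebraMap A B s ≠ 0 := by simpa [map_eq_zero_iff _ hinj] using hs0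
  have hsL : algebraMap B L (algebraMap A B s) ≠ 0 := by simpa using hsB
  have hsK : algebraMap A K s ≠ 0 := by simpa using hs0
  have hint : IsIntegral B (j (algebraMap A K a / algebraMap A K s)) := by
    obtain ⟨p, hp, hpx⟩ := hx
    refine ⟨p.map (algebraMap A B), hp.map _, ?_⟩
    rw [Polynomial.eval₂_map, ← (RingHom.ext hj : j.comp (algebraMap A K) = (algebraMap B L).comp (algebraMap A B)),
      ← Polynomial.hom_eval₂, hpx, map_zero]
  obtain ⟨b, hb⟩ := IsIntegrallyClosed.isIntegral_iff.1 hint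
  have hsb : algebraMap A B s * b = algebraMap A B a := by
    apply IsFractionRing.injective B L
    rw [map_mul, hb, map_div₀, hj, hj, mul_comm, div_mul_cancel₀ _ hsL]
  obtain ⟨c, hc⟩ := Algebra.IsInvariant.isInvariant (A := A) (G := G) b fun g ↦ by
    apply mul_left_cancel₀ hsB
    rw [hsb]
    calc algebraMap A B s * g • b = (g • algebraMap A B s) * g • b := by rw [smul_algebraMap]
      _ = g • (algebraMap A B s * b) := (smul_mul' _ _ _).symm
      _ = algebraMap A B a := by rw [hsb, smul_algebraMap]
  refine ⟨c, ?_⟩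
  rw [eq_div_iff hsK, ← map_mul]
  congr 1
  apply hinj
  rw [map_mul, hc, mul_comm, hsb]

/-- On the ring of invariants of a finite group acting on a factorial ring, every prime of height
one is set-theoretically the zero locus of one function. -/
theorem exists_mem_forall_le_of_isInvariant (G : Type*) [Group G] [Finite G]
    [MulSemiringAction G B]
    [SMulCommClass G A B] [Algebra.IsInvariant A B G] [IsDomain B] [UniqueFactorizationMonoid B] [IsDomain A]
    (hinj : Function.Injective (algebraMap A B)) (P : Ideal A) [P.IsPrime] (hP : P.height = 1) :
    ∃ f ∈ P, f ≠ 0 ∧ ∀ P' : Ideal A, P'.IsPrime → f ∈ P' → P ≤ P' := by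
  have := Fintype.ofFinite G
  have hint := Algebra.IsInvariant.isIntegral A B G
  have hker : RingHom.ker (algebraMap A B) = ⊥ := (RingHom.injective_iff_ker_eq_bot _).1 hinj
  obtain ⟨Q, hQ, hQP⟩ := Ideal.exists_ideal_over_prime_of_isIntegral_of_isDomain (S := B) P
    (hker ▸ bot_le)
  have hPbot : P ≠ ⊥ := Ideal.ne_bot_of_height_eq_one hP
  have hQbot : Q ≠ ⊥ := by
    rintro rfl
    exact hPbot (by rw [← hQP]; exact hker)
  obtain ⟨q, hqQ, hq⟩ := hQ.exists_mem_prime_of_ne_bot hQbot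
  -- `f` is the norm of a prime element `q` of a prime `Q` lying over `P`.
  obtain ⟨f, hf⟩ := Algebra.IsInvariant.isInvariant (A := A) (G := G) (∏ g : G, g • q)
    (Finset.smul_prod_perm q)
  have hqf : q ∣ algebraMap A B f := by
    rw [hf]
    simpa using Finset.dvd_prod_of_mem (fun g : G ↦ g • q) (Finset.mem_univ 1)
  have hf0 : f ≠ 0 := by
    rintro rfl
    rw [map_zero] at hf
    obtain ⟨g, -, hg⟩ := Finset.prod_eq_zero_iff.1 hf.symm
    exact hq.ne_zero ((smul_eq_zero_iff_eq g).1 hg)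
  have hfP : f ∈ P := by
    rw [← hQP, Ideal.mem_comap]
    exact Ideal.mem_of_dvd _ hqf hqQ
  -- The contraction of `(q)` is a prime inside `P` containing `f ≠ 0`; since `P` has height one,
  -- they coincide.
  have hspan : (Ideal.span {q}).comap (algebraMap A B) = P := by
    have hqp : (Ideal.span {q}).IsPrime := (Ideal.span_singleton_prime hq.ne_zero).2 hq
    have hle : (Ideal.span {q}).comap (algebraMap A B) ≤ P := by
      rw [← hQP]
      exact Ideal.comap_mono ((Ideal.span_singleton_le_iff_mem _).2 hqQ)
    by_contra hne
    have hlt := lt_of_le_of_ne hle hne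
    have hp' : ((Ideal.span {q}).comap (algebraMap A B)).IsPrime := Ideal.comap_isPrime _ _
    have h1 := Ideal.height_add_one_le_of_lt_of_isPrime hlt
    rw [hP] at h1
    replace h1 : ((Ideal.span {q}).comap (algebraMap A B)).height = 0 := by
      by_contra h0
      have h2 : (1 : ℕ∞) + 1 ≤ 1 := (add_le_add_left (Order.one_le_iff_ne_zero.2 h0) 1).trans h1
      exact absurd h2 (by decide)
    rw [Ideal.height_eq_zero_iff_eq_bot] at h1
    have hf' : f ∈ (Ideal.span {q}).comap (algebraMap A B) := Ideal.mem_span_singleton.2 hqf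
    rw [h1] at hf'
    exact hf0 (by simpa using hf')
  refine ⟨f, hfP, hf0, fun P' hP' hfP' p hp ↦ ?_⟩
  obtain ⟨Q', hQ', hQP'⟩ := Ideal.exists_ideal_over_prime_of_isIntegral_of_isDomain (S := B) P'
    (hker ▸ bot_le)
  rw [← hQP', Ideal.mem_comap, hf] at hfP'
  -- A prime over `P'` contains some conjugate `g • q`. Elements of `P` are divisible by `q` and
  -- invariant, so they are divisible by `g • q` as well.
  obtain ⟨g, -, hg⟩ := hQ'.prod_mem_iff.1 hfP'
  rw [← hQP', Ideal.mem_comap]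
  rw [← hspan, Ideal.mem_comap, Ideal.mem_span_singleton] at hp
  obtain ⟨c, hc⟩ := hp
  rw [← smul_algebraMap g p, hc, smul_mul']
  exact Q'.mul_mem_right _ hg

/-- Chains of primes lift by lying over and going up, and strict chains stay strict under
contraction by incomparability. -/
theorem ringKrullDim_eq_of_isIntegral_of_injective {A B : Type*} [CommRing A] [CommRing B]
    [Algebra A B] [Algebra.IsIntegral A B] (hinj : Function.Injective (algebraMap A B)) :
    ringKrullDim A = ringKrullDim B := by
  refine le_antisymm (iSup_le fun l ↦ ?_) ?_
  · have : FaithfulSMul A B := (faithfulSMul_iff_algebraMap_injective A B).2 hinj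
    obtain ⟨P, hP⟩ := Algebra.IsIntegral.comap_surjective A B l.head
    have : P.asIdeal.LiesOver l.head.asIdeal := ⟨(congrArg PrimeSpectrum.asIdeal hP).symm⟩
    obtain ⟨L, hL, -⟩ := Ideal.exists_ltSeries_of_hasGoingUp l P.asIdeal
    rw [← hL]
    exact le_iSup (fun L : LTSeries (PrimeSpectrum B) ↦ (L.length : WithBot ℕ∞)) L
  · refine Order.krullDim_le_of_strictMono (PrimeSpectrum.comap (algebraMap A B)) fun P Q h ↦ ?_
    exact Ideal.IsIntegral.comap_lt_comap h

end Invariants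

/-! ### Orders of rational functions on normal schemes -/

section Divisors

open Order TopologicalSpace

variable {X : Scheme.{0}} [IsIntegral X]

theorem IsNormal.isIntegrallyClosed (hX : IsNormal X) {W : X.Opens}
    (hW : IsAffineOpen W) [Nonempty W] : IsIntegrallyClosed Γ(X, W) := by
  refine IsIntegrallyClosed.of_localization_maximal fun P _ hP ↦ ?_
  let p : PrimeSpectrum Γ(X, W) := ⟨P, hP.isPrime⟩
  have hyW : hW.fromSpec p ∈ W := by
    have : hW.fromSpec p ∈ Set.range hW.fromSpec := ⟨p, rfl⟩
    rwa [hW.range_fromSpec] at this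
  let := TopCat.Presheaf.algebra_section_stalk X.presheaf ⟨hW.fromSpec p, hyW⟩
  have : IsLocalization.AtPrime (X.presheaf.stalk (hW.fromSpec p)) P :=
    hW.isLocalization_stalk' p hyW
  have := hX (hW.fromSpec p)
  exact .of_equiv (IsLocalization.algEquiv P.primeCompl
    (X.presheaf.stalk (hW.fromSpec p)) (Localization.AtPrime P)).toRingEquiv

variable [IsLocallyNoetherian X]

theorem ord_one (y : X) : Scheme.ord (1 : X.functionField) y = 0 := by
  have := Scheme.ord_mul (X := X) (x := y) one_ne_zero one_ne_zero
  rw [_root_.mul_one] at this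
  omega

theorem ord_inv {f : X.functionField} (hf : f ≠ 0) (y : X) :
    Scheme.ord f⁻¹ y = - Scheme.ord f y := by
  have := Scheme.ord_mul (x := y) hf (inv_ne_zero hf)
  rw [mul_inv_cancel₀ hf, ord_one] at this
  omega

theorem isDiscreteValuationRing_stalk (hX : IsNormal X) {y : X} (hy : coheight y = 1) :
    IsDiscreteValuationRing (X.presheaf.stalk y) := by
  have hdim : ringKrullDim (X.presheaf.stalk y) = 1 := by
    rw [ringKrullDim_stalk_eq_coheight, hy]; rfl
  have hfield : ¬ IsField (X.presheaf.stalk y) := fun h ↦ by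
    rw [ringKrullDim_eq_zero_of_isField h] at hdim
    exact zero_ne_one hdim
  have : Ring.KrullDimLE 1 (X.presheaf.stalk y) := krullDimLE_of_coheight_le hy.le
  have hbot : IsLocalRing.maximalIdeal (X.presheaf.stalk y) ≠ ⊥ := fun h ↦
    hfield (IsLocalRing.isField_iff_maximalIdeal_eq.2 h)
  refine ((IsDiscreteValuationRing.TFAE _ hfield).out 0 3 rfl rfl).2
    ⟨hX y, IsLocalRing.maximalIdeal _, ⟨hbot, inferInstance⟩, fun P hP ↦ ?_⟩
  have hPp := hP.2
  exact IsLocalRing.eq_maximalIdeal (Ideal.IsPrime.isMaximal_of_ne_bot hPp hP.1)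

theorem exists_unit_of_ord_eq_zero (hX : IsNormal X) {y : X} (hy : coheight y = 1)
    {f : X.functionField} (hf : f ≠ 0) (h : Scheme.ord f y = 0) :
    ∃ u : (X.presheaf.stalk y)ˣ, algebraMap (X.presheaf.stalk y) X.functionField u = f := by
  have := isDiscreteValuationRing_stalk hX hy
  have : Ring.KrullDimLE 1 (X.presheaf.stalk y) := krullDimLE_of_coheight_le hy.le
  rw [Scheme.ord_eq_iff hy hf] at h
  obtain ⟨u, hu⟩ := Ring.associated_of_ordFrac_eq (R := X.presheaf.stalk y) 1 f
    (by rw [map_one]; exact h.symm)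
  exact ⟨u, by rw [← hu, Units.smul_def, Algebra.smul_def, _root_.mul_one]⟩

/-- A rational function without zeros and poles in codimension one on an affine open subset of a
normal scheme is a unit there. -/
theorem exists_isUnit_of_forall_ord_eq_zero (hX : IsNormal X) {W : X.Opens} (hW : IsAffineOpen W)
    [Nonempty W] {f : X.functionField} (hf : f ≠ 0) (h : ∀ y ∈ W, Scheme.ord f y = 0) :
    ∃ u : Γ(X, W)ˣ, X.germToFunctionField W u = f := by
  have hic := hX.isIntegrallyClosed hW
  have hnoeth : IsNoetherianRing Γ(X, W) := IsLocallyNoetherian.component_noetherian ⟨W, hW⟩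
  have := functionField_isFractionRing_of_isAffineOpen X W hW
  have key : ∀ g : X.functionField, g ≠ 0 → (∀ y ∈ W, Scheme.ord g y = 0) →
      ∃ a : Γ(X, W), algebraMap Γ(X, W) X.functionField a = g := by
    intro g hg hord
    refine exists_algebraMap_eq_of_forall_height_eq_one g fun P hP hht ↦ ?_
    let p : PrimeSpectrum Γ(X, W) := ⟨P, hP⟩
    let y := hW.fromSpec p
    have hyW : y ∈ W := by
      have : y ∈ Set.range hW.fromSpec := ⟨p, rfl⟩
      rwa [hW.range_fromSpec] at this
    have hy : coheight y = 1 := by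
      rw [← hht]
      exact (coheight_eq_of_isOpenImmersion hW.fromSpec).trans
        (idealHeight_eq_coheight (Γ(X, W)) p).symm
    obtain ⟨u, hu⟩ := exists_unit_of_ord_eq_zero hX hy hg (hord y hyW)
    let := TopCat.Presheaf.algebra_section_stalk X.presheaf ⟨y, hyW⟩
    have : IsLocalization.AtPrime (X.presheaf.stalk y) P := hW.isLocalization_stalk' p hyW
    obtain ⟨⟨a, s⟩, has⟩ := IsLocalization.surj P.primeCompl (u : X.presheaf.stalk y)
    have htower : IsScalarTower Γ(X, W) (X.presheaf.stalk y) X.functionField :=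
      functionField_isScalarTower X W ⟨y, hyW⟩
    refine ⟨a, s, s.2, ?_⟩
    rw [← hu, IsScalarTower.algebraMap_apply Γ(X, W) (X.presheaf.stalk y) X.functionField,
      IsScalarTower.algebraMap_apply Γ(X, W) (X.presheaf.stalk y) X.functionField, ← map_mul, has]
  obtain ⟨a, ha⟩ := key f hf h
  obtain ⟨b, hb⟩ := key f⁻¹ (inv_ne_zero hf) fun y hy ↦ by rw [ord_inv hf, h y hy, neg_zero]
  have hab : a * b = 1 := by
    apply IsFractionRing.injective Γ(X, W) X.functionField
    rw [map_mul, ha, hb, mul_inv_cancel₀ hf, map_one]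
  exact ⟨⟨a, b, hab, by rw [mul_comm, hab]⟩, ha⟩

omit [IsLocallyNoetherian X] in
-- Otherwise `y < z < genericPoint X` is a chain forcing coheight at least two.
theorem eq_of_specializes_of_coheight_eq_one {y z : X} (hy : coheight y = 1) (hz : z ⤳ y)
    (hne : z ≠ genericPoint X) : z = y := by
  by_contra h
  have h1 : y < z := lt_of_le_not_ge (show y ≤ z from hz) fun h' ↦
    h (Specializes.antisymm hz (show y ⤳ z from h')).eq
  have h2 : z < genericPoint X := lt_of_le_not_ge (show z ≤ genericPoint X from genericPoint_specializes z) fun h' ↦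
    hne (Specializes.antisymm (show z ⤳ genericPoint X from h') (genericPoint_specializes z)).eq
  have h3 := Order.coheight_add_one_le h1
  have h4 := Order.coheight_add_one_le h2
  rw [hy] at h3
  have h5 : (1 : ℕ∞) + 1 ≤ 1 := (add_le_add_left (le_trans le_add_self h4) 1).trans h3
  exact absurd h5 (by decide)

/-- `f` is a unit on a nonempty open set. A codimension one point outside of it must be the generic
point of one of the finitely many irreducible closed sets that make up the complement. -/
theorem finite_support_ord [CompactSpace X] {f : X.functionField} (hf : f ≠ 0) :
    {y : X | Scheme.ord f y ≠ 0}.Finite := by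
  have : IsNoetherian X := {}
  obtain ⟨U, -, f', hU, rfl, hunit⟩ := exists_isUnit_germ_eq X f hf
  obtain ⟨S, hfin, hcl, hirr, hS⟩ := NoetherianSpace.exists_finite_set_isClosed_irreducible
    (U.2.isClosed_compl)
  have hsub : {y : X | Scheme.ord (X.germToFunctionField U f') y ≠ 0} ⊆
      ⋃ t ∈ S, {y : X | closure {y} = t} := by
    intro y hy
    have hy1 : coheight y = 1 := by
      by_contra h
      exact hy (Scheme.ord_eq_zero_of_coheight_neq_one h _)
    have hyU : y ∈ (U : Set X)ᶜ := fun hyU ↦ hy (Scheme.ord_of_isUnit hunit hyU)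
    replace hyU : y ∈ (U.carrier)ᶜ := hyU
    rw [hS] at hyU
    obtain ⟨t, ht, hyt⟩ := hyU
    obtain ⟨z, hz⟩ := QuasiSober.sober (hirr t ht) (hcl t ht)
    have hzU : z ∈ (U.carrier)ᶜ := by
      rw [hS]
      exact ⟨t, ht, hz.mem⟩
    have hzy : z = y := by
      refine eq_of_specializes_of_coheight_eq_one hy1 (hz.specializes hyt) ?_
      rintro rfl
      obtain ⟨x⟩ := hU
      exact hzU (genericPoint_mem X x.2)
    exact Set.mem_biUnion ht (hzy ▸ hz)
  refine (hfin.biUnion fun t _ ↦ Set.Subsingleton.finite fun y hy z hz ↦ ?_).subset hsub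
  have : closure {y} = closure {z} := Eq.trans hy (Eq.symm hz)
  exact (inseparable_iff_closure_eq.2 this).eq

end Divisors

/-! ### Cartier divisors, Weil divisors and the Picard group -/

section Picard

open TopologicalSpace Opposite

variable (X : Scheme.{0}) [IsIntegral X]

/-- The sheaf of nonzero rational functions. -/
abbrev rationalUnits : Sheaf (Opens.grothendieckTopology X) AddCommGrpCat.{0} :=
  irreducibleConstantSheaf X (Additive X.functionFieldˣ)

/-- The sheaf of Cartier divisors. -/
abbrev cartierSheaf : Sheaf (Opens.grothendieckTopology X) AddCommGrpCat.{0} :=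
  Limits.cokernel (unitsSheafToConstant X)

/-- A nonzero rational function as a section of the sheaf of nonzero rational functions. -/
def constSection (U : X.Opens) : Additive X.functionFieldˣ →+ (rationalUnits X).obj.obj (op U) where
  toFun f := (⟨fun _ ↦ f, fun _ _ ↦ rfl⟩ : constantSections X (Additive X.functionFieldˣ) U)
  map_zero' := rfl
  map_add' _ _ := rfl

/-- The Cartier divisor on `U` of a nonzero rational function. -/
def cartierOf (U : X.Opens) : Additive X.functionFieldˣ →+ (cartierSheaf X).obj.obj (op U) :=
  ((Limits.cokernel.π (unitsSheafToConstant X)).hom.app (op U)).hom.comp (constSection X U)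

variable {X}

theorem map_cartierOf {U V : X.Opens} (i : op U ⟶ op V) (f : Additive X.functionFieldˣ) :
    (cartierSheaf X).obj.map i (cartierOf X U f) = cartierOf X V f :=
  (NatTrans.naturality_apply (Limits.cokernel.π (unitsSheafToConstant X)).hom i
    (constSection X U f)).symm

instance : Mono (unitsSheafToConstant X) := by
  have h : ∀ U, Mono ((unitsSheafToConstant X).hom.app U) := fun U ↦
    (AddCommGrpCat.mono_iff_injective _).mpr (unitsToConstant_injective X U.unop)
  have : Mono ((sheafToPresheaf _ _).map (unitsSheafToConstant X)) :=
    NatTrans.mono_of_mono_app (unitsSheafToConstant X).hom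
  exact (sheafToPresheaf _ _).mono_of_mono_map this

theorem cokernel_app_app_eq_zero (U : X.Opens) (t : (unitsSheaf X).obj.obj (op U)) :
    (Limits.cokernel.π (unitsSheafToConstant X)).hom.app (op U)
      ((unitsSheafToConstant X).hom.app (op U) t) = 0 :=
  ConcreteCategory.congr_hom
    (congrArg (fun g ↦ g.hom.app (op U)) (Limits.cokernel.condition (unitsSheafToConstant X))) t

variable (X) in
/-- The presentation of the sheaf of Cartier divisors. -/
abbrev cartierComplex : ShortComplex (Sheaf (Opens.grothendieckTopology X) AddCommGrpCat.{0}) :=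
  ShortComplex.mk (unitsSheafToConstant X) (Limits.cokernel.π _) (Limits.cokernel.condition _)

theorem cartierComplex_shortExact : (cartierComplex X).ShortExact where
  exact := ShortComplex.exact_cokernel _
  mono_f := inferInstanceAs (Mono (unitsSheafToConstant X))
  epi_g := inferInstanceAs (Epi (Limits.cokernel.π _))

/-- Left exactness of sections: the kernel of `Kˣ(U) → (Kˣ/𝒪ˣ)(U)` is `𝒪ˣ(U)`. -/
theorem cartierOf_eq_zero_iff {U : X.Opens} [Nonempty U] (f : Additive X.functionFieldˣ) :
    cartierOf X U f = 0 ↔ ∃ u : Γ(X, U)ˣ, X.germToFunctionField U u = (f.toMul : X.functionField) := by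
  constructor
  · intro h
    obtain ⟨u, hu⟩ := TopCat.Sheaf.sections_exact_of_left_exact (U := U)
      (cartierComplex_shortExact (X := X)).exact (cartierComplex_shortExact (X := X)).mono_f
      (constSection X U f) h
    obtain ⟨x⟩ := ‹Nonempty U›
    refine ⟨(show Additive Γ(X, U)ˣ from u).toMul, ?_⟩
    have := congrArg (fun w : Additive X.functionFieldˣ ↦ (w.toMul : X.functionField))
      (congrFun (congrArg Subtype.val (show unitsToConstant X U u = (⟨fun _ ↦ f, fun _ _ ↦ rfl⟩ :
        constantSections X (Additive X.functionFieldˣ) U) from hu)) x)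
    exact this
  · rintro ⟨u, hu⟩
    have h1 : constSection X U f = (unitsSheafToConstant X).hom.app (op U) (Additive.ofMul u) := by
      refine Subtype.ext (funext fun x ↦ ?_)
      exact congrArg Additive.ofMul (Units.ext hu.symm)
    change (Limits.cokernel.π (unitsSheafToConstant X)).hom.app (op U) (constSection X U f) = 0
    rw [h1]
    exact cokernel_app_app_eq_zero U _

/-- An epimorphism of sheaves is locally surjective, so a section of the quotient has local
equations. -/
theorem exists_cartierOf_eq {U : X.Opens} (q : (cartierSheaf X).obj.obj (op U)) {x : X}
    (hx : x ∈ U) : ∃ (V : X.Opens) (h : V ≤ U) (f : Additive X.functionFieldˣ), x ∈ V ∧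
      cartierOf X V f = (cartierSheaf X).obj.map (homOfLE h).op q := by
  have hepi := (cartierComplex_shortExact (X := X)).epi_g
  have := (TopCat.Sheaf.isLocallySurjective_iff_epi (cartierComplex X).g).mpr hepi
  obtain ⟨V, hV, ⟨s, hs⟩, hxV⟩ := (TopCat.Presheaf.isLocallySurjective_iff _).mp this U q x hx
  let s' : constantSections X (Additive X.functionFieldˣ) V := s
  refine ⟨V, hV, s'.1 ⟨x, hxV⟩, hxV, ?_⟩
  have h2 : constSection X V (s'.1 ⟨x, hxV⟩) = s := Subtype.ext (funext fun y ↦ s'.2 _ _)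
  change (Limits.cokernel.π (unitsSheafToConstant X)).hom.app (op V) (constSection X V _) = _
  rw [h2]
  exact hs

variable [IsLocallyNoetherian X]

theorem ord_congr_of_cartierOf_eq {U : X.Opens} {f g : Additive X.functionFieldˣ}
    (h : cartierOf X U f = cartierOf X U g) {y : X} (hy : y ∈ U) :
    Scheme.ord (f.toMul : X.functionField) y = Scheme.ord (g.toMul : X.functionField) y := by
  have : Nonempty U := ⟨⟨y, hy⟩⟩
  rw [← sub_eq_zero, ← map_sub, cartierOf_eq_zero_iff] at h
  obtain ⟨u, hu⟩ := h
  have h1 := Scheme.ord_of_isUnit u.isUnit hy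
  have h2 : (f.toMul : X.functionField) = X.germToFunctionField U u * (g.toMul : X.functionField) := by
    rw [hu, ← Units.val_mul]
    congr 1
    exact (div_mul_cancel f.toMul g.toMul).symm
  rw [h2, Scheme.ord_mul (by rw [hu]; exact Units.ne_zero _) (Units.ne_zero _), h1, zero_add]

/-- On each affine open set `f/g` has neither zeros nor poles in codimension one, hence is a unit by
normality. The sheaf property then globalizes the equality. -/
theorem cartierOf_eq_of_forall_ord_eq (hX : IsNormal X) {U : X.Opens}
    {f g : Additive X.functionFieldˣ}
    (h : ∀ y ∈ U, Scheme.ord (f.toMul : X.functionField) y =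
      Scheme.ord (g.toMul : X.functionField) y) :
    cartierOf X U f = cartierOf X U g := by
  have key : ∀ x : U, ∃ W : X.Opens, x.1 ∈ W ∧ W ≤ U ∧ cartierOf X W f = cartierOf X W g := by
    intro x
    obtain ⟨_, ⟨W, hW, rfl⟩, hxW, hWU⟩ :=
      X.isBasis_affineOpens.exists_subset_of_mem_open x.2 U.isOpen
    have : Nonempty W := ⟨⟨x.1, hxW⟩⟩
    refine ⟨W, hxW, hWU, ?_⟩
    rw [← sub_eq_zero, ← map_sub, cartierOf_eq_zero_iff]
    obtain ⟨u, hu⟩ := exists_isUnit_of_forall_ord_eq_zero hX hW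
      (f := ((f - g).toMul : X.functionField)) (Units.ne_zero _) fun y hy ↦ by
        have h2 : ((f - g).toMul : X.functionField) = f.toMul * (g.toMul : X.functionField)⁻¹ := by
          simp [div_eq_mul_inv]
        rw [h2, Scheme.ord_mul (Units.ne_zero _) (inv_ne_zero (Units.ne_zero _)),
          ord_inv (Units.ne_zero _), h y (hWU hy), add_neg_cancel]
    exact ⟨u, hu⟩
  choose W hxW hWU hW using key
  refine TopCat.Sheaf.eq_of_locally_eq' (cartierSheaf X) W U (fun x ↦ homOfLE (hWU x))
    (fun x hx ↦ Opens.mem_iSup.2 ⟨⟨x, hx⟩, hxW ⟨x, hx⟩⟩) _ _ fun x ↦ ?_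
  rw [map_cartierOf, map_cartierOf, hW]

variable (X) in
/-- Functions on the points of `X` that are locally the divisor of a rational function. -/
def locallyPrincipal : AddSubgroup (X → ℤ) where
  carrier := {D | ∀ x, ∃ U : X.Opens, x ∈ U ∧ ∃ f : X.functionField, f ≠ 0 ∧
    ∀ y ∈ U, D y = Scheme.ord f y}
  add_mem' {D E} hD hE x := by
    obtain ⟨U, hxU, f, hf, h⟩ := hD x
    obtain ⟨V, hxV, g, hg, h'⟩ := hE x
    exact ⟨U ⊓ V, ⟨hxU, hxV⟩, f * g, mul_ne_zero hf hg, fun y hy ↦ by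
      rw [Scheme.ord_mul hf hg, Pi.add_apply, h y hy.1, h' y hy.2]⟩
  zero_mem' x := ⟨⊤, trivial, 1, one_ne_zero, fun y _ ↦ (ord_one y).symm⟩
  neg_mem' {D} hD x := by
    obtain ⟨U, hxU, f, hf, h⟩ := hD x
    exact ⟨U, hxU, f⁻¹, inv_ne_zero hf, fun y hy ↦ by rw [ord_inv hf, Pi.neg_apply, h y hy]⟩

/-- A Cartier divisor has the local equation `f` on `U`. -/
def IsLocalEquation (q : (cartierSheaf X).obj.obj (op ⊤)) (U : X.Opens)
    (f : Additive X.functionFieldˣ) : Prop :=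
  cartierOf X U f = (cartierSheaf X).obj.map (homOfLE le_top : U ⟶ ⊤).op q

omit [IsLocallyNoetherian X] in
theorem exists_isLocalEquation (q : (cartierSheaf X).obj.obj (op ⊤)) (x : X) :
    ∃ U f, x ∈ U ∧ IsLocalEquation q U f := by
  obtain ⟨V, h, f, hx, hf⟩ := exists_cartierOf_eq q (x := x) trivial
  exact ⟨V, f, hx, hf⟩

omit [IsLocallyNoetherian X] in
theorem IsLocalEquation.mono {q : (cartierSheaf X).obj.obj (op ⊤)} {U V : X.Opens}
    {f : Additive X.functionFieldˣ} (h : IsLocalEquation q U f) (hVU : V ≤ U) :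
    IsLocalEquation q V f := by
  have := congrArg ((cartierSheaf X).obj.map (homOfLE hVU).op) h
  rw [map_cartierOf, ← CategoryTheory.comp_apply, ← Functor.map_comp] at this
  exact this

theorem IsLocalEquation.ord_eq {q : (cartierSheaf X).obj.obj (op ⊤)} {U V : X.Opens}
    {f g : Additive X.functionFieldˣ} (hf : IsLocalEquation q U f) (hg : IsLocalEquation q V g)
    {y : X} (hyU : y ∈ U) (hyV : y ∈ V) :
    Scheme.ord (f.toMul : X.functionField) y = Scheme.ord (g.toMul : X.functionField) y :=
  ord_congr_of_cartierOf_eq (U := U ⊓ V) ((hf.mono inf_le_left).trans (hg.mono inf_le_right).symm)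
    ⟨hyU, hyV⟩

/-- The Weil divisor of a Cartier divisor, as a function on points. -/
def weilFun (q : (cartierSheaf X).obj.obj (op ⊤)) (x : X) : ℤ :=
  Scheme.ord ((exists_isLocalEquation q x).choose_spec.choose.toMul : X.functionField) x

theorem IsLocalEquation.weilFun_eq {q : (cartierSheaf X).obj.obj (op ⊤)} {U : X.Opens}
    {f : Additive X.functionFieldˣ} (h : IsLocalEquation q U f) {y : X} (hy : y ∈ U) :
    weilFun q y = Scheme.ord (f.toMul : X.functionField) y :=
  (exists_isLocalEquation q y).choose_spec.choose_spec.2.ord_eq h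
    (exists_isLocalEquation q y).choose_spec.choose_spec.1 hy

variable (X) in
/-- The Weil divisor of a Cartier divisor, as a homomorphism. -/
def weilHom : (cartierSheaf X).obj.obj (op ⊤) →+ (X → ℤ) where
  toFun := weilFun
  map_zero' := by
    funext x
    have : IsLocalEquation (0 : (cartierSheaf X).obj.obj (op ⊤)) ⊤ 0 := by
      simp [IsLocalEquation]
    rw [this.weilFun_eq (y := x) trivial]
    exact ord_one x
  map_add' q r := by
    funext x
    obtain ⟨U, f, hxU, hf⟩ := exists_isLocalEquation q x
    obtain ⟨V, g, hxV, hg⟩ := exists_isLocalEquation r x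
    have hfg : IsLocalEquation (q + r) (U ⊓ V) (f + g) := by
      rw [IsLocalEquation, map_add, map_add, hf.mono inf_le_left, hg.mono inf_le_right]
    rw [hfg.weilFun_eq ⟨hxU, hxV⟩, Pi.add_apply, hf.weilFun_eq hxU, hg.weilFun_eq hxV]
    exact Scheme.ord_mul (Units.ne_zero _) (Units.ne_zero _)

theorem weilHom_cartierOf (f : Additive X.functionFieldˣ) :
    weilHom X (cartierOf X ⊤ f) = Scheme.ord (f.toMul : X.functionField) := by
  funext x
  exact IsLocalEquation.weilFun_eq (U := ⊤) (map_cartierOf _ f).symm trivial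

theorem weilHom_injective (hX : IsNormal X) : Function.Injective (weilHom X) := by
  intro q r h
  have key : ∀ x : X, ∃ W : X.Opens, x ∈ W ∧
      (cartierSheaf X).obj.map (homOfLE le_top : W ⟶ ⊤).op q =
      (cartierSheaf X).obj.map (homOfLE le_top : W ⟶ ⊤).op r := by
    intro x
    obtain ⟨U, f, hxU, hf⟩ := exists_isLocalEquation q x
    obtain ⟨V, g, hxV, hg⟩ := exists_isLocalEquation r x
    refine ⟨U ⊓ V, ⟨hxU, hxV⟩, ?_⟩
    rw [← hf.mono inf_le_left, ← hg.mono inf_le_right]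
    refine cartierOf_eq_of_forall_ord_eq hX fun y hy ↦ ?_
    rw [← hf.weilFun_eq hy.1, ← hg.weilFun_eq hy.2]
    exact congrFun h y
  choose W hxW hW using key
  exact TopCat.Sheaf.eq_of_locally_eq' (cartierSheaf X) W ⊤ (fun x ↦ homOfLE le_top)
    (fun x hx ↦ Opens.mem_iSup.2 ⟨x, hxW x⟩) _ _ hW

/-- Local equations of the same Weil divisor differ by units on a normal scheme, so the Cartier
divisors they define agree on overlaps and glue. -/
theorem range_weilHom (hX : IsNormal X) : (weilHom X).range = locallyPrincipal X := by
  ext D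
  constructor
  · rintro ⟨q, rfl⟩ x
    obtain ⟨U, f, hxU, hf⟩ := exists_isLocalEquation q x
    exact ⟨U, hxU, f.toMul, Units.ne_zero _, fun y hy ↦ hf.weilFun_eq hy⟩
  · intro hD
    choose U hxU f hf h using hD
    let f' : X → Additive X.functionFieldˣ := fun x ↦ .ofMul (Units.mk0 (f x) (hf x))
    obtain ⟨q, hq, -⟩ := TopCat.Sheaf.existsUnique_gluing' (cartierSheaf X) U ⊤
      (fun x ↦ homOfLE le_top) (fun x hx ↦ Opens.mem_iSup.2 ⟨x, hxU x⟩)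
      (fun x ↦ cartierOf X (U x) (f' x)) (fun x y ↦ by
        rw [map_cartierOf, map_cartierOf]
        refine cartierOf_eq_of_forall_ord_eq hX fun z hz ↦ ?_
        exact (h x z hz.1).symm.trans (h y z hz.2))
    refine ⟨q, funext fun x ↦ ?_⟩
    have : IsLocalEquation q (U x) (f' x) := (hq x).symm
    exact (this.weilFun_eq (hxU x)).trans (h x x (hxU x)).symm

/-- The Picard group of a normal scheme is the group of locally principal Weil divisors modulo
principal divisors. -/
theorem exists_surjective_hom_pic (hX : IsNormal X) :
    ∃ d : locallyPrincipal X →+ Pic X, Function.Surjective d ∧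
      ∀ D, d D = 0 ↔ ∃ f : X.functionField, f ≠ 0 ∧ D.1 = Scheme.ord f := by
  have : Subsingleton (Sheaf.H.{0} (cartierComplex X).X₂ 1) :=
    subsingleton_H_one_of_isFlasque (rationalUnits X)
  obtain ⟨δ, hδ, hker⟩ := exists_connecting_hom (cartierComplex_shortExact (X := X))
  let e : (cartierSheaf X).obj.obj (op ⊤) ≃+ locallyPrincipal X :=
    (AddMonoidHom.ofInjective (weilHom_injective hX)).trans
      (AddEquiv.addSubgroupCongr (range_weilHom hX))
  have he : ∀ q, (e q).1 = weilHom X q := fun q ↦ rfl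
  refine ⟨δ.comp e.symm.toAddMonoidHom, hδ.comp e.symm.surjective, fun D ↦ ?_⟩
  obtain ⟨q, rfl⟩ := e.surjective D
  have h1 : (δ.comp e.symm.toAddMonoidHom) (e q) = δ q := congrArg δ (e.symm_apply_apply q)
  rw [h1, hker, he]
  constructor
  · rintro ⟨t, rfl⟩
    let t' : constantSections X (Additive X.functionFieldˣ) ⊤ := t
    have h2 : constSection X ⊤ (t'.1 ⟨genericPoint X, trivial⟩) = t :=
      Subtype.ext (funext fun y ↦ t'.2 _ _)
    refine ⟨(t'.1 ⟨genericPoint X, trivial⟩).toMul, Units.ne_zero _, ?_⟩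
    rw [← weilHom_cartierOf, ← h2]
    rfl
  · rintro ⟨f, hf, h⟩
    refine ⟨constSection X ⊤ (.ofMul (Units.mk0 f hf)), weilHom_injective hX ?_⟩
    rw [h]
    exact weilHom_cartierOf (.ofMul (Units.mk0 f hf))

end Picard

/-! ### Torsion class groups on a cover, `ℚ`-factoriality and the Picard rank -/

section TorsionClassGroup

open Order

variable {X : Scheme.{0}} [IsIntegral X] [IsLocallyNoetherian X]

variable (X) in
/-- The divisor of a nonzero rational function, as a homomorphism. -/
def divHom : Additive X.functionFieldˣ →+ (X → ℤ) where
  toFun f := Scheme.ord (f.toMul : X.functionField)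
  map_zero' := funext fun y ↦ ord_one y
  map_add' _ _ := funext fun _ ↦ Scheme.ord_mul (Units.ne_zero _) (Units.ne_zero _)

/-- Every prime divisor on the open set `U` has a positive multiple that is principal on `U`. -/
def HasTorsionClassGroup (U : X.Opens) : Prop :=
  ∀ y ∈ U, coheight y = 1 → ∃ f : Additive X.functionFieldˣ,
    0 < divHom X f y ∧ ∀ z ∈ U, z ≠ y → divHom X f z = 0

theorem HasTorsionClassGroup.exists_multiple {U : X.Opens} (hU : HasTorsionClassGroup U)
    {D : X → ℤ} (hD : ∀ y, D y ≠ 0 → coheight y = 1) (hfin : {y | y ∈ U ∧ D y ≠ 0}.Finite) :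
    ∃ m : ℕ, 0 < m ∧ ∃ f : Additive X.functionFieldˣ, ∀ y ∈ U, (m : ℤ) * D y = divHom X f y := by
  classical
  have key : ∀ S : Finset X, (∀ y ∈ S, y ∈ U ∧ coheight y = 1) →
      ∃ m : ℕ, 0 < m ∧ ∃ f : Additive X.functionFieldˣ,
        ∀ y ∈ U, (m : ℤ) * (if y ∈ S then D y else 0) = divHom X f y := by
    intro S
    induction S using Finset.induction_on with
    | empty => exact fun _ ↦ ⟨1, one_pos, 0, fun y _ ↦ by simp⟩
    | insert x S hx ih =>
      intro h
      obtain ⟨m, hm, f, hf⟩ := ih fun y hy ↦ h y (Finset.mem_insert_of_mem hy)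
      obtain ⟨hxU, hx1⟩ := h x (Finset.mem_insert_self _ _)
      obtain ⟨g, hgx, hg⟩ := hU x hxU hx1
      obtain ⟨k, hk⟩ := Int.eq_ofNat_of_zero_le hgx.le
      -- With `k = ord_x g`, the term `(m * D x) • g` has order `k * m * D x` at `x` and order zero
      -- elsewhere on `U`. Multiplying the old data by `k` matches the multiples.
      refine ⟨k * m, Nat.mul_pos (by omega) hm, (k : ℤ) • f + (m * D x) • g, fun y hy ↦ ?_⟩
      rw [map_add, map_zsmul, map_zsmul]
      simp only [Pi.add_apply, Pi.smul_apply, smul_eq_mul, ← hf y hy]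
      by_cases hyx : y = x
      · subst hyx
        simp [hx, hk]
        ring
      · simp [hyx, hg y hy hyx]
        split_ifs <;> ring
  obtain ⟨m, hm, f, hf⟩ := key hfin.toFinset fun y hy ↦ by
    have := hfin.mem_toFinset.1 hy
    exact ⟨this.1, hD y this.2⟩
  refine ⟨m, hm, f, fun y hy ↦ ?_⟩
  rw [← hf y hy]
  by_cases h : D y = 0 <;> simp [h, hy]

/-- A multiple of a Weil divisor is Cartier on a scheme with a finite cover by open sets with
torsion class group. -/
theorem exists_nsmul_mem_locallyPrincipal {I : Type*} [Finite I] {U : I → X.Opens}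
    (hcov : ∀ x, ∃ i, x ∈ U i) (hU : ∀ i, HasTorsionClassGroup (U i))
    {D : X → ℤ} (hD : ∀ y, D y ≠ 0 → coheight y = 1) (hfin : ∀ i, {y | y ∈ U i ∧ D y ≠ 0}.Finite) :
    ∃ m : ℕ, 0 < m ∧ m • D ∈ locallyPrincipal X := by
  classical
  have := Fintype.ofFinite I
  choose m hm f hf using fun i ↦ (hU i).exists_multiple hD (hfin i)
  refine ⟨∏ i, m i, Finset.prod_pos fun i _ ↦ hm i, fun x ↦ ?_⟩
  obtain ⟨i, hi⟩ := hcov x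
  obtain ⟨k, hk⟩ := Finset.dvd_prod_of_mem m (Finset.mem_univ i)
  refine ⟨U i, hi, ((k • f i).toMul : X.functionField), Units.ne_zero _, fun y hy ↦ ?_⟩
  change _ = divHom X (k • f i) y
  simp only [map_nsmul, Pi.smul_apply, nsmul_eq_mul]
  rw [← hf i y hy, hk]
  push_cast
  ring

theorem isQFactorial_of_hasTorsionClassGroup [CompactSpace X] (hX : IsNormal X) {I : Type*}
    [Finite I] {U : I → X.Opens} (hcov : ∀ x, ∃ i, x ∈ U i)
    (hU : ∀ i, HasTorsionClassGroup (U i)) : IsQFactorial X := by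
  have : IsNoetherian X := {}
  refine ⟨hX, inferInstance, inferInstance, fun D hD ↦ ?_⟩
  obtain ⟨m, hm, h⟩ := exists_nsmul_mem_locallyPrincipal hcov hU (D := D) hD fun i ↦
    (D.locallyFiniteSupport.finite_inter_support_of_isCompact
      (TopologicalSpace.NoetherianSpace.isCompact (U i : Set X)))
  refine ⟨m, hm, fun x ↦ ?_⟩
  obtain ⟨V, hV, f, hf, h'⟩ := h x
  exact ⟨V, hV, f, hf, fun y hy ↦ by rw [← h' y hy]; simp⟩

theorem ord_eq_zero_or_coheight_eq_one {f : X.functionField} {y : X} (h : Scheme.ord f y ≠ 0) :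
    coheight y = 1 := by
  by_contra h1
  exact h (Scheme.ord_eq_zero_of_coheight_neq_one h1 _)

theorem coheight_eq_one_of_mem_locallyPrincipal {D : X → ℤ} (hD : D ∈ locallyPrincipal X) {y : X}
    (h : D y ≠ 0) : coheight y = 1 := by
  obtain ⟨U, hy, f, -, hf⟩ := hD y
  exact ord_eq_zero_or_coheight_eq_one (f := f) (hf y hy ▸ h)

theorem finite_support_of_mem_locallyPrincipal [CompactSpace X] {D : X → ℤ}
    (hD : D ∈ locallyPrincipal X) : {y | D y ≠ 0}.Finite := by
  choose U hU f hf h using hD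
  obtain ⟨t, ht⟩ := isCompact_univ.elim_finite_subcover (fun x ↦ (U x : Set X))
    (fun x ↦ (U x).isOpen) (fun x _ ↦ Set.mem_iUnion.2 ⟨x, hU x⟩)
  refine (t.finite_toSet.biUnion fun x _ ↦ finite_support_ord (hf x)).subset fun y hy ↦ ?_
  obtain ⟨x, hx, hyx⟩ := Set.mem_iUnion₂.1 (ht (Set.mem_univ y))
  exact Set.mem_biUnion hx (by
    change Scheme.ord (f x) y ≠ 0
    rw [← h x y hyx]
    exact hy)

/-- The Picard rank of a normal scheme with torsion local class groups that has an open subset with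
torsion class group, without nonconstant units, and with exactly two prime divisors in its
complement. -/
theorem picardRank_eq_two [CompactSpace X] (hX : IsNormal X) {I : Type*}
    [Finite I] {U : I → X.Opens} (hcov : ∀ x, ∃ i, x ∈ U i)
    (hU : ∀ i, HasTorsionClassGroup (U i)) (i₀ : I)
    (hunit : ∀ f : Additive X.functionFieldˣ, (∀ y ∈ U i₀, divHom X f y = 0) → divHom X f = 0)
    {p q : X} (hpq : p ≠ q) (hp : coheight p = 1) (hq : coheight q = 1) (hpU : p ∉ U i₀)
    (hqU : q ∉ U i₀) (hcompl : ∀ y, coheight y = 1 → y ∉ U i₀ → y = p ∨ y = q) :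
    picardRank X = 2 := by
  classical
  obtain ⟨d, hd, hker⟩ := exists_surjective_hom_pic hX
  have hsingle : ∀ x : X, coheight x = 1 → ∃ m : ℕ, 0 < m ∧
      m • (Pi.single x 1 : X → ℤ) ∈ locallyPrincipal X := fun x hx ↦
    exists_nsmul_mem_locallyPrincipal hcov hU (fun y hy ↦ by
      by_cases h : y = x
      · rw [h, hx]
      · simp [h] at hy) fun i ↦ (Set.finite_singleton x).subset fun y hy ↦ by
        by_contra h
        exact hy.2 (by simp [show y ≠ x from h])
  obtain ⟨m, hm, hmD⟩ := hsingle p hp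
  obtain ⟨n, hn, hnD⟩ := hsingle q hq
  let Dp : locallyPrincipal X := ⟨_, hmD⟩
  let Dq : locallyPrincipal X := ⟨_, hnD⟩
  -- The Cartier divisors `m[p]` and `n[q]` span a subgroup of `Pic X`; it is shown to be free of
  -- rank two with torsion quotient.
  let L : ℤ × ℤ →ₗ[ℤ] Pic X :=
    (LinearMap.toSpanSingleton ℤ (Pic X) (d Dp)).coprod (LinearMap.toSpanSingleton ℤ (Pic X) (d Dq))
  have hL : ∀ i j : ℤ, L (i, j) = d (i • Dp + j • Dq) := fun i j ↦ by
    simp [L]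
  have hval : ∀ (i j : ℤ) (y : X), (i • Dp + j • Dq : locallyPrincipal X).1 y =
      i * (m * (Pi.single p 1 : X → ℤ) y) + j * (n * (Pi.single q 1 : X → ℤ) y) := fun i j y ↦ by
    simp [Dp, Dq]
  have hLinj : Function.Injective L := by
    refine (injective_iff_map_eq_zero L).2 fun ⟨i, j⟩ h ↦ ?_
    rw [hL, hker] at h
    obtain ⟨f, hf, h⟩ := h
    -- A relation is the divisor of a function without zeros or poles on `U i₀`; by `hunit` this
    -- divisor vanishes everywhere, and so do both coefficients.
    have hf0 : divHom X (.ofMul (Units.mk0 f hf)) = 0 := hunit _ fun y hy ↦ by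
      change Scheme.ord f y = 0
      rw [← congrFun h y, hval]
      have h1 : y ≠ p := fun h ↦ hpU (h ▸ hy)
      have h2 : y ≠ q := fun h ↦ hqU (h ▸ hy)
      simp [h1, h2]
    have h0 : ∀ y, (i • Dp + j • Dq : locallyPrincipal X).1 y = 0 := fun y ↦
      (congrFun h y).trans (congrFun hf0 y)
    have hp0 := h0 p
    have hq0 := h0 q
    rw [hval] at hp0 hq0
    simp [hpq, hpq.symm] at hp0 hq0
    ext
    · exact hp0.resolve_right hm.ne'
    · exact hq0.resolve_right hn.ne'
  have htors : ∀ z : Pic X, ∃ k : ℤ, k ≠ 0 ∧ k • z ∈ LinearMap.range L := by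
    intro z
    obtain ⟨D, rfl⟩ := hd z
    obtain ⟨k, hk, f, hf⟩ := (hU i₀).exists_multiple (D := D.1)
      (fun y hy ↦ coheight_eq_one_of_mem_locallyPrincipal D.2 hy)
      ((finite_support_of_mem_locallyPrincipal D.2).subset fun y hy ↦ hy.2)
    have hfmem : divHom X f ∈ locallyPrincipal X := fun x ↦
      ⟨⊤, trivial, f.toMul, Units.ne_zero _, fun _ _ ↦ rfl⟩
    let F : locallyPrincipal X := ⟨_, hfmem⟩
    have hF : d F = 0 := (hker F).2 ⟨f.toMul, Units.ne_zero _, rfl⟩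
    -- `E` has the class of `k • D` and is trivial on `U i₀`, so it is supported on `{p, q}`.
    -- Multiplying by `m * n` makes both of its coefficients divisible as needed.
    let E : locallyPrincipal X := k • D - F
    have hE : E.1 = fun y ↦ k * D.1 y - divHom X f y := by
      funext y
      simp [E, F]
    have hEU : ∀ y ∈ U i₀, E.1 y = 0 := fun y hy ↦ by
      rw [hE]
      simp [hf y hy]
    have hEval : (m * n : ℤ) • E = (n * E.1 p) • Dp + (m * E.1 q) • Dq := by
      refine Subtype.ext (funext fun y ↦ ?_)
      rw [hval]
      change (m * n : ℤ) * E.1 y = _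
      by_cases h1 : y = p
      · subst h1
        simp [hpq]
        ring
      by_cases h2 : y = q
      · subst h2
        simp [hpq.symm]
        ring
      have : E.1 y = 0 := by
        by_contra h0
        have h3 := coheight_eq_one_of_mem_locallyPrincipal E.2 h0
        have h4 : y ∉ U i₀ := fun h ↦ h0 (hEU y h)
        rcases hcompl y h3 h4 with h | h
        exacts [h1 h, h2 h]
      simp [h1, h2, this]
    refine ⟨m * n * k, by positivity, (n * E.1 p, m * E.1 q), ?_⟩
    rw [hL, ← hEval, map_zsmul, map_sub, hF, sub_zero, map_nsmul]
    simp only [mul_smul, natCast_zsmul]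
  have hrange : Module.rank ℤ (LinearMap.range L) = 2 := by
    rw [← LinearEquiv.rank_eq (LinearEquiv.ofInjective L hLinj)]
    simp [one_add_one_eq_two]
  have hquot : Module.rank ℤ (Pic X ⧸ LinearMap.range L) = 0 := by
    rw [rank_eq_zero_iff]
    intro z
    obtain ⟨z, rfl⟩ := Submodule.Quotient.mk_surjective _ z
    obtain ⟨k, hk, h⟩ := htors z
    exact ⟨k, hk, by rw [← Submodule.Quotient.mk_smul, Submodule.Quotient.mk_eq_zero]; exact h⟩
  have := Submodule.rank_quotient_add_rank (LinearMap.range L)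
  rw [hrange, hquot, zero_add] at this
  exact this.symm

end TorsionClassGroup

/-! ### Gluing morphisms along a dense part -/

section Glue

open Limits

/-- Morphisms on the members of an open cover of a reduced scheme to a separated scheme glue if
they agree on a common dense part. -/
theorem exists_hom_of_isDominant {S X Y W : Scheme.{0}} [IsReduced X] (𝒰 : X.OpenCover)
    (s : Y ⟶ S) [IsSeparated s] (g : ∀ i, 𝒰.X i ⟶ Y) (x : X ⟶ S)
    (hg : ∀ i, g i ≫ s = 𝒰.f i ≫ x) (t : W ⟶ X) [IsDominant t] (t' : ∀ i, W ⟶ 𝒰.X i)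
    (ht : ∀ i, t' i ≫ 𝒰.f i = t) (c : W ⟶ Y) (hc : ∀ i, t' i ≫ g i = c) :
    ∃ f : X ⟶ Y, ∀ i, 𝒰.f i ≫ f = g i := by
  refine ⟨𝒰.glueMorphisms g fun i j ↦ ?_, fun i ↦ 𝒰.ι_glueMorphisms _ _ i⟩
  -- `W` maps to each overlap with dense image, so on the reduced overlap two morphisms to a
  -- separated scheme agree as soon as they agree on `W`.
  obtain ⟨l, hl₁, hl₂⟩ : ∃ l : W ⟶ pullback (𝒰.f i) (𝒰.f j),
      l ≫ pullback.fst _ _ = t' i ∧ l ≫ pullback.snd _ _ = t' j :=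
    ⟨pullback.lift (t' i) (t' j) ((ht i).trans (ht j).symm), pullback.lift_fst _ _ _,
      pullback.lift_snd _ _ _⟩
  have hl : l ≫ (pullback.fst _ _ ≫ 𝒰.f i) = t := by rw [← Category.assoc, hl₁, ht]
  have : IsDominant (l ≫ (pullback.fst (𝒰.f i) (𝒰.f j) ≫ 𝒰.f i)) := hl ▸ ‹_›
  have : IsDominant l := .of_comp_of_isOpenImmersion l (pullback.fst (𝒰.f i) (𝒰.f j) ≫ 𝒰.f i)
  have : IsReduced (pullback (𝒰.f i) (𝒰.f j)) :=
    isReduced_of_isOpenImmersion (pullback.fst (𝒰.f i) (𝒰.f j) ≫ 𝒰.f i)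
  refine ext_of_isDominant_of_isSeparated s ?_ l ?_
  · rw [Category.assoc, Category.assoc, hg, hg, pullback.condition_assoc]
  · rw [← Category.assoc, ← Category.assoc, hl₁, hl₂, hc, hc]

end Glue

/-! ### Extending the torus multiplication to an action -/

section TorusAction

instance : Subsingleton pt := inferInstanceAs (Subsingleton (PrimeSpectrum ℂ))

/-- `K[ℤⁿ]` is reduced for every field `K` over `ℂ`. This keeps `T × X` reduced, which density
arguments on products require. -/
instance (n : ℕ) : GeometricallyReduced (torus n).hom where
  geometrically_isReduced := by
    change geometrically _ (Spec.map (CommRingCat.ofHom (algebraMap ℂ _)))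
    rw [geometrically_iff_of_commRing_of_isClosedUnderIsomorphisms]
    intro K _ _
    have e : (TensorProduct ℂ (AddMonoidAlgebra ℂ (Fin n → ℤ)) K) ≃ₐ[ℂ]
        AddMonoidAlgebra K (Fin n → ℤ) := (Algebra.TensorProduct.comm ℂ _ _).trans
      ((AddMonoidAlgebra.scalarTensorEquiv (M := Fin n → ℤ) ℂ K).restrictScalars ℂ)
    have : _root_.IsReduced (TensorProduct ℂ (AddMonoidAlgebra ℂ (Fin n → ℤ)) K) :=
      isReduced_of_injective e e.injective
    exact isReduced_of_isOpenImmersion (pullbackSpecIso ℂ (AddMonoidAlgebra ℂ (Fin n → ℤ)) K).hom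

variable {X Y Z : Over pt}

theorem isReduced_tensor [IsReduced X.left] [IsLocallyNoetherian X.left]
    [GeometricallyReduced Y.hom] : IsReduced (Y ⊗ X).left :=
  inferInstanceAs (IsReduced (Limits.pullback Y.hom X.hom))

theorem isLocallyNoetherian_tensor [IsLocallyNoetherian X.left]
    [LocallyOfFiniteType Y.hom] : IsLocallyNoetherian (Y ⊗ X).left :=
  LocallyOfFiniteType.isLocallyNoetherian (Limits.pullback.snd Y.hom X.hom)

theorem isPullback_whiskerLeft (f : X ⟶ Z) :
    IsPullback (Y ◁ f).left (Limits.pullback.snd Y.hom X.hom) (Limits.pullback.snd Y.hom Z.hom)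
      f.left := by
  refine IsPullback.of_right (h₁₂ := Limits.pullback.fst Y.hom Z.hom) (h₂₂ := Z.hom)
    (v₁₃ := Y.hom) ?_ (Over.whiskerLeft_left_snd f) (IsPullback.of_hasPullback Y.hom Z.hom)
  rw [Over.whiskerLeft_left_fst, Over.w]
  exact IsPullback.of_hasPullback Y.hom X.hom

/-- The projection `Y × Z → Z` is open over a field, so the preimage of a dense set is dense. -/
theorem isDominant_whiskerLeft (f : X ⟶ Z) [IsDominant f.left] : IsDominant (Y ◁ f).left := by
  have h := isPullback_whiskerLeft (Y := Y) f
  have hd : Dense ((Limits.pullback.snd Y.hom Z.hom) ⁻¹' Set.range f.left) :=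
    f.left.denseRange.preimage (Limits.pullback.snd Y.hom Z.hom).isOpenMap
  rw [← Scheme.Pullback.range_fst] at hd
  have : IsDominant (Limits.pullback.fst (Limits.pullback.snd Y.hom Z.hom) f.left) := ⟨hd⟩
  rw [← h.isoPullback_hom_fst]
  infer_instance

theorem isOpenImmersion_whiskerLeft (f : X ⟶ Z) [IsOpenImmersion f.left] :
    IsOpenImmersion (Y ◁ f).left :=
  MorphismProperty.of_isPullback (isPullback_whiskerLeft f).flip ‹_›


/-- The affine toric monoid scheme `Spec ℂ[S]` of a commutative monoid `S`. -/
abbrev affineToric (S : Type) [AddCommMonoid S] : Over pt :=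
  (Spec (.of (AddMonoidAlgebra ℂ S))).asOver (Spec (.of ℂ))

instance (S : Type) [AddCommMonoid S] : MonObj (affineToric S) :=
  inferInstanceAs (MonObj ((Spec (.of (AddMonoidAlgebra ℂ S))).asOver (Spec (.of ℂ))))

/-- The morphism of affine toric monoid schemes induced by a homomorphism of monoids. -/
def affineToricMap {S S' : Type} [AddCommMonoid S] [AddCommMonoid S'] (α : S →+ S') :
    affineToric S' ⟶ affineToric S :=
  ((bialgSpec (.of ℂ)).map (.op (CommBialgCat.ofHom
    (AddMonoidAlgebra.mapDomainBialgHom ℂ α)))).hom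

instance {S S' : Type} [AddCommMonoid S] [AddCommMonoid S'] (α : S →+ S') :
    IsMonHom (affineToricMap α) :=
  ((bialgSpec (.of ℂ)).map (.op (CommBialgCat.ofHom
    (AddMonoidAlgebra.mapDomainBialgHom ℂ α)))).isMonHom_hom

/-- The action of a torus on a variety covered by affine toric charts. -/
theorem exists_torus_action {X : Over pt} [IsReduced X.left] [IsLocallyNoetherian X.left]
    [IsSeparated X.hom] {n : ℕ} (j : torus n ⟶ X) [IsDominant j.left] {I : Type} {S : I → Type}
    [∀ i, AddCommMonoid (S i)] (α : ∀ i, S i →+ (Fin n → ℤ)) (κ : ∀ i, affineToric (S i) ⟶ X)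
    [∀ i, IsOpenImmersion (κ i).left] (hκ : ∀ x, ∃ i, x ∈ Set.range (κ i).left)
    (hj : ∀ i, affineToricMap (α i) ≫ κ i = j) :
    ∃ act : torus n ⊗ X ⟶ X,
      (η[torus n] ▷ X) ≫ act = (λ_ X).hom ∧
      (μ[torus n] ▷ X) ≫ act = (α_ (torus n) (torus n) X).hom ≫ (torus n ◁ act) ≫ act ∧
      (torus n ◁ j) ≫ act = μ[torus n] ≫ j := by
  have hfin : LocallyOfFiniteType (torus n).hom :=
    locallyOfFiniteType_specOverSpec (R := .of ℂ) (A := .of (AddMonoidAlgebra ℂ (Fin n → ℤ)))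
  have hred : IsReduced (torus n ⊗ X).left := isReduced_tensor
  have hnoe : IsLocallyNoetherian (torus n ⊗ X).left := isLocallyNoetherian_tensor
  have hred' : IsReduced (torus n ⊗ torus n ⊗ X).left := isReduced_tensor
  have hred'' : IsReduced ((torus n ⊗ torus n) ⊗ X).left :=
    have : IsIso (α_ (torus n) (torus n) X).hom.left :=
      inferInstanceAs (IsIso ((Over.forget pt).map (α_ (torus n) (torus n) X).hom))
    isReduced_of_isOpenImmersion (α_ (torus n) (torus n) X).hom.left
  have hred₁ : IsReduced (𝟙_ (Over pt) ⊗ X).left :=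
    have : IsIso (λ_ X).hom.left := inferInstanceAs (IsIso ((Over.forget pt).map (λ_ X).hom))
    isReduced_of_isOpenImmersion (λ_ X).hom.left
  have hopen (i : I) : IsOpenImmersion (torus n ◁ κ i).left := isOpenImmersion_whiskerLeft _
  have hdom {Y : Over pt} : IsDominant (Y ◁ j).left := isDominant_whiskerLeft _
  have hsurj (y : (torus n ⊗ X).left) : ∃ i, y ∈ Set.range (torus n ◁ κ i).left := by
    obtain ⟨i, hi⟩ := hκ (Limits.pullback.snd (torus n).hom X.hom y)
    refine ⟨i, ?_⟩
    rw [← (isPullback_whiskerLeft (Y := torus n) (κ i)).isoPullback_hom_fst, Scheme.Hom.comp_base,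
      TopCat.coe_comp, (Scheme.Hom.surjective _).range_comp, Scheme.Pullback.range_fst]
    exact hi
  let 𝒰 : (torus n ⊗ X).left.OpenCover := .mkOfCovers I _ (fun i ↦ (torus n ◁ κ i).left)
      hsurj (fun i ↦ hopen i)
  -- The torus maps to the monoid scheme `Spec ℂ[S i]` and acts on it through the multiplication
  -- there.
  let a (i : I) : torus n ⊗ affineToric (S i) ⟶ affineToric (S i) :=
    (affineToricMap (α i) ▷ _) ≫ μ
  have ha (i : I) : (torus n ◁ affineToricMap (α i)) ≫ a i = μ ≫ affineToricMap (α i) := by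
    simp only [a]
    rw [← Category.assoc, ← tensorHom_def', IsMonHom.mul_hom]
  have ht (i : I) : (torus n ◁ affineToricMap (α i)) ≫ (torus n ◁ κ i) = torus n ◁ j := by
    rw [← MonoidalCategory.whiskerLeft_comp, hj]
  have hc (i : I) : (torus n ◁ affineToricMap (α i)) ≫ a i ≫ κ i = μ ≫ j := by
    rw [← Category.assoc, ha, Category.assoc, hj]
  obtain ⟨f, hf⟩ : ∃ f : (torus n ⊗ X).left ⟶ X.left,
      ∀ i, (torus n ◁ κ i).left ≫ f = (a i ≫ κ i).left :=
    exists_hom_of_isDominant 𝒰 X.hom (fun i : I ↦ (a i ≫ κ i).left) (torus n ⊗ X).hom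
      (fun i : I ↦ (Over.w (a i ≫ κ i)).trans (Over.w (torus n ◁ κ i)).symm) (torus n ◁ j).left
      (fun i : I ↦ (torus n ◁ affineToricMap (α i)).left)
      (fun i : I ↦ congrArg Over.Hom.left (ht i)) (μ[torus n] ≫ j).left
      (fun i : I ↦ congrArg Over.Hom.left (hc i))
  have hover : f ≫ X.hom = (torus n ⊗ X).hom :=
    𝒰.hom_ext _ _ fun i : I ↦ by
      refine (Category.assoc _ _ _).symm.trans ((congrArg (· ≫ X.hom) (hf i)).trans ?_)
      exact (Over.w (a i ≫ κ i)).trans (Over.w (torus n ◁ κ i)).symm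
  let act : torus n ⊗ X ⟶ X := Over.homMk f hover
  have hact (i : I) : (torus n ◁ κ i) ≫ act = a i ≫ κ i := Over.OverMorphism.ext (hf i)
  have hjact : (torus n ◁ j) ≫ act = μ[torus n] ≫ j := by
    obtain ⟨i⟩ : Nonempty I := by
      let x : (torus n).left := (⊥ : PrimeSpectrum (AddMonoidAlgebra ℂ (Fin n → ℤ)))
      obtain ⟨i, -⟩ := hκ (j.left x)
      exact ⟨i⟩
    rw [← hj i, MonoidalCategory.whiskerLeft_comp, Category.assoc, hact, ← Category.assoc, ha,
      Category.assoc]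
  refine ⟨act, ?_, ?_, hjact⟩
  -- Both axioms are equalities of morphisms from a reduced to a separated scheme. They may be
  -- checked after restricting the last factor to the dense torus, where they are the monoid laws of
  -- the torus.
  · refine Over.OverMorphism.ext (ext_of_isDominant_of_isSeparated X.hom ((Over.w _).trans (Over.w _).symm)
      (𝟙_ (Over pt) ◁ j).left ?_)
    rw [← Over.comp_left, ← Over.comp_left, whisker_exchange_assoc, hjact, leftUnitor_naturality,
      ← MonObj.one_mul, Category.assoc]
  · refine Over.OverMorphism.ext (ext_of_isDominant_of_isSeparated X.hom ((Over.w _).trans (Over.w _).symm)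
      ((torus n ⊗ torus n) ◁ j).left ?_)
    rw [← Over.comp_left, ← Over.comp_left, whisker_exchange_assoc, hjact]
    simp only [tensor_whiskerLeft, Category.assoc, Iso.inv_hom_id_assoc]
    rw [← MonoidalCategory.whiskerLeft_comp_assoc, hjact, MonoidalCategory.whiskerLeft_comp_assoc,
      hjact, MonObj.mul_assoc_assoc]

end TorusAction

/-! ### Quotients of affine space by diagonal cyclic group actions -/

section CyclicQuotient

/-- Every prime of height one is the radical of a principal ideal. -/
def HasPrincipalDivisors (A : Type*) [CommRing A] : Prop :=
  ∀ P : Ideal A, P.IsPrime → P.height = 1 → ∃ f ∈ P, f ≠ 0 ∧ ∀ P' : Ideal A, P'.IsPrime → f ∈ P' → P ≤ P'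

/-- The group of `N`-th roots of unity. -/
def RootGroup (N : ℕ) : Type := rootsOfUnity N ℂ

instance (N : ℕ) : Group (RootGroup N) := inferInstanceAs (Group (rootsOfUnity N ℂ))

instance (N : ℕ) [NeZero N] : Finite (RootGroup N) := inferInstanceAs (Finite (rootsOfUnity N ℂ))

/-- The value of a root of unity. -/
def RootGroup.val {N : ℕ} : RootGroup N →* ℂ := (Units.coeHom ℂ).comp (rootsOfUnity N ℂ).subtype

theorem RootGroup.val_pow_eq_one {N : ℕ} (g : RootGroup N) : g.val ^ N = 1 := by
  have := (mem_rootsOfUnity' N g.1).1 g.2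
  exact this

variable {τ : Type} (N : ℕ) (w : τ → ℕ)

/-- The linear diagonal action of the `N`-th roots of unity with weights `w`. -/
def rootAct (g : RootGroup N) : MvPolynomial τ ℂ →ₐ[ℂ] MvPolynomial τ ℂ :=
  MvPolynomial.aeval fun i ↦ MvPolynomial.C (g.val ^ w i) * MvPolynomial.X i

variable {N}

theorem rootAct_monomial (g : RootGroup N) (e : τ →₀ ℕ) (c : ℂ) :
    rootAct N w g (MvPolynomial.monomial e c) =
      MvPolynomial.monomial e (g.val ^ Finsupp.weight w e * c) := by
  rw [rootAct, MvPolynomial.aeval_monomial, MvPolynomial.algebraMap_eq]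
  have h : ∏ i ∈ e.support, (g.val ^ w i) ^ e i = g.val ^ Finsupp.weight w e := by
    simp only [← pow_mul, Finset.prod_pow_eq_pow_sum, Finsupp.weight_apply, Finsupp.sum,
      smul_eq_mul, _root_.mul_comm (w _)]
  rw [MvPolynomial.monomial_eq, Finsupp.prod, Finsupp.prod, ← h]
  simp only [mul_pow, Finset.prod_mul_distrib, ← MvPolynomial.C_pow, ← map_prod, map_mul]
  ring

theorem coeff_rootAct (g : RootGroup N) (e : τ →₀ ℕ) (p : MvPolynomial τ ℂ) :
    (rootAct N w g p).coeff e = g.val ^ Finsupp.weight w e * p.coeff e := by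
  classical
  induction p using MvPolynomial.induction_on' with
  | monomial u c =>
    rw [rootAct_monomial, MvPolynomial.coeff_monomial, MvPolynomial.coeff_monomial]
    split_ifs with h
    · rw [h]
    · simp
  | add p q hp hq => simp [hp, hq, mul_add]

/-- The action of the roots of unity on the polynomial ring. -/
abbrev rootAction : MulSemiringAction (RootGroup N) (MvPolynomial τ ℂ) where
  smul g := rootAct N w g
  one_smul p := MvPolynomial.ext _ _ fun e ↦ by
    refine (coeff_rootAct w 1 e p).trans ?_
    simp
  mul_smul g h p := MvPolynomial.ext _ _ fun e ↦ by
    refine (coeff_rootAct w (g * h) e p).trans ?_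
    refine Eq.trans ?_ (coeff_rootAct w g e (rootAct N w h p)).symm
    rw [coeff_rootAct, map_mul, mul_pow, _root_.mul_assoc]
  smul_zero g := map_zero (rootAct N w g)
  smul_add g := map_add (rootAct N w g)
  smul_one g := map_one (rootAct N w g)
  smul_mul g := map_mul (rootAct N w g)

variable {S : Type} [AddCommMonoid S] (β : S →+ (τ →₀ ℕ)) 

/-- The embedding of a monoid algebra into a polynomial ring. -/
def toMvPolynomial : AddMonoidAlgebra ℂ S →ₐ[ℂ] MvPolynomial τ ℂ :=
  AddMonoidAlgebra.mapDomainAlgHom ℂ ℂ β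

theorem toMvPolynomial_single (s : S) (c : ℂ) :
    toMvPolynomial β (AddMonoidAlgebra.single s c) = MvPolynomial.monomial (β s) c :=
  AddMonoidAlgebra.mapDomain_single

variable {β} (hβ : Function.Injective β)

include hβ in
theorem toMvPolynomial_injective : Function.Injective (toMvPolynomial β) :=
  AddMonoidAlgebra.mapDomain_injective hβ

variable (hrange : ∀ e, e ∈ Set.range β ↔ N ∣ Finsupp.weight w e)

include hβ in
theorem isDomain_of_injective : IsDomain (AddMonoidAlgebra ℂ S) :=
  (toMvPolynomial_injective hβ).isDomain (toMvPolynomial β).toRingHom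

theorem rootAct_toMvPolynomial (h : ∀ s, N ∣ Finsupp.weight w (β s)) (g : RootGroup N)
    (x : AddMonoidAlgebra ℂ S) : rootAct N w g (toMvPolynomial β x) = toMvPolynomial β x := by
  suffices (rootAct N w g).comp (toMvPolynomial β) = toMvPolynomial β from
    DFunLike.congr_fun this x
  ext s
  obtain ⟨k, hk⟩ := h s
  refine congrArg (MvPolynomial.coeff _) ?_
  change rootAct N w g (toMvPolynomial β (.single s 1)) = toMvPolynomial β (.single s 1)
  rw [toMvPolynomial_single, rootAct_monomial, hk, pow_mul, g.val_pow_eq_one, one_pow,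
    _root_.one_mul]

/-- A primitive `N`-th root of unity `ζ` multiplies the coefficient at `e` by `ζ` to the weight of
`e`; invariance forces `N` to divide the weight wherever the coefficient is nonzero. -/
theorem exists_toMvPolynomial_eq [NeZero N] (h : ∀ e, N ∣ Finsupp.weight w e → e ∈ Set.range β)
    (p : MvPolynomial τ ℂ) (hp : ∀ g : RootGroup N, rootAct N w g p = p) :
    ∃ x, toMvPolynomial β x = p := by
  change p ∈ (toMvPolynomial β).range
  rw [p.as_sum]
  refine Subalgebra.sum_mem _ fun e he ↦ ?_
  have hN : N ∣ Finsupp.weight w e := by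
    let ζ := Complex.isPrimitiveRoot_exp N (NeZero.ne N)
    let g : RootGroup N := (rootsOfUnity.mkOfPowEq (Complex.exp (2 * Real.pi * Complex.I / N)) ζ.pow_eq_one)
    have hg : g.val = Complex.exp (2 * Real.pi * Complex.I / N) := rfl
    have := congrArg (MvPolynomial.coeff e) (hp g)
    rw [coeff_rootAct, hg] at this
    exact ζ.dvd_of_pow_eq_one _ (mul_right_cancel₀ (MvPolynomial.mem_support_iff.1 he)
      (this.trans (_root_.one_mul _).symm))
  obtain ⟨s, rfl⟩ := h e hN
  exact ⟨.single s _, toMvPolynomial_single _ _ _⟩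

include hβ hrange in
/-- The ring of invariants of a linear diagonal action of a cyclic group. -/
theorem cyclicQuotient_properties [NeZero N] [Finite τ] [IsNoetherianRing (AddMonoidAlgebra ℂ S)]:
    IsIntegrallyClosed (AddMonoidAlgebra ℂ S) ∧ HasPrincipalDivisors (AddMonoidAlgebra ℂ S) ∧
      ringKrullDim (AddMonoidAlgebra ℂ S) = Nat.card τ := by
  have := isDomain_of_injective hβ
  let _ : Algebra (AddMonoidAlgebra ℂ S) (MvPolynomial τ ℂ) := (toMvPolynomial β).toRingHom.toAlgebra
  let _ : MulSemiringAction (RootGroup N) (MvPolynomial τ ℂ) := rootAction w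
  have hinj : Function.Injective (algebraMap (AddMonoidAlgebra ℂ S) (MvPolynomial τ ℂ)) :=
    toMvPolynomial_injective hβ
  have hcomm : SMulCommClass (RootGroup N) (AddMonoidAlgebra ℂ S) (MvPolynomial τ ℂ) := ⟨fun g x p ↦ by
    change rootAct N w g (toMvPolynomial β x * p) = toMvPolynomial β x * rootAct N w g p
    rw [map_mul, rootAct_toMvPolynomial w (fun s ↦ (hrange _).1 ⟨s, rfl⟩)]⟩
  have hinv : Algebra.IsInvariant (AddMonoidAlgebra ℂ S) (MvPolynomial τ ℂ) (RootGroup N) :=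
    ⟨fun p hp ↦ exists_toMvPolynomial_eq w (fun e ↦ (hrange e).2) p hp⟩
  have hint := Algebra.IsInvariant.isIntegral (AddMonoidAlgebra ℂ S) (MvPolynomial τ ℂ) (RootGroup N)
  refine ⟨isIntegrallyClosed_of_isInvariant (RootGroup N) hinj, fun P hP h ↦
    exists_mem_forall_le_of_isInvariant (RootGroup N) hinj P h, ?_⟩
  rw [ringKrullDim_eq_of_isIntegral_of_injective hinj,
    MvPolynomial.ringKrullDim_of_isNoetherianRing, ringKrullDim_eq_zero_of_field, zero_add]

include hβ in
-- Units of a polynomial ring over a field are constants, and the monoid algebra embeds in one.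
theorem exists_eq_single_of_isUnit {x : AddMonoidAlgebra ℂ S} (hx : IsUnit x) :
    ∃ c : ℂ, x = algebraMap ℂ _ c := by
  obtain ⟨c, -, hc⟩ := MvPolynomial.isUnit_iff_eq_C_of_isReduced.1 (hx.map (toMvPolynomial β))
  refine ⟨c, toMvPolynomial_injective hβ ?_⟩
  rw [AlgHom.commutes, hc]
  rfl

end CyclicQuotient

/-! ### Degree zero localizations mapped to a ring where the denominator is invertible -/

section AwayHom

open HomogeneousLocalization

variable {R σ : Type} [CommRing R] [SetLike σ R] [AddSubgroupClass σ R] (𝒜 : ℕ → σ) [GradedRing 𝒜]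
  {L : Type} [CommRing L] (φ : R →+* L) {f g : R}

/-- The homomorphism from the degree zero part of `R_f` induced by a homomorphism inverting `f`. -/
def awayHom (hf : IsUnit (φ f)) : Away 𝒜 f →+* L :=
  (Localization.awayLift φ f hf).comp (algebraMap (Away 𝒜 f) (Localization.Away f))

variable {φ}

theorem awayHom_mk_mul (hf : IsUnit (φ f)) {d : ℕ} (hd : f ∈ 𝒜 d) (n : ℕ) (x : R)
    (hx : x ∈ 𝒜 (n • d)) : awayHom 𝒜 φ hf (Away.mk 𝒜 hd n x hx) * φ f ^ n = φ x := by
  change Localization.awayLift φ f hf (Away.mk 𝒜 hd n x hx).val * φ f ^ n = φ x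
  rw [Away.val_mk, ← map_pow]
  have h : algebraMap R (Localization.Away f) (f ^ n) *
      (Localization.mk x (⟨f ^ n, ⟨n, rfl⟩⟩ : Submonoid.powers f) : Localization.Away f) =
      algebraMap R (Localization.Away f) x := by
    rw [Localization.mk_eq_mk']
    exact IsLocalization.mk'_spec' (Localization.Away f) x
      (⟨f ^ n, ⟨n, rfl⟩⟩ : Submonoid.powers f)
  have h2 (y : R) : Localization.awayLift φ f hf (algebraMap R (Localization.Away f) y) = φ y :=
    IsLocalization.Away.lift_eq f hf y
  rw [← h2 x, ← h, map_mul, h2, _root_.mul_comm]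

theorem awayHom_awayMap {e : ℕ} (hg : g ∈ 𝒜 e) {x : R} (hx : x = f * g) (hf : IsUnit (φ f))
    (hxu : IsUnit (φ x)) (z : Away 𝒜 f) :
    awayHom 𝒜 φ hxu (awayMap 𝒜 hg hx z) = awayHom 𝒜 φ hf z := by
  change Localization.awayLift φ x hxu (awayMap 𝒜 hg hx z).val = Localization.awayLift φ f hf z.val
  rw [val_awayMap]
  change ((Localization.awayLift φ x hxu).comp (Localization.awayLift (algebraMap R _) f _)) z.val = _
  congr 1
  refine IsLocalization.ringHom_ext (Submonoid.powers f) (RingHom.ext fun y ↦ ?_)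
  simp only [RingHom.comp_apply]
  have h1 : Localization.awayLift (algebraMap R (Localization.Away x)) f
      (isUnit_of_dvd_unit (map_dvd _ ⟨_, hx⟩) (IsLocalization.Away.algebraMap_isUnit x))
      (algebraMap R (Localization.Away f) y) = algebraMap R (Localization.Away x) y :=
    IsLocalization.Away.lift_eq ..
  have h2 : Localization.awayLift φ x hxu (algebraMap R (Localization.Away x) y) = φ y :=
    IsLocalization.Away.lift_eq ..
  have h3 : Localization.awayLift φ f hf (algebraMap R (Localization.Away f) y) = φ y :=
    IsLocalization.Away.lift_eq ..
  rw [h1, h2, h3]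

theorem awayHom_fromZeroRingHom (hf : IsUnit (φ f)) (z : 𝒜 0) :
    awayHom 𝒜 φ hf (fromZeroRingHom 𝒜 _ z) = φ z :=
  IsLocalization.Away.lift_eq f hf (z : R)

theorem awayHom_injective (hφ : Function.Injective φ) (hf : IsUnit (φ f)) :
    Function.Injective (awayHom 𝒜 φ hf) := by
  refine Function.Injective.comp (g := Localization.awayLift φ f hf) ?_ (val_injective _)
  refine (IsLocalization.lift_injective_iff _).2 fun x y ↦ ?_
  refine ⟨fun h ↦ ?_, fun h ↦ ?_⟩
  · obtain ⟨⟨_, n, rfl⟩, hc⟩ := (IsLocalization.eq_iff_exists (Submonoid.powers f) _).1 h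
    have := congrArg φ hc
    rw [map_mul, map_mul, map_pow] at this
    exact (hf.pow n).mul_left_cancel this
  · rw [hφ h]

variable {m m' : ℕ}

/-- Both composites factor through the common chart `D₊(fg)`. This is the compatibility that lets
chartwise morphisms be glued. -/
theorem SpecMap_awayHom_awayι (hf : f ∈ 𝒜 m) (hm : 0 < m) (hg : g ∈ 𝒜 m') (hm' : 0 < m')
    (hfu : IsUnit (φ f)) (hgu : IsUnit (φ g)) :
    Spec.map (CommRingCat.ofHom (awayHom 𝒜 φ hfu)) ≫ Proj.awayι 𝒜 f hf hm =
      Spec.map (CommRingCat.ofHom (awayHom 𝒜 φ hgu)) ≫ Proj.awayι 𝒜 g hg hm' := by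
  have key {f g x : R} {m m' k : ℕ} (hf : f ∈ 𝒜 m) (hm : 0 < m) (hg : g ∈ 𝒜 m')
      (hfu : IsUnit (φ f)) (hx : x = f * g) (hk : k = m + m') (hxk : x ∈ 𝒜 k) (hk0 : 0 < k)
      (hxu : IsUnit (φ x)) :
      Spec.map (CommRingCat.ofHom (awayHom 𝒜 φ hfu)) ≫ Proj.awayι 𝒜 f hf hm =
      Spec.map (CommRingCat.ofHom (awayHom 𝒜 φ hxu)) ≫ Proj.awayι 𝒜 x hxk hk0 := by
    subst hk
    rw [← Proj.SpecMap_awayMap_awayι 𝒜 hf hm hg hx, ← Category.assoc, ← Spec.map_comp,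
      ← CommRingCat.ofHom_comp]
    congr 3
    exact RingHom.ext fun z ↦ (awayHom_awayMap 𝒜 hg hx hfu hxu z).symm
  have hu : IsUnit (φ (f * g)) := map_mul φ f g ▸ hfu.mul hgu
  have hfg : f * g ∈ 𝒜 (m + m') := SetLike.mul_mem_graded hf hg
  rw [key hf hm hg hfu rfl rfl hfg (by omega) hu,
    key hg hm' hf hgu (_root_.mul_comm f g) (_root_.add_comm m m') hfg (by omega) hu]

end AwayHom

/-! ### Charts of `Proj` of a ring spanned by monomials -/

section MonomialChart

open HomogeneousLocalization

/-- Two injective ring homomorphisms with the same range have isomorphic sources. -/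
theorem exists_ringEquiv_of_range_eq {A B L : Type} [CommRing A] [CommRing B] [CommRing L]
    {φ : A →+* L} {ψ : B →+* L} (hφ : Function.Injective φ) (hψ : Function.Injective ψ)
    (h : φ.range = ψ.range) : ∃ e : A ≃+* B, ∀ x, ψ (e x) = φ x := by
  let e₁ := RingEquiv.ofBijective φ.rangeRestrict
    ⟨fun x y h ↦ hφ (congrArg Subtype.val h), φ.rangeRestrict_surjective⟩
  let e₂ := RingEquiv.ofBijective ψ.rangeRestrict
    ⟨fun x y h ↦ hψ (congrArg Subtype.val h), ψ.rangeRestrict_surjective⟩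
  refine ⟨(e₁.trans (RingEquiv.subringCongr h)).trans e₂.symm, fun x ↦ ?_⟩
  have := congrArg Subtype.val (e₂.apply_symm_apply (RingEquiv.subringCongr h (e₁ x)))
  exact this

variable {R Λ S : Type} [CommRing R] [Algebra ℂ R] (𝒜 : ℕ → Submodule ℂ R) [GradedAlgebra 𝒜]
  [AddCommGroup Λ] [AddCommMonoid S] {Θ : R →ₐ[ℂ] AddMonoidAlgebra ℂ Λ} {P : ℕ → Set Λ}

/-- The affine charts of `Proj` of an algebra spanned by monomials are spectra of monoid
algebras. -/
theorem exists_ringEquiv_away (hΘ : Function.Injective Θ)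
    (hP : ∀ n, (𝒜 n).map Θ.toLinearMap =
      Submodule.span ℂ ((fun m ↦ AddMonoidAlgebra.single m 1) '' P n))
    {f : R} {d : ℕ} (hd : f ∈ 𝒜 d) {w : Λ} (hf : Θ f = AddMonoidAlgebra.single w 1)
    (hu : IsUnit ((Θ : R →+* AddMonoidAlgebra ℂ Λ) f)) {α : S →+ Λ} (hα : Function.Injective α)
    (hrange : ∀ m, m ∈ Set.range α ↔ ∃ k : ℕ, m + k • w ∈ P (k • d)) :
    ∃ e : AddMonoidAlgebra ℂ S ≃+* Away 𝒜 f,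
      ∀ x, awayHom 𝒜 (Θ : R →+* AddMonoidAlgebra ℂ Λ) hu (e x) =
        AddMonoidAlgebra.mapDomainRingHom ℂ α x := by
  have hpow (n : ℕ) : (Θ : R →+* AddMonoidAlgebra ℂ Λ) f ^ n =
      AddMonoidAlgebra.single (n • w) 1 := by
    change Θ f ^ n = _
    rw [hf, AddMonoidAlgebra.single_pow, one_pow]
  -- Both rings embed in the Laurent ring, and both images are spanned by the monomials `m` for
  -- which `m + k • w` is a monomial of degree `k • d` for some `k`.
  refine exists_ringEquiv_of_range_eq (AddMonoidAlgebra.mapDomain_injective hα)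
    (awayHom_injective 𝒜 hΘ hu) (le_antisymm ?_ ?_)
  · rintro _ ⟨x, rfl⟩
    induction x using AddMonoidAlgebra.induction_linear with
    | zero => rw [map_zero]; exact zero_mem _
    | add x y hx hy => rw [map_add]; exact add_mem hx hy
    | single s c =>
      obtain ⟨k, hk⟩ := (hrange (α s)).1 ⟨s, rfl⟩
      have hmem : AddMonoidAlgebra.single (α s + k • w) (1 : ℂ) ∈ (𝒜 (k • d)).map Θ.toLinearMap := by
        rw [hP]
        exact Submodule.subset_span ⟨_, hk, rfl⟩
      obtain ⟨x, hx, hxs⟩ := hmem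
      refine ⟨Away.mk 𝒜 hd k (c • x) (Submodule.smul_mem _ c hx), (hu.pow k).mul_right_cancel ?_⟩
      rw [awayHom_mk_mul, hpow]
      change Θ (c • x) = AddMonoidAlgebra.mapDomain α (AddMonoidAlgebra.single s c) * _
      rw [map_smul, show Θ x = _ from hxs, AddMonoidAlgebra.mapDomain_single,
        AddMonoidAlgebra.single_mul_single, AddMonoidAlgebra.smul_single, smul_eq_mul]
  · rintro _ ⟨z, rfl⟩
    obtain ⟨n, x, hx, rfl⟩ := Away.mk_surjective 𝒜 hd z
    have hmem : Θ x ∈ Submodule.span ℂ ((fun m ↦ AddMonoidAlgebra.single m 1) '' P (n • d)) := by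
      rw [← hP]
      exact ⟨x, hx, rfl⟩
    have hz : awayHom 𝒜 (Θ : R →+* AddMonoidAlgebra ℂ Λ) hu (Away.mk 𝒜 hd n x hx) =
        Θ x * AddMonoidAlgebra.single (-(n • w)) 1 := by
      refine (hu.pow n).mul_right_cancel ?_
      rw [awayHom_mk_mul, hpow, _root_.mul_assoc, AddMonoidAlgebra.single_mul_single,
        neg_add_cancel, _root_.mul_one]
      exact (_root_.mul_one _).symm
    rw [hz]
    clear hz
    generalize Θ x = y at hmem
    induction hmem using Submodule.span_induction with
    | mem y hy =>
      obtain ⟨m, hm, rfl⟩ := hy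
      obtain ⟨s, hs⟩ := (hrange (m + -(n • w))).2 ⟨n, by simpa using hm⟩
      refine ⟨AddMonoidAlgebra.single s 1, ?_⟩
      refine AddMonoidAlgebra.mapDomain_single.trans ?_
      rw [AddMonoidAlgebra.single_mul_single, hs, _root_.mul_one]
    | zero => rw [zero_mul]; exact zero_mem _
    | add y y' _ _ h h' => rw [add_mul]; exact add_mem h h'
    | smul c y _ h =>
      rw [smul_mul_assoc, Algebra.smul_def]
      refine mul_mem ⟨algebraMap ℂ _ c, ?_⟩ h
      exact (AddMonoidAlgebra.mapDomainAlgHom ℂ ℂ α).commutes c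

end MonomialChart

/-! ### Row and column sums of monomials -/

section Margins

/-- Pairs of multisets of the same size are the margins of a multiset of pairs. -/
theorem exists_multiset_of_card_eq {α β : Type*} (s : Multiset α) (t : Multiset β)
    (h : s.card = t.card) :
    ∃ r : Multiset (α × β), r.map Prod.fst = s ∧ r.map Prod.snd = t := by
  induction s using Multiset.induction generalizing t with
  | empty => exact ⟨0, rfl, (Multiset.card_eq_zero.1 h.symm).symm⟩
  | cons i s ih =>
    obtain ⟨j, t, rfl⟩ : ∃ j t', t = j ::ₘ t' := by
      obtain ⟨j, hj⟩ := Multiset.card_pos_iff_exists_mem.1 (h ▸ by simp : 0 < t.card)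
      exact ⟨j, Multiset.exists_cons_of_mem hj⟩
    obtain ⟨r, rfl, rfl⟩ := ih t (by simpa using h)
    exact ⟨(i, j) ::ₘ r, by simp, by simp⟩

/-- Monomials in variables satisfying the determinantal relations depend on their margins only. -/
theorem prod_eq_of_map_eq {α β Q : Type*} [CommMonoid Q] (x : α × β → Q)
    (hx : ∀ i k j l, x (i, j) * x (k, l) = x (i, l) * x (k, j)) (s t : Multiset (α × β))
    (h₁ : s.map Prod.fst = t.map Prod.fst) (h₂ : s.map Prod.snd = t.map Prod.snd) :
    (s.map x).prod = (t.map x).prod := by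
  classical
  induction s using Multiset.induction generalizing t with
  | empty =>
    rw [Multiset.map_zero, eq_comm, Multiset.map_eq_zero] at h₁
    rw [h₁]
  | cons p s ih =>
    obtain ⟨i, j⟩ := p
    by_cases hmem : (i, j) ∈ t
    · obtain ⟨t, rfl⟩ := Multiset.exists_cons_of_mem hmem
      simp only [Multiset.map_cons, Multiset.prod_cons] at h₁ h₂ ⊢
      rw [ih t ((Multiset.cons_inj_right _).1 h₁) ((Multiset.cons_inj_right _).1 h₂)]
    · obtain ⟨⟨i', l⟩, hl, rfl⟩ := Multiset.mem_map.1 (h₁ ▸ Multiset.mem_map_of_mem Prod.fst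
        (Multiset.mem_cons_self (i, j) s) : i ∈ t.map Prod.fst)
      obtain ⟨⟨k, j'⟩, hk, rfl⟩ := Multiset.mem_map.1 (h₂ ▸ Multiset.mem_map_of_mem Prod.snd
        (Multiset.mem_cons_self (i', j) s) : j ∈ t.map Prod.snd)
      obtain ⟨t, rfl⟩ := Multiset.exists_cons_of_mem hl
      rcases Multiset.mem_cons.1 hk with h | hk
      · exact (hmem (Multiset.mem_cons.2 (.inl (Prod.ext rfl (Prod.ext_iff.1 h).2)))).elim
      · obtain ⟨t, rfl⟩ := Multiset.exists_cons_of_mem hk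
        simp only [Multiset.map_cons, Multiset.prod_cons] at h₁ h₂ ⊢
        rw [ih ((k, l) ::ₘ t) ?_ ?_]
        · simp only [Multiset.map_cons, Multiset.prod_cons]
          rw [← _root_.mul_assoc, hx, _root_.mul_assoc]
        · simpa using h₁
        · rw [Multiset.cons_swap] at h₂
          simpa using h₂

end Margins

/-! ### The coordinate ring of the Segre cone as a monomial ring -/

section CoordinateRing

open MvPolynomial

/-- Pairs of exponent vectors, for the rows and for the columns. -/
abbrev Expo : Type := (Fin 3 → ℤ) × (Fin 3 → ℤ)

/-- The exponent vector of the variable in position `p`. -/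
def unitExpo (p : Fin 3 × Fin 3) : Expo := (Pi.single p.1 1, Pi.single p.2 1)

/-- The margins of an exponent matrix. -/
def margins : (Fin 3 × Fin 3 →₀ ℕ) →+ Expo := Finsupp.weight unitExpo

theorem margins_single (p : Fin 3 × Fin 3) (n : ℕ) : margins (.single p n) = n • unitExpo p :=
  Finsupp.weight_single ..

theorem margins_fst (e : Fin 3 × Fin 3 →₀ ℕ) (i : Fin 3) :
    (margins e).1 i = (e.mapDomain Prod.fst i : ℤ) := by
  induction e using Finsupp.induction_linear with
  | zero => simp
  | add e e' h h' => simp [h, h', Finsupp.mapDomain_add]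
  | single p n =>
    rw [margins_single, Finsupp.mapDomain_single]
    simp [unitExpo, Finsupp.single_apply, Pi.single_apply, eq_comm]

theorem margins_snd (e : Fin 3 × Fin 3 →₀ ℕ) (j : Fin 3) :
    (margins e).2 j = (e.mapDomain Prod.snd j : ℤ) := by
  induction e using Finsupp.induction_linear with
  | zero => simp
  | add e e' h h' => simp [h, h', Finsupp.mapDomain_add]
  | single p n =>
    rw [margins_single, Finsupp.mapDomain_single]
    simp [unitExpo, Finsupp.single_apply, Pi.single_apply, eq_comm]

/-- For the converse, list rows and columns with the prescribed multiplicities; the lists have equal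
length, and any pairing of them is an exponent matrix. -/
theorem mem_range_margins {m : Expo} :
    m ∈ Set.range margins ↔ (∀ i, 0 ≤ m.1 i) ∧ (∀ j, 0 ≤ m.2 j) ∧ ∑ i, m.1 i = ∑ j, m.2 j := by
  constructor
  · rintro ⟨e, rfl⟩
    refine ⟨fun i ↦ by simp [margins_fst], fun j ↦ by simp [margins_snd], ?_⟩
    induction e using Finsupp.induction_linear with
    | zero => simp
    | add e e' h h' => simp only [map_add, Prod.fst_add, Prod.snd_add, Pi.add_apply,
        Finset.sum_add_distrib, h, h']
    | single p n => simp [margins_single, unitExpo, ← Finset.mul_sum]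
  · rintro ⟨h₁, h₂, h⟩
    let u : Fin 3 →₀ ℕ := Finsupp.equivFunOnFinite.symm fun i ↦ (m.1 i).toNat
    let v : Fin 3 →₀ ℕ := Finsupp.equivFunOnFinite.symm fun j ↦ (m.2 j).toNat
    have huv : u.toMultiset.card = v.toMultiset.card := by
      rw [Finsupp.card_toMultiset, Finsupp.card_toMultiset, Finsupp.sum_fintype _ _ (by simp),
        Finsupp.sum_fintype _ _ (by simp)]
      zify
      simpa [u, v, h₁, h₂] using h
    obtain ⟨r, hr₁, hr₂⟩ := exists_multiset_of_card_eq _ _ huv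
    obtain ⟨e, rfl⟩ : ∃ e, Finsupp.toMultiset e = r :=
      ⟨Multiset.toFinsupp r, Multiset.toFinsupp_toMultiset r⟩
    rw [Finsupp.toMultiset_map] at hr₁ hr₂
    have hu := by simpa using congrArg Multiset.toFinsupp hr₁
    have hv := by simpa using congrArg Multiset.toFinsupp hr₂
    refine ⟨e, Prod.ext (funext fun i ↦ ?_) (funext fun j ↦ ?_)⟩
    · simp [margins_fst, hu, u, h₁]
    · simp [margins_snd, hv, v, h₂]

/-- The homogeneous coordinate ring. -/
abbrev CoordRing : Type := MatrixRing ⧸ minorsIdeal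

/-- The class of the variable in position `p`. -/
def coord (p : Fin 3 × Fin 3) : CoordRing := Ideal.Quotient.mk minorsIdeal (X p)

theorem coord_mul_coord (i k j l : Fin 3) :
    coord (i, j) * coord (k, l) = coord (i, l) * coord (k, j) := by
  rw [coord, coord, coord, coord, ← map_mul, ← map_mul, Ideal.Quotient.eq]
  exact Ideal.subset_span ⟨i, k, j, l, rfl⟩

theorem mk_monomial_eq (e : Fin 3 × Fin 3 →₀ ℕ) :
    Ideal.Quotient.mk minorsIdeal (monomial e 1) = (e.toMultiset.map coord).prod := by
  induction e using Finsupp.induction_linear with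
  | zero => simp
  | add e e' h h' =>
    rw [← _root_.one_mul (1 : ℂ), ← monomial_mul, map_mul, h, h', map_add, Multiset.map_add,
      Multiset.prod_add]
  | single p n =>
    rw [← X_pow_eq_monomial, map_pow, Finsupp.toMultiset_single, Multiset.map_nsmul,
      Multiset.prod_nsmul, Multiset.map_singleton, Multiset.prod_singleton, coord]

theorem mk_monomial_eq_of_margins_eq {e e' : Fin 3 × Fin 3 →₀ ℕ} (h : margins e = margins e') :
    Ideal.Quotient.mk minorsIdeal (monomial e 1) = Ideal.Quotient.mk minorsIdeal (monomial e' 1) := by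
  rw [mk_monomial_eq, mk_monomial_eq]
  refine prod_eq_of_map_eq coord coord_mul_coord _ _ ?_ ?_
  · rw [Finsupp.toMultiset_map, Finsupp.toMultiset_map]
    congr 1
    ext i
    have := congrArg (fun m : Expo ↦ m.1 i) h
    simpa [margins_fst] using this
  · rw [Finsupp.toMultiset_map, Finsupp.toMultiset_map]
    congr 1
    ext i
    have := congrArg (fun m : Expo ↦ m.2 i) h
    simpa [margins_snd] using this

/-- The torus parametrization of the cone over the variety. -/
def paramAux : MatrixRing →ₐ[ℂ] AddMonoidAlgebra ℂ Expo :=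
  aeval fun p ↦ AddMonoidAlgebra.single (unitExpo p) 1

theorem paramAux_monomial (e : Fin 3 × Fin 3 →₀ ℕ) (c : ℂ) :
    paramAux (monomial e c) = AddMonoidAlgebra.single (margins e) c := by
  have h1 : paramAux (monomial e 1) = AddMonoidAlgebra.single (margins e) 1 := by
    induction e using Finsupp.induction_linear with
    | zero => rw [map_zero]; exact map_one paramAux
    | add e e' h h' =>
      rw [← _root_.one_mul (1 : ℂ), ← monomial_mul, map_mul, h, h', map_add,
        AddMonoidAlgebra.single_mul_single]
    | single p n =>
      rw [← X_pow_eq_monomial, map_pow, paramAux, aeval_X, AddMonoidAlgebra.single_pow, one_pow,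
        margins_single]
  rw [← _root_.mul_one c, ← smul_eq_mul, ← smul_monomial, map_smul, h1, AddMonoidAlgebra.smul_single]

/-- The homogeneous coordinate ring as a subring of a Laurent polynomial ring. -/
def param : CoordRing →ₐ[ℂ] AddMonoidAlgebra ℂ Expo :=
  Ideal.Quotient.liftₐ minorsIdeal paramAux fun f hf ↦ by
    suffices minorsIdeal ≤ RingHom.ker paramAux from this hf
    refine Ideal.span_le.2 ?_
    rintro _ ⟨i, k, j, l, rfl⟩
    simp [paramAux, AddMonoidAlgebra.single_mul_single, unitExpo, _root_.add_comm]

theorem param_mk (f : MatrixRing) : param (Ideal.Quotient.mk minorsIdeal f) = paramAux f := rfl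

theorem param_coord (p : Fin 3 × Fin 3) :
    param (coord p) = AddMonoidAlgebra.single (unitExpo p) 1 := by
  rw [coord, param_mk, paramAux, aeval_X]

/-- A linear left inverse sends each Laurent monomial to the class of any matrix monomial with those
margins; that class does not depend on the choice. -/
theorem param_injective : Function.Injective param := by
  classical
  refine (injective_iff_map_eq_zero param).2 fun x hx ↦ ?_
  obtain ⟨f, rfl⟩ := Ideal.Quotient.mk_surjective x
  let r : Expo → CoordRing := fun m ↦ if h : m ∈ Set.range margins then
    -- Zero is a junk value for exponents that are not margins; it never enters, as `T` is only
    -- applied to the image of `paramAux`.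
    Ideal.Quotient.mk minorsIdeal (monomial h.choose 1) else 0
  have hr (e) : r (margins e) = Ideal.Quotient.mk minorsIdeal (monomial e 1) := by
    have h : margins e ∈ Set.range margins := ⟨e, rfl⟩
    simp only [r, dif_pos h]
    exact mk_monomial_eq_of_margins_eq h.choose_spec
  let T : AddMonoidAlgebra ℂ Expo →ₗ[ℂ] CoordRing :=
    Finsupp.linearCombination ℂ r ∘ₗ (AddMonoidAlgebra.coeffLinearEquiv ℂ).toLinearMap
  have hT : T ∘ₗ paramAux.toLinearMap = (Ideal.Quotient.mkₐ ℂ minorsIdeal).toLinearMap := by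
    refine (basisMonomials _ ℂ).ext fun e ↦ ?_
    simp only [LinearMap.comp_apply, AlgHom.toLinearMap_apply, coe_basisMonomials]
    rw [paramAux_monomial]
    change Finsupp.linearCombination ℂ r (Finsupp.single (margins e) 1) = _
    rw [Finsupp.linearCombination_single, one_smul, hr]
    rfl
  have := LinearMap.congr_fun hT f
  change T (paramAux f) = Ideal.Quotient.mk minorsIdeal f at this
  rw [← this, ← param_mk, hx, map_zero]

end CoordinateRing

/-! ### The weighted grading in terms of exponents -/

section Grading

open MvPolynomial

variable (a b : Fin 3 → ℚ)

/-- The grading of the homogeneous coordinate ring. -/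
abbrev grading : ℕ → Submodule ℂ CoordRing := quotientGrading (weightGrading a b) minorsIdeal

instance [h : Fact (IsFormat a b)] : GradedAlgebra (grading a b) :=
  quotientGradedAlgebra (weightGrading a b) minorsIdeal h.out.minorsIdeal_isHomogeneous

/-- The degree of an exponent vector. -/
def expoDeg : Expo →+ ℚ where
  toFun m := ∑ i, a i * m.1 i + ∑ j, b j * m.2 j
  map_zero' := by simp
  map_add' m m' := by
    simp only [Prod.fst_add, Prod.snd_add, Pi.add_apply, Int.cast_add, mul_add,
      Finset.sum_add_distrib]
    ring

theorem expoDeg_apply (m : Expo) : expoDeg a b m = ∑ i, a i * m.1 i + ∑ j, b j * m.2 j := rfl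

variable {a b}

theorem IsFormat.expoDeg_unitExpo (h : IsFormat a b) (p : Fin 3 × Fin 3) :
    expoDeg a b (unitExpo p) = wt a b p := by
  rw [show p = (p.1, p.2) from rfl, h.wt_cast, expoDeg_apply]
  simp [unitExpo, Pi.single_apply]

theorem IsFormat.expoDeg_margins (h : IsFormat a b) (e : Fin 3 × Fin 3 →₀ ℕ) :
    expoDeg a b (margins e) = Finsupp.weight (wt a b) e := by
  induction e using Finsupp.induction_linear with
  | zero => simp
  | add e e' h h' => simp [h, h']
  | single p n =>
    rw [margins_single, map_nsmul, h.expoDeg_unitExpo, Finsupp.weight_single]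
    simp

variable (a b) in
/-- The exponents of the monomials of degree `n` in the homogeneous coordinate ring. -/
def monomialSet (n : ℕ) : Set Expo :=
  {m | (∀ i, 0 ≤ m.1 i) ∧ (∀ j, 0 ≤ m.2 j) ∧ ∑ i, m.1 i = ∑ j, m.2 j ∧ expoDeg a b m = n}

theorem IsFormat.mem_monomialSet (h : IsFormat a b) {n : ℕ} {m : Expo} :
    m ∈ monomialSet a b n ↔ ∃ e, Finsupp.weight (wt a b) e = n ∧ margins e = m := by
  constructor
  · rintro ⟨h₁, h₂, h₃, h₄⟩
    obtain ⟨e, rfl⟩ := mem_range_margins.2 ⟨h₁, h₂, h₃⟩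
    rw [h.expoDeg_margins] at h₄
    exact ⟨e, by exact_mod_cast h₄, rfl⟩
  · rintro ⟨e, he, rfl⟩
    obtain ⟨h₁, h₂, h₃⟩ := mem_range_margins.1 ⟨e, rfl⟩
    exact ⟨h₁, h₂, h₃, by rw [h.expoDeg_margins, he]⟩

theorem IsFormat.map_param_grading (h : IsFormat a b) (n : ℕ) :
    (grading a b n).map param.toLinearMap =
      Submodule.span ℂ ((fun m ↦ AddMonoidAlgebra.single m 1) '' monomialSet a b n) := by
  refine le_antisymm ?_ (Submodule.span_le.2 ?_)
  · rintro _ ⟨_, ⟨f, hf, rfl⟩, rfl⟩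
    change paramAux f ∈ _
    rw [f.as_sum, map_sum]
    refine Submodule.sum_mem _ fun e he ↦ ?_
    rw [paramAux_monomial, ← _root_.mul_one (coeff e f), ← smul_eq_mul,
      ← AddMonoidAlgebra.smul_single]
    exact Submodule.smul_mem _ _ (Submodule.subset_span ⟨_, h.mem_monomialSet.2
      ⟨e, hf (mem_support_iff.1 he), rfl⟩, rfl⟩)
  · rintro _ ⟨m, hm, rfl⟩
    obtain ⟨e, he, rfl⟩ := h.mem_monomialSet.1 hm
    refine ⟨Ideal.Quotient.mk _ (monomial e 1), ⟨monomial e 1, ?_, rfl⟩, paramAux_monomial e 1⟩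
    exact isWeightedHomogeneous_monomial _ _ _ he

theorem coord_mem (p : Fin 3 × Fin 3) : coord p ∈ grading a b (wt a b p) :=
  mk_mem_quotientGrading _ _ (isWeightedHomogeneous_X ℂ _ _)

instance : IsDomain CoordRing := param_injective.isDomain param.toRingHom

theorem coord_ne_zero (p : Fin 3 × Fin 3) : coord p ≠ 0 := fun h ↦ by
  have := param_coord p
  rw [h, map_zero, eq_comm, AddMonoidAlgebra.single_eq_zero] at this
  exact one_ne_zero this

theorem isUnit_single (m : Expo) :
    IsUnit (AddMonoidAlgebra.single m 1 : AddMonoidAlgebra ℂ Expo) :=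
  .of_mul_eq_one (AddMonoidAlgebra.single (-m) 1) (by
    rw [AddMonoidAlgebra.single_mul_single, add_neg_cancel, _root_.mul_one]
    rfl)

theorem isUnit_param_coord (p : Fin 3 × Fin 3) : IsUnit (param.toRingHom (coord p)) := by
  change IsUnit (param (coord p))
  rw [param_coord]
  exact isUnit_single _

end Grading

/-! ### Exponents of the torus and of the charts -/

section Charts

variable (a b : Fin 3 → ℚ)

/-- The exponents of the Laurent monomials of degree zero. -/
def torusLattice : AddSubgroup Expo where
  carrier := {m | ∑ i, m.1 i = ∑ j, m.2 j ∧ expoDeg a b m = 0}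
  zero_mem' := by simp
  add_mem' h h' := by
    simp only [Set.mem_ofPred_eq, Prod.fst_add, Prod.snd_add, Pi.add_apply,
      Finset.sum_add_distrib, map_add] at h h' ⊢
    simp [h, h']
  neg_mem' h := by
    simp only [Set.mem_ofPred_eq, Prod.fst_neg, Prod.snd_neg, Pi.neg_apply,
      Finset.sum_neg_distrib, map_neg] at h ⊢
    simp [h]

/-- The exponents of the Laurent monomials that are regular on the chart where the coordinate in
position `p` does not vanish. -/
def chartMonoid (p : Fin 3 × Fin 3) : AddSubmonoid Expo where
  carrier := {m | m ∈ torusLattice a b ∧ (∀ i ≠ p.1, 0 ≤ m.1 i) ∧ ∀ j ≠ p.2, 0 ≤ m.2 j}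
  zero_mem' := ⟨zero_mem _, by simp, by simp⟩
  add_mem' h h' := ⟨add_mem h.1 h'.1, fun i hi ↦ add_nonneg (h.2.1 i hi) (h'.2.1 i hi),
    fun j hj ↦ add_nonneg (h.2.2 j hj) (h'.2.2 j hj)⟩

variable {a b}

/-- A degree zero Laurent monomial becomes a genuine one after multiplication by a power of the
product of all nine variables, in which each row and each column has sum 3. -/
theorem IsFormat.mem_torusLattice (h : IsFormat a b) {m : Expo} :
    m ∈ torusLattice a b ↔
      ∃ k : ℕ, m + k • (∑ p, unitExpo p) ∈ monomialSet a b (k • ∑ p, wt a b p) := by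
  have hdeg : expoDeg a b (∑ p, unitExpo p) = (∑ p, wt a b p : ℕ) := by
    simp [h.expoDeg_unitExpo]
  have h1 (i : Fin 3) : (∑ p, unitExpo p).1 i = 3 := by
    simp [unitExpo, Prod.fst_sum, Fintype.sum_prod_type, Pi.single_apply]
  have h2 (i : Fin 3) : (∑ p, unitExpo p).2 i = 3 := by
    simp [unitExpo, Prod.snd_sum, Fintype.sum_prod_type, Pi.single_apply]
  simp only [monomialSet, Set.mem_ofPred_eq, Prod.fst_add, Prod.snd_add, Pi.add_apply, Prod.smul_fst,
    Prod.smul_snd, Pi.smul_apply, h1, h2, map_add, map_nsmul, hdeg, Finset.sum_add_distrib]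
  simp only [torusLattice, ← SetLike.mem_coe]
  constructor
  · rintro ⟨h₁, h₂⟩
    let k : ℕ := ∑ i, ((m.1 i).natAbs + (m.2 i).natAbs)
    have hk (i : Fin 3) : (m.1 i).natAbs + (m.2 i).natAbs ≤ k :=
      Finset.single_le_sum (f := fun i ↦ (m.1 i).natAbs + (m.2 i).natAbs) (fun _ _ ↦ Nat.zero_le _)
        (Finset.mem_univ i)
    refine ⟨k, fun i ↦ ?_, fun i ↦ ?_, ?_, ?_⟩
    · have := hk i
      simp only [nsmul_eq_mul]
      omega
    · have := hk i
      simp only [nsmul_eq_mul]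
      omega
    · rw [h₁]
    · rw [h₂]; simp
  · rintro ⟨k, -, -, h₁, h₂⟩
    refine ⟨by simpa using h₁, ?_⟩
    simpa using h₂

theorem IsFormat.mem_chartMonoid (h : IsFormat a b) (p : Fin 3 × Fin 3) {m : Expo} :
    m ∈ chartMonoid a b p ↔ ∃ k : ℕ, m + k • unitExpo p ∈ monomialSet a b (k • wt a b p) := by
  have hdeg : expoDeg a b (unitExpo p) = (wt a b p : ℕ) := h.expoDeg_unitExpo p
  have h1 (i : Fin 3) : (unitExpo p).1 i = if i = p.1 then 1 else 0 := by
    simp [unitExpo, Pi.single_apply]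
  have h2 (i : Fin 3) : (unitExpo p).2 i = if i = p.2 then 1 else 0 := by
    simp [unitExpo, Pi.single_apply]
  simp only [monomialSet, Set.mem_ofPred_eq, Prod.fst_add, Prod.snd_add, Pi.add_apply, Prod.smul_fst,
    Prod.smul_snd, Pi.smul_apply, h1, h2, map_add, map_nsmul, hdeg, Finset.sum_add_distrib]
  constructor
  · rintro ⟨⟨h₁, h₂⟩, h₃, h₄⟩
    refine ⟨(m.1 p.1).natAbs + (m.2 p.2).natAbs, fun i ↦ ?_, fun i ↦ ?_, ?_, ?_⟩
    · split_ifs with hi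
      · subst hi; simp only [nsmul_eq_mul]; omega
      · simpa using h₃ i hi
    · split_ifs with hi
      · subst hi; simp only [nsmul_eq_mul]; omega
      · simpa using h₄ i hi
    · rw [h₁]; simp
    · rw [h₂]; simp
  · rintro ⟨k, h₃, h₄, h₁, h₂⟩
    refine ⟨⟨by simpa using h₁, by simpa using h₂⟩, fun i hi ↦ ?_, fun i hi ↦ ?_⟩
    · simpa [hi] using h₃ i
    · simpa [hi] using h₄ i

/-- The coordinates on the cyclic cover of a chart: the entries outside of the chosen row and
column. -/
abbrev ChartIndex (p : Fin 3 × Fin 3) : Type := {i : Fin 3 // i ≠ p.1} ⊕ {j : Fin 3 // j ≠ p.2}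

theorem card_chartIndex (p : Fin 3 × Fin 3) : Nat.card (ChartIndex p) = 4 := by
  rw [Nat.card_eq_fintype_card, Fintype.card_sum, Fintype.card_subtype_compl,
    Fintype.card_subtype_compl]
  simp

variable (a b) in
/-- The weights of the cyclic group action on the cover of a chart. -/
def chartWeight (p : Fin 3 × Fin 3) : ChartIndex p → ℕ :=
  Sum.elim (fun i ↦ wt a b (i, p.2)) fun j ↦ wt a b (p.1, j)

variable (a b) in
/-- The exponents of a chart in terms of the coordinates on its cyclic cover. -/
def chartExpo (p : Fin 3 × Fin 3) : chartMonoid a b p →+ (ChartIndex p →₀ ℕ) where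
  toFun m := Finsupp.equivFunOnFinite.symm
    (Sum.elim (fun i ↦ (m.1.1 i).toNat) fun j ↦ (m.1.2 j).toNat)
  map_zero' := by ext (i | i) <;> simp
  map_add' m m' := by
    ext (i | i)
    · have h := m.2.2.1 i i.2
      have h' := m'.2.2.1 i i.2
      simp [Int.toNat_add h h']
    · have h := m.2.2.2 i i.2
      have h' := m'.2.2.2 i i.2
      simp [Int.toNat_add h h']

theorem weight_chartWeight (p : Fin 3 × Fin 3) (e : ChartIndex p →₀ ℕ) :
    Finsupp.weight (chartWeight a b p) e =
      ∑ i : {i : Fin 3 // i ≠ p.1}, e (.inl i) * wt a b (i, p.2) +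
        ∑ j : {j : Fin 3 // j ≠ p.2}, e (.inr j) * wt a b (p.1, j) := by
  rw [Finsupp.weight_apply, Finsupp.sum_fintype _ _ (by simp), Fintype.sum_sum_type]
  rfl

theorem mem_torusLattice_iff (p : Fin 3 × Fin 3) (m : Expo) : m ∈ torusLattice a b ↔
    m.1 p.1 + ∑ i : {i : Fin 3 // i ≠ p.1}, m.1 i = m.2 p.2 + ∑ j : {j : Fin 3 // j ≠ p.2}, m.2 j ∧
    (a p.1 * m.1 p.1 + ∑ i : {i : Fin 3 // i ≠ p.1}, a i * m.1 i) +
      (b p.2 * m.2 p.2 + ∑ j : {j : Fin 3 // j ≠ p.2}, b j * m.2 j) = 0 := by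
  rw [← Fintype.sum_eq_add_sum_subtype_ne m.1 p.1, ← Fintype.sum_eq_add_sum_subtype_ne m.2 p.2,
    ← Fintype.sum_eq_add_sum_subtype_ne (fun i ↦ a i * (m.1 i : ℚ)) p.1,
    ← Fintype.sum_eq_add_sum_subtype_ne (fun j ↦ b j * (m.2 j : ℚ)) p.2]
  rfl

/-- If the other four exponents of a difference vanish, balance makes its two entries at `p` equal,
and degree zero gives `(a p.1 + b p.2)` times that entry `= 0`. The factor is at least 1. -/
theorem IsFormat.chartExpo_injective (h : IsFormat a b) (p : Fin 3 × Fin 3) :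
    Function.Injective (chartExpo a b p) := by
  intro m m' hm
  have h₁ (i : Fin 3) (hi : i ≠ p.1) : m.1.1 i = m'.1.1 i := by
    have := DFunLike.congr_fun hm (.inl ⟨i, hi⟩)
    have hm0 := m.2.2.1 i hi
    have hm0' := m'.2.2.1 i hi
    change (m.1.1 i).toNat = (m'.1.1 i).toNat at this
    omega
  have h₂ (i : Fin 3) (hi : i ≠ p.2) : m.1.2 i = m'.1.2 i := by
    have := DFunLike.congr_fun hm (.inr ⟨i, hi⟩)
    have hm0 := m.2.2.2 i hi
    have hm0' := m'.2.2.2 i hi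
    change (m.1.2 i).toNat = (m'.1.2 i).toNat at this
    omega
  obtain ⟨hs, hd⟩ := (mem_torusLattice_iff p _).1
    (sub_mem m.2.1 m'.2.1 : m.1 - m'.1 ∈ torusLattice a b)
  simp only [Prod.fst_sub, Prod.snd_sub, Pi.sub_apply] at hs hd
  have e₁ (i : {i : Fin 3 // i ≠ p.1}) : m.1.1 i - m'.1.1 i = 0 := sub_eq_zero.2 (h₁ i i.2)
  have e₂ (i : {i : Fin 3 // i ≠ p.2}) : m.1.2 i - m'.1.2 i = 0 := sub_eq_zero.2 (h₂ i i.2)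
  simp only [e₁, e₂, Finset.sum_const_zero, add_zero, Int.cast_zero, mul_zero] at hs hd
  rw [← hs, ← add_mul] at hd
  have h0 := (mul_eq_zero.1 hd).resolve_left (by have := h.one_le_add p.1 p.2; linarith)
  have h0' : m.1.1 p.1 - m'.1.1 p.1 = 0 := by exact_mod_cast h0
  refine Subtype.ext (Prod.ext (funext fun i ↦ ?_) (funext fun i ↦ ?_))
  · by_cases hi : i = p.1
    · subst hi; omega
    · exact h₁ i hi
  · by_cases hi : i = p.2
    · subst hi; omega
    · exact h₂ i hi

/-- The two missing exponents must solve the balance and degree equations. Eliminating one leaves a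
single equation, solvable in integers exactly when `wt p` divides the weight. -/
theorem IsFormat.mem_range_chartExpo (h : IsFormat a b) (p : Fin 3 × Fin 3)
    (e : ChartIndex p →₀ ℕ) :
    e ∈ Set.range (chartExpo a b p) ↔ wt a b p ∣ Finsupp.weight (chartWeight a b p) e := by
  have hN : (wt a b p : ℚ) = a p.1 + b p.2 := h.wt_cast p.1 p.2
  have hw : (Finsupp.weight (chartWeight a b p) e : ℚ) =
      ∑ i : {i : Fin 3 // i ≠ p.1}, (e (.inl i) : ℚ) * (a i + b p.2) +
        ∑ j : {j : Fin 3 // j ≠ p.2}, (e (.inr j) : ℚ) * (a p.1 + b j) := by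
    rw [weight_chartWeight]
    push_cast
    simp only [h.wt_cast]
  simp only [mul_add, Finset.sum_add_distrib, ← Finset.sum_mul] at hw
  constructor
  · rintro ⟨m, rfl⟩
    obtain ⟨hs, hd⟩ := (mem_torusLattice_iff p _).1 m.2.1
    have e₁ (i : {i : Fin 3 // i ≠ p.1}) : (chartExpo a b p m (.inl i) : ℤ) = m.1.1 i :=
      Int.toNat_of_nonneg (m.2.2.1 i i.2)
    have e₂ (i : {i : Fin 3 // i ≠ p.2}) : (chartExpo a b p m (.inr i) : ℤ) = m.1.2 i :=
      Int.toNat_of_nonneg (m.2.2.2 i i.2)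
    simp only [← e₁, ← e₂, Int.cast_natCast] at hs hd
    rw [← Int.natCast_dvd_natCast]
    refine ⟨∑ i, (chartExpo a b p m (.inl i) : ℤ) - m.1.2 p.2, ?_⟩
    have hs' : (m.1.1 p.1 : ℚ) + ∑ i, (chartExpo a b p m (.inl i) : ℚ) =
      m.1.2 p.2 + ∑ i, (chartExpo a b p m (.inr i) : ℚ) := by exact_mod_cast hs
    have : (Finsupp.weight (chartWeight a b p) (chartExpo a b p m) : ℚ) =
        wt a b p * (∑ i, (chartExpo a b p m (.inl i) : ℚ) - m.1.2 p.2) := by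
      rw [hw, hN]
      simp only [_root_.mul_comm (a _), _root_.mul_comm (b _)] at hd ⊢
      linear_combination hd - hs' * a p.1
    exact_mod_cast this
  · rintro ⟨k, hk⟩
    rw [hk] at hw
    let A : ℤ := ∑ i : {i : Fin 3 // i ≠ p.1}, (e (.inl i) : ℤ)
    let B : ℤ := ∑ j : {j : Fin 3 // j ≠ p.2}, (e (.inr j) : ℤ)
    -- With quotient `k`, the solution has entries `B - k` in the row of `p` and `A - k` in its
    -- column; these two may be negative.
    let m : Expo := (fun i ↦ if hi : i ≠ p.1 then e (.inl ⟨i, hi⟩) else B - k,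
      fun j ↦ if hj : j ≠ p.2 then e (.inr ⟨j, hj⟩) else A - k)
    have m₁ : m.1 p.1 = B - k := by simp [m]
    have m₂ : m.2 p.2 = A - k := by simp [m]
    have e₁ (i : {i : Fin 3 // i ≠ p.1}) : m.1 i = e (.inl i) := by simp [m, i.2]
    have e₂ (i : {i : Fin 3 // i ≠ p.2}) : m.2 i = e (.inr i) := by simp [m, i.2]
    have hm : m ∈ chartMonoid a b p := by
      refine ⟨(mem_torusLattice_iff p _).2 ⟨?_, ?_⟩, fun i hi ↦ ?_, fun i hi ↦ ?_⟩
      · simp only [m₁, m₂, e₁, e₂]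
        simp only [A, B]
        ring
      · simp only [m₁, m₂, e₁, e₂]
        push_cast at hw ⊢
        rw [hN] at hw
        simp only [A, B]
        push_cast
        simp only [_root_.mul_comm (a _), _root_.mul_comm (b _)] at hw ⊢
        linear_combination -hw
      · rw [e₁ ⟨i, hi⟩]; positivity
      · rw [e₂ ⟨i, hi⟩]; positivity
    refine ⟨⟨m, hm⟩, ?_⟩
    ext (i | i)
    · change (m.1 i).toNat = _
      rw [e₁]; simp
    · change (m.2 i).toNat = _
      rw [e₂]; simp

end Charts

/-! ### Charts of `Proj` as toric schemes over `ℂ` -/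

section ProjOver

open HomogeneousLocalization

variable {R : Type} [CommRing R] [Algebra ℂ R] (𝒜 : ℕ → Submodule ℂ R) [GradedAlgebra 𝒜]

/-- An affine chart of `Proj`, with a given coordinate ring. -/
def chartHom {A : Type} [CommRing A] {f : R} {d : ℕ} (hf : f ∈ 𝒜 d) (hd : 0 < d)
    (e : A ≃+* Away 𝒜 f) : Spec (.of A) ⟶ Proj 𝒜 :=
  Spec.map (CommRingCat.ofHom e.symm.toRingHom) ≫ Proj.awayι 𝒜 f hf hd

instance {A : Type} [CommRing A] {B : Type} [CommRing B] (e : A ≃+* B) :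
    IsIso (Spec.map (CommRingCat.ofHom e.toRingHom)) :=
  have : IsIso (CommRingCat.ofHom e.toRingHom) := (inferInstance : IsIso e.toCommRingCatIso.hom)
  inferInstance

instance {A : Type} [CommRing A] {f : R} {d : ℕ} (hf : f ∈ 𝒜 d) (hd : 0 < d)
    (e : A ≃+* Away 𝒜 f) : IsOpenImmersion (chartHom 𝒜 hf hd e) := by
  unfold chartHom
  infer_instance

theorem opensRange_chartHom {A : Type} [CommRing A] {f : R} {d : ℕ} (hf : f ∈ 𝒜 d) (hd : 0 < d)
    (e : A ≃+* Away 𝒜 f) : (chartHom 𝒜 hf hd e).opensRange = Proj.basicOpen 𝒜 f :=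
  (Scheme.Hom.opensRange_comp_of_isIso _ _).trans (Proj.opensRange_awayι 𝒜 f hf hd)

theorem chartHom_over {A : Type} [CommRing A] [Algebra ℂ A] {f : R} {d : ℕ} (hf : f ∈ 𝒜 d)
    (hd : 0 < d) (e : A ≃+* Away 𝒜 f)
    (he : ∀ c : ℂ, e (algebraMap ℂ _ c) = fromZeroRingHom 𝒜 _ (algebraMap ℂ (𝒜 0) c)) :
    chartHom 𝒜 hf hd e ≫ (projOver 𝒜).hom = Spec.map (CommRingCat.ofHom (algebraMap ℂ A)) := by
  change _ ≫ Proj.toSpecZero 𝒜 ≫ _ = _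
  rw [chartHom, Category.assoc, Proj.awayι_toSpecZero_assoc, ← Spec.map_comp, ← Spec.map_comp]
  congr 1
  ext c
  change e.symm (fromZeroRingHom 𝒜 _ (algebraMap ℂ (𝒜 0) c)) = _
  rw [← he, RingEquiv.symm_apply_apply]
  rfl

/-- An affine chart of `Proj` identified with an affine toric variety. -/
def chartMorphism {S : Type} [AddCommMonoid S] {f : R} {d : ℕ} (hf : f ∈ 𝒜 d) (hd : 0 < d)
    (e : AddMonoidAlgebra ℂ S ≃+* Away 𝒜 f)
    (he : ∀ c : ℂ, e (algebraMap ℂ _ c) = fromZeroRingHom 𝒜 _ (algebraMap ℂ (𝒜 0) c)) :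
    affineToric S ⟶ projOver 𝒜 :=
  Over.homMk (U := affineToric S) (V := projOver 𝒜) (chartHom 𝒜 hf hd e)
    (chartHom_over 𝒜 hf hd e he)

/-- Compatibility of the charts with localization. -/
theorem affineToricMap_chartMorphism {S S' Λ : Type} [AddCommMonoid S] [AddCommMonoid S']
    [AddCommGroup Λ] {Θ : R →+* AddMonoidAlgebra ℂ Λ} {f g x : R} {d k l : ℕ}
    (hf : f ∈ 𝒜 d) (hd : 0 < d) (hg : g ∈ 𝒜 k) (hx : x ∈ 𝒜 l) (hl : 0 < l) (hl' : l = d + k)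
    (hxfg : x = f * g)
    (e : AddMonoidAlgebra ℂ S ≃+* Away 𝒜 f) (e' : AddMonoidAlgebra ℂ S' ≃+* Away 𝒜 x)
    (he : ∀ c : ℂ, e (algebraMap ℂ _ c) = fromZeroRingHom 𝒜 _ (algebraMap ℂ (𝒜 0) c))
    (he' : ∀ c : ℂ, e' (algebraMap ℂ _ c) = fromZeroRingHom 𝒜 _ (algebraMap ℂ (𝒜 0) c))
    (hfu : IsUnit (Θ f)) (hxu : IsUnit (Θ x)) {α : S →+ Λ} {α' : S' →+ Λ} (δ₀ : S →+ S')
    (hδ₀ : ∀ s, α' (δ₀ s) = α s) (hα' : Function.Injective α')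
    (hα : ∀ y, awayHom 𝒜 Θ hfu (e y) = AddMonoidAlgebra.mapDomainRingHom ℂ α y)
    (hα'' : ∀ y, awayHom 𝒜 Θ hxu (e' y) = AddMonoidAlgebra.mapDomainRingHom ℂ α' y) :
    affineToricMap δ₀ ≫ chartMorphism 𝒜 hf hd e he = chartMorphism 𝒜 hx hl e' he' := by
  subst hl'
  refine Over.OverMorphism.ext ?_
  change Spec.map (CommRingCat.ofHom (AddMonoidAlgebra.mapDomainRingHom ℂ δ₀)) ≫
    chartHom 𝒜 hf hd e = chartHom 𝒜 hx hl e'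
  rw [chartHom, chartHom,
    ← Proj.SpecMap_awayMap_awayι 𝒜 hf hd hg hxfg, ← Category.assoc, ← Category.assoc,
    ← Spec.map_comp, ← Spec.map_comp, ← CommRingCat.ofHom_comp, ← CommRingCat.ofHom_comp]
  congr 3
  refine RingHom.ext fun z ↦ ?_
  obtain ⟨y, rfl⟩ := e.surjective z
  apply AddMonoidAlgebra.mapDomain_injective hα'
  change _ = AddMonoidAlgebra.mapDomainRingHom ℂ α' (e'.symm (awayMap 𝒜 hg hxfg (e y)))
  rw [← hα'', RingEquiv.apply_symm_apply, awayHom_awayMap 𝒜 hg hxfg hfu hxu, hα]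
  change AddMonoidAlgebra.mapDomainRingHom ℂ α'
    (AddMonoidAlgebra.mapDomainRingHom ℂ δ₀ (e.symm (e y))) = _
  rw [RingEquiv.symm_apply_apply, ← RingHom.comp_apply, ← AddMonoidAlgebra.mapDomainRingHom_comp]
  congr 2
  exact AddMonoidHom.ext hδ₀

end ProjOver

/-! ### A basis of the torus lattice and the cover by coordinate charts -/

section Torus

variable {a b : Fin 3 → ℚ}

variable (a b) in
theorem exists_torusLattice_equiv : ∃ n : ℕ, Nonempty (torusLattice a b ≃+ (Fin n → ℤ)) := by
  let M : Submodule ℤ Expo := (torusLattice a b).toIntSubmodule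
  exact ⟨_, ⟨(Module.finBasis ℤ M).equivFun.toAddEquiv⟩⟩

instance : Algebra.FiniteType ℂ CoordRing :=
  Algebra.FiniteType.of_surjective (Ideal.Quotient.mkₐ ℂ minorsIdeal)
    (Ideal.Quotient.mkₐ_surjective ℂ minorsIdeal)

variable [h : Fact (IsFormat a b)]

instance : IsScalarTower ℂ (grading a b 0) CoordRing :=
  IsScalarTower.of_algebraMap_eq (R := ℂ) (S := grading a b 0) (A := CoordRing) fun _ ↦ rfl

instance : Algebra.FiniteType (grading a b 0) CoordRing :=
  Algebra.FiniteType.of_restrictScalars_finiteType ℂ (grading a b 0) CoordRing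

omit h in
theorem adjoin_range_coord : Algebra.adjoin (grading a b 0) (Set.range coord) = ⊤ := by
  rw [eq_top_iff]
  rintro x -
  obtain ⟨f, rfl⟩ := Ideal.Quotient.mk_surjective x
  induction f using MvPolynomial.induction_on with
  | C c =>
    exact (Algebra.adjoin (grading a b 0) (Set.range coord)).algebraMap_mem
      (algebraMap ℂ (grading a b 0) c)
  | add f g hf hg => rw [map_add]; exact add_mem hf hg
  | mul_X f p hf => rw [map_mul]; exact mul_mem hf (Algebra.subset_adjoin ⟨p, rfl⟩)

variable (a b) in
theorem iSup_basicOpen_coord : ⨆ p, Proj.basicOpen (grading a b) (coord p) = ⊤ :=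
  Proj.iSup_basicOpen_eq_top' (grading a b) coord (fun p ↦ ⟨_, coord_mem p⟩) adjoin_range_coord

end Torus

/-! ### The toric charts and the embedded torus -/

section Charts

open HomogeneousLocalization

/-- The parametrization of the homogeneous coordinate ring, as a ring homomorphism. -/
abbrev paramHom : CoordRing →+* AddMonoidAlgebra ℂ Expo := param.toRingHom

theorem paramHom_injective : Function.Injective paramHom := param_injective

variable (a b : Fin 3 → ℚ) [h : Fact (IsFormat a b)]

theorem exists_chartEquiv (p : Fin 3 × Fin 3) :
    ∃ e : AddMonoidAlgebra ℂ (chartMonoid a b p) ≃+* Away (grading a b) (coord p),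
      ∀ x, awayHom (grading a b) paramHom (isUnit_param_coord p) (e x) =
        AddMonoidAlgebra.mapDomainRingHom ℂ (chartMonoid a b p).subtype x :=
  exists_ringEquiv_away (grading a b) param_injective h.out.map_param_grading (coord_mem p)
    (param_coord p) (isUnit_param_coord p) (α := (chartMonoid a b p).subtype)
    Subtype.val_injective fun m ↦ by
      rw [← h.out.mem_chartMonoid p]
      exact (Set.ext_iff.1 Subtype.range_coe m)

/-- The coordinate ring of the chart where `x p ≠ 0`. -/
def chartEquiv (p : Fin 3 × Fin 3) :
    AddMonoidAlgebra ℂ (chartMonoid a b p) ≃+* Away (grading a b) (coord p) :=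
  (exists_chartEquiv a b p).choose

theorem awayHom_chartEquiv (p : Fin 3 × Fin 3) (x : AddMonoidAlgebra ℂ (chartMonoid a b p)) :
    awayHom (grading a b) paramHom (isUnit_param_coord p) (chartEquiv a b p x) =
      AddMonoidAlgebra.mapDomainRingHom ℂ (chartMonoid a b p).subtype x :=
  (exists_chartEquiv a b p).choose_spec x

variable {a b} in
theorem map_algebraMap_of_awayHom_eq {S : Type} [AddCommMonoid S] {f : CoordRing}
    (e : AddMonoidAlgebra ℂ S ≃+* Away (grading a b) f) {α : S →+ Expo}
    (hu : IsUnit (paramHom f))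
    (he : ∀ x, awayHom (grading a b) paramHom hu (e x) = AddMonoidAlgebra.mapDomainRingHom ℂ α x)
    (c : ℂ) : e (algebraMap ℂ _ c) =
      fromZeroRingHom (grading a b) _ (algebraMap ℂ (grading a b 0) c) := by
  apply awayHom_injective (grading a b) paramHom_injective hu
  rw [he, awayHom_fromZeroRingHom]
  change _ = param (algebraMap ℂ CoordRing c)
  rw [AlgHom.commutes, AddMonoidAlgebra.coe_algebraMap, AddMonoidAlgebra.coe_algebraMap]
  change AddMonoidAlgebra.mapDomain α (AddMonoidAlgebra.single 0 c) = AddMonoidAlgebra.single 0 c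
  rw [AddMonoidAlgebra.mapDomain_single, map_zero]

theorem wt_pos' (p : Fin 3 × Fin 3) : 0 < wt a b p := h.out.wt_pos p.1 p.2

/-- The affine toric chart where `x p ≠ 0`. -/
def chart (p : Fin 3 × Fin 3) : affineToric (chartMonoid a b p) ⟶ projOver (grading a b) :=
  chartMorphism (grading a b) (coord_mem p) (wt_pos' a b p) (chartEquiv a b p)
    (map_algebraMap_of_awayHom_eq _ _ (awayHom_chartEquiv a b p))

instance (p : Fin 3 × Fin 3) : IsOpenImmersion (chart a b p).left :=
  inferInstanceAs (IsOpenImmersion (chartHom ..))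

theorem opensRange_chart (p : Fin 3 × Fin 3) :
    (chart a b p).left.opensRange = Proj.basicOpen (grading a b) (coord p) :=
  opensRange_chartHom ..

theorem exists_mem_range_chart (x : (projOver (grading a b)).left) :
    ∃ p, x ∈ Set.range (chart a b p).left := by
  have hx : x ∈ ⨆ p, Proj.basicOpen (grading a b) (coord p) := by
    rw [iSup_basicOpen_coord]; trivial
  obtain ⟨p, hp⟩ := TopologicalSpace.Opens.mem_iSup.1 hx
  exact ⟨p, by rwa [← opensRange_chart] at hp⟩

/-- The torus is `D₊(∏ x p)`: its coordinate ring is the group algebra of `torusLattice`, a finite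
free `ℤ`-module. Being contained in each `D₊(x p)`, it factors through every chart by the inclusion
of monoids. -/
theorem exists_torus_embedding : ∃ (n : ℕ) (j : torus n ⟶ projOver (grading a b))
    (α : ∀ p, chartMonoid a b p →+ (Fin n → ℤ)), IsOpenImmersion j.left ∧
    ∀ p, affineToricMap (α p) ≫ chart a b p = j := by
  obtain ⟨n, ⟨ε⟩⟩ := exists_torusLattice_equiv a b
  let α₀ : (Fin n → ℤ) →+ Expo := (torusLattice a b).subtype.comp ε.symm.toAddMonoidHom
  have hα₀ : Function.Injective α₀ := Subtype.val_injective.comp ε.symm.injective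
  have hx : ∏ p, coord p ∈ grading a b (∑ p, wt a b p) :=
    SetLike.prod_mem_graded _ _ _ fun p _ ↦ coord_mem p
  have hx0 : param (∏ p, coord p) = AddMonoidAlgebra.single (∑ p, unitExpo p) 1 := by
    rw [map_prod]
    exact (Finset.prod_congr rfl fun p _ ↦ param_coord p).trans (map_prod
      (AddMonoidAlgebra.of ℂ Expo) (fun p ↦ Multiplicative.ofAdd (unitExpo p)) Finset.univ).symm
  have hu : IsUnit (paramHom (∏ p, coord p)) := by
    change IsUnit (param _)
    rw [hx0]
    exact isUnit_single _
  obtain ⟨e, he⟩ := exists_ringEquiv_away (grading a b) param_injective h.out.map_param_grading hx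
    hx0 hu hα₀ fun m ↦ by
      rw [← h.out.mem_torusLattice]
      refine ⟨?_, fun hm ↦ ⟨ε ⟨m, hm⟩, ?_⟩⟩
      · rintro ⟨x, rfl⟩
        exact (ε.symm x).2
      · exact congrArg Subtype.val (ε.symm_apply_apply ⟨m, hm⟩)
  have hpos : 0 < ∑ p, wt a b p := Finset.sum_pos (fun p _ ↦ wt_pos' a b p) Finset.univ_nonempty
  have he' := map_algebraMap_of_awayHom_eq e hu he
  refine ⟨n, chartMorphism (grading a b) hx hpos e he', fun p ↦ ε.toAddMonoidHom.comp
    (AddSubmonoid.inclusion (T := (torusLattice a b).toAddSubmonoid) fun m hm ↦ hm.1),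
    inferInstanceAs (IsOpenImmersion (chartHom ..)), fun p ↦ ?_⟩
  refine affineToricMap_chartMorphism (Θ := paramHom) (grading a b) (coord_mem p) (wt_pos' a b p)
    (g := ∏ q ∈ Finset.univ.erase p, coord q) (k := ∑ q ∈ Finset.univ.erase p, wt a b q)
    (SetLike.prod_mem_graded _ _ _ fun q _ ↦ coord_mem q) hx hpos
    (Finset.add_sum_erase _ _ (Finset.mem_univ p)).symm
    (Finset.mul_prod_erase _ _ (Finset.mem_univ p)).symm
    (chartEquiv a b p) e _ he' (isUnit_param_coord p) hu _ (fun s ↦ ?_) hα₀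
    (awayHom_chartEquiv a b p) he
  exact congrArg Subtype.val (ε.symm_apply_apply _)

end Charts

/-! ### Reading off properties of a scheme from affine charts -/

section AffineCharts

open Order TopologicalSpace

variable {X : Scheme.{0}}

section Single

variable {A : Type} [CommRing A] (φ : Spec (.of A) ⟶ X) [IsOpenImmersion φ]

/-- The coordinate ring of an affine chart, as a ring of sections. -/
def chartSection : A ≃+* Γ(X, φ ''ᵁ ⊤) :=
  ((Scheme.ΓSpecIso (.of A)).symm ≪≫ (φ.appIso ⊤).symm).commRingCatIsoToRingEquiv

theorem mem_basicOpen_chartSection (g : A) (P : Spec (.of A)) :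
    φ P ∈ X.basicOpen (chartSection φ g) ↔ g ∉ P.asIdeal := by
  have h : φ ''ᵁ (Spec (.of A)).basicOpen ((Scheme.ΓSpecIso (.of A)).inv g) =
      X.basicOpen (chartSection φ g) := Scheme.image_basicOpen φ _
  rw [← h, basicOpen_eq_of_affine]
  exact φ.isOpenEmbedding.injective.mem_set_image

theorem isAffineOpen_image_top : IsAffineOpen (φ ''ᵁ ⊤) :=
  (isAffineOpen_top _).image_of_isOpenImmersion φ

theorem coheight_eq_height_of_chart (P : Spec (.of A)) :
    coheight (φ P) = P.asIdeal.height :=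
  (coheight_eq_of_isOpenImmersion φ).trans (idealHeight_eq_coheight (.of A) P).symm

theorem isIntegrallyClosed_stalk_of_chart [IsDomain A] [IsIntegrallyClosed A]
    (P : Spec (.of A)) : IsIntegrallyClosed (X.presheaf.stalk (φ P)) := by
  have : P.asIdeal.IsPrime := P.2
  let k : Algebra A ((Spec (.of A)).presheaf.stalk P) := StructureSheaf.stalkAlgebra A P
  have : IsLocalization.AtPrime ((Spec (.of A)).presheaf.stalk P) P.asIdeal :=
    StructureSheaf.IsLocalization.to_stalk A P
  have : IsIntegrallyClosed ((Spec (.of A)).presheaf.stalk P) :=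
    isIntegrallyClosed_of_isLocalization _ P.asIdeal.primeCompl
      (Ideal.primeCompl_le_nonZeroDivisors _)
  exact .of_equiv (asIso (φ.stalkMap P)).commRingCatIsoToRingEquiv.symm

/-- The function whose radical is the given height one prime has no zeros on the chart at other
codimension one points, so its divisor there is a nonzero multiple of one prime divisor. -/
theorem hasTorsionClassGroup_of_chart [IsIntegral X] [IsLocallyNoetherian X] (hX : IsNormal X)
    [IsDomain A] (hA : HasPrincipalDivisors A) : HasTorsionClassGroup (φ ''ᵁ ⊤) := by
  rintro _ ⟨P, -, rfl⟩ hy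
  change coheight (φ P) = 1 at hy
  have hP : P.asIdeal.height = 1 := by rw [← hy, coheight_eq_height_of_chart]
  obtain ⟨g, hgP, hg0, hg⟩ := hA P.asIdeal P.2 hP
  have hne : Nonempty (φ ''ᵁ ⊤ : X.Opens) := ⟨⟨φ P, P, trivial, rfl⟩⟩
  let f : X.functionField := X.germToFunctionField (φ ''ᵁ ⊤) (chartSection φ g)
  have hf0 : f ≠ 0 := by
    intro h
    exact hg0 ((map_eq_zero_iff _ (chartSection φ).injective).1
      ((map_eq_zero_iff _ (Scheme.germToFunctionField_injective _ _)).1 h))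
  have hy0 : Scheme.ord f (φ P) ≠ 0 := by
    intro h
    obtain ⟨u, hu⟩ := exists_unit_of_ord_eq_zero hX hy hf0 h
    have hmem : φ P ∈ φ ''ᵁ ⊤ := ⟨P, trivial, rfl⟩
    have h1 : (X.presheaf.germ _ _ hmem (chartSection φ g)) = u := by
      apply IsFractionRing.injective (X.presheaf.stalk (φ P)) X.functionField
      rw [hu]
      exact Scheme.algebraMap_germ_eq_germToFunctionField _ hmem _
    have h2 : φ P ∈ X.basicOpen (chartSection φ g) := by
      rw [Scheme.mem_basicOpen X _ _ hmem, h1]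
      exact u.isUnit
    exact (mem_basicOpen_chartSection φ g P).1 h2 hgP
  have hz0 : ∀ z ∈ φ ''ᵁ ⊤, z ≠ φ P → Scheme.ord f z = 0 := by
    rintro _ ⟨Q, -, rfl⟩ hQ
    change Scheme.ord f (φ Q) = 0
    by_contra h
    have hQ1 : coheight (φ Q) = 1 := ord_eq_zero_or_coheight_eq_one h
    by_cases hgQ : g ∈ Q.asIdeal
    · refine hQ (eq_of_specializes_of_coheight_eq_one hQ1 ?_ ?_).symm
      · exact Specializes.map ((PrimeSpectrum.le_iff_specializes P Q).1 (hg Q.asIdeal Q.2 hgQ))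
          φ.continuous
      · intro h
        rw [h] at hy
        exact zero_ne_one ((coheight_top (α := X)).symm.trans hy)
    · have hmem := (mem_basicOpen_chartSection φ g Q).2 hgQ
      have hne' : Nonempty (X.basicOpen (chartSection φ g) : X.Opens) := ⟨⟨_, hmem⟩⟩
      have hu := RingedSpace.isUnit_res_basicOpen X.toRingedSpace (chartSection φ g)
      refine h (Eq.trans ?_ (Scheme.ord_of_isUnit (U := X.basicOpen (chartSection φ g)) hu hmem))
      congr 1
      exact (X.presheaf.germ_res_apply _ _ _ _).symm
  -- Only the nonvanishing of the order was shown; passing to the inverse function if necessary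
  -- avoids determining its sign.
  rcases lt_or_gt_of_ne hy0 with h | h
  · refine ⟨-Additive.ofMul (Units.mk0 f hf0), ?_, fun z hz hzy ↦ ?_⟩
    · rw [map_neg]
      exact neg_pos.2 h
    · rw [map_neg]
      exact neg_eq_zero.2 (hz0 z hz hzy)
  · exact ⟨Additive.ofMul (Units.mk0 f hf0), h, hz0⟩

/-- If the units of an affine chart are constant, a rational function without zeros and poles on
the chart is constant. -/
theorem divHom_eq_zero_of_chart [IsIntegral X] [IsLocallyNoetherian X] (hX : IsNormal X)
    [Algebra ℂ A] (s : X ⟶ pt) (hs : φ ≫ s = Spec.map (CommRingCat.ofHom (algebraMap ℂ A)))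
    [Nontrivial A] (hA : ∀ x : A, IsUnit x → ∃ c, x = algebraMap ℂ A c)
    (f : Additive X.functionFieldˣ) (hf : ∀ y ∈ φ ''ᵁ ⊤, divHom X f y = 0) : divHom X f = 0 := by
  obtain ⟨P⟩ : Nonempty (Spec (.of A)) := inferInstanceAs (Nonempty (PrimeSpectrum A))
  have hne : Nonempty (φ ''ᵁ ⊤ : X.Opens) := ⟨⟨φ P, P, trivial, rfl⟩⟩
  obtain ⟨u, hu⟩ := exists_isUnit_of_forall_ord_eq_zero hX (isAffineOpen_image_top φ)
    (Units.ne_zero f.toMul) hf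
  obtain ⟨c, hc⟩ := hA ((chartSection φ).symm u) (u.isUnit.map (chartSection φ).symm)
  have hc0 : c ≠ 0 := by
    rintro rfl
    have := u.isUnit.map (chartSection φ).symm
    rw [hc, map_zero] at this
    exact not_isUnit_zero this
  -- On the chart `f` equals a nonzero constant `c`. The same constant pulled back from `Spec ℂ` is
  -- a global unit with the same germ, so `f` is a unit everywhere.
  let t : Γ(X, ⊤) := s.appTop ((Scheme.ΓSpecIso (.of ℂ)).inv c)
  have ht : IsUnit t := ((IsUnit.mk0 c hc0).map (Scheme.ΓSpecIso (.of ℂ)).inv.hom).map s.appTop.hom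
  have htu : X.presheaf.map (homOfLE le_top : φ ''ᵁ ⊤ ⟶ ⊤).op t = u := by
    rw [← (chartSection φ).apply_symm_apply u, hc]
    have h1 : s.appTop ≫ X.presheaf.map (homOfLE le_top : φ ''ᵁ ⊤ ⟶ ⊤).op ≫ (φ.appIso ⊤).hom =
        s.appTop ≫ φ.appTop := by
      rw [Scheme.Hom.appIso_hom', Scheme.Hom.map_appLE, Scheme.Hom.appTop, Scheme.Hom.app_eq_appLE]
      rfl
    rw [← Scheme.Hom.comp_appTop, hs] at h1
    have h2 := Scheme.ΓSpecIso_inv_naturality (CommRingCat.ofHom (algebraMap ℂ A))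
    have h3 : (Scheme.ΓSpecIso (.of ℂ)).inv ≫ s.appTop ≫
        X.presheaf.map (homOfLE le_top : φ ''ᵁ ⊤ ⟶ ⊤).op = CommRingCat.ofHom (algebraMap ℂ A) ≫
        (Scheme.ΓSpecIso (.of A)).inv ≫ (φ.appIso ⊤).inv := by
      rw [← Category.assoc (CommRingCat.ofHom _), h2, Category.assoc, ← h1]
      simp
    exact congr($(h3).hom c)
  have hne' : Nonempty (⊤ : X.Opens) := ⟨⟨φ P, trivial⟩⟩
  have hft : X.germToFunctionField ⊤ t = f.toMul := by
    rw [← hu, ← htu]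
    exact (X.presheaf.germ_res_apply _ _ _ _).symm
  funext y
  change Scheme.ord (f.toMul : X.functionField) y = 0
  rw [← hft]
  exact Scheme.ord_of_isUnit ht trivial

end Single

variable {I : Type} {A : I → Type} [∀ i, CommRing (A i)] (φ : ∀ i, Spec (.of (A i)) ⟶ X)
  [∀ i, IsOpenImmersion (φ i)] (hφ : ∀ x, ∃ i, x ∈ Set.range (φ i))

include hφ

theorem isNormal_of_charts [∀ i, IsDomain (A i)] [∀ i, IsIntegrallyClosed (A i)] : IsNormal X := by
  intro x
  obtain ⟨i, P, rfl⟩ := hφ x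
  exact isIntegrallyClosed_stalk_of_chart (φ i) P

/-- The charts are irreducible and all contain the nonempty open set `W`, so every nonempty open set
meets `W`, and two of them meet within one chart. -/
theorem isIntegral_of_charts [∀ i, IsDomain (A i)] {W : X.Opens} (hne : (W : Set X).Nonempty)
    (hW : ∀ i, (W : Set X) ⊆ Set.range (φ i)) : IsIntegral X := by
  have hred : IsReduced X := by
    let 𝒰 : X.OpenCover := Scheme.Cover.mkOfCovers I _ φ
      (fun x ↦ (hφ x).imp fun i ⟨y, hy⟩ ↦ ⟨y, hy⟩) (fun i ↦ inferInstance)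
    have : ∀ i, IsReduced (𝒰.X i) := fun i : I ↦ inferInstanceAs (IsReduced (Spec (.of (A i))))
    exact IsReduced.of_openCover (X := X) 𝒰
  have : Nonempty X := ⟨hne.some⟩
  have hirr (i : I) : IsPreirreducible (Set.range (φ i)) := by
    have : IsIntegral (Spec (.of (A i))) := inferInstance
    rw [← Set.image_univ]
    exact (PreirreducibleSpace.isPreirreducible_univ (X := Spec (.of (A i)))).image _
      (φ i).continuous.continuousOn
  have key (U : Set X) (hU : IsOpen U) (hUne : U.Nonempty) : (U ∩ W).Nonempty := by
    obtain ⟨x, hx⟩ := hUne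
    obtain ⟨i, hi⟩ := hφ x
    obtain ⟨w, hw⟩ := hne
    obtain ⟨z, -, hz⟩ := hirr i U W hU W.2 ⟨x, hi, hx⟩ ⟨w, hW i hw, hw⟩
    exact ⟨z, hz⟩
  have : PreirreducibleSpace X := ⟨fun U U' hU hU' hUne hUne' ↦ by
    obtain ⟨x, -, hx⟩ := hUne
    obtain ⟨x', -, hx'⟩ := hUne'
    obtain ⟨w, hwU, hw⟩ := key U hU ⟨x, hx⟩
    obtain ⟨w', hwU', hw'⟩ := key U' hU' ⟨x', hx'⟩
    obtain ⟨i, hi⟩ := hφ w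
    obtain ⟨z, -, hz⟩ := hirr i U U' hU hU' ⟨w, hi, hwU⟩ ⟨w', hW i hw', hwU'⟩
    exact ⟨z, trivial, hz⟩⟩
  have : IrreducibleSpace X := ⟨inferInstance⟩
  exact isIntegral_of_irreducibleSpace_of_isReduced X

theorem topologicalKrullDim_eq_of_charts [Nonempty I] {n : WithBot ℕ∞}
    (hn : ∀ i, ringKrullDim (A i) = n) : topologicalKrullDim X = n := by
  have hdim (i : I) : topologicalKrullDim (Spec (.of (A i))) = n :=
    (PrimeSpectrum.topologicalKrullDim_eq_ringKrullDim (A i)).trans (hn i)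
  refine le_antisymm (iSup_le fun l ↦ ?_) ?_
  -- A chain of irreducible closed sets is no longer than the coheight of a point of its smallest
  -- member, which is the height of a prime in a chart.
  · obtain ⟨x, hx⟩ := l.head.2.nonempty
    obtain ⟨i, P, rfl⟩ := hφ x
    have : P.asIdeal.IsPrime := P.2
    have hPn : (coheight P : WithBot ℕ∞) ≤ n := by
      rw [← hn i, ← idealHeight_eq_coheight (.of (A i)) P]
      exact Ideal.height_le_ringKrullDim_of_isPrime
    refine le_trans ?_ hPn
    rw [← coheight_eq_of_isOpenImmersion (φ i), ← coheight_orderIso (irreducibleSetEquivPoints (α := X)).symm]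
    refine le_trans ?_ (WithBot.coe_le_coe.2 (coheight_anti (show _ ≤ l.head from ?_)))
    · exact WithBot.coe_le_coe.2 (length_le_coheight_head)
    · exact l.head.3.closure_subset_iff.2 (Set.singleton_subset_iff.2 hx)
  · rw [← hdim (Classical.arbitrary I)]
    exact (φ _).isOpenEmbedding.isInducing.topologicalKrullDim_le

end AffineCharts

/-! ### Dimension, normality, toric structure and `ℚ`-factoriality -/

section Structure

variable (a b : Fin 3 → ℚ) [h : Fact (IsFormat a b)]

/-- All weights are positive, so only constants have degree zero. Properness over the spectrum of
the degree zero part then becomes properness over `ℂ`. -/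
theorem bijective_algebraMap_grading_zero :
    Function.Bijective (algebraMap ℂ (grading a b 0)) := by
  refine ⟨fun c c' hc ↦ ?_, fun x ↦ ?_⟩
  · have : Nontrivial CoordRing := inferInstance
    exact (algebraMap ℂ CoordRing).injective (congrArg Subtype.val hc)
  · have hx : param x ∈ (grading a b 0).map param.toLinearMap := ⟨x, x.2, rfl⟩
    have h0 : monomialSet a b 0 = {0} := by
      ext m
      rw [h.out.mem_monomialSet, Set.mem_singleton_iff]
      constructor
      · rintro ⟨e, he, rfl⟩
        have := Finsupp.nonTorsionWeight_of ℕ (w := wt a b) fun p ↦ (wt_pos' a b p).ne'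
        rw [(Finsupp.weight_eq_zero_iff_eq_zero (wt a b)).1 he, map_zero]
      · rintro rfl
        exact ⟨0, map_zero _, map_zero _⟩
    rw [h.out.map_param_grading, h0, Set.image_singleton, Submodule.mem_span_singleton] at hx
    obtain ⟨c, hc⟩ := hx
    refine ⟨c, Subtype.ext (param_injective ?_)⟩
    rw [← hc]
    change param (algebraMap ℂ CoordRing c) = _
    rw [AlgHom.commutes, Algebra.algebraMap_eq_smul_one]
    rfl

instance : IsProper (projOver (grading a b)).hom := by
  have : IsIso (CommRingCat.ofHom (algebraMap ℂ (grading a b 0))) :=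
    (inferInstance : IsIso (RingEquiv.ofBijective _
      (bijective_algebraMap_grading_zero a b)).toCommRingCatIso.hom)
  change IsProper (Proj.toSpecZero (grading a b) ≫ Spec.map _)
  infer_instance

instance : IsLocallyNoetherian (projOver (grading a b)).left :=
  LocallyOfFiniteType.isLocallyNoetherian (projOver (grading a b)).hom

instance : CompactSpace (projOver (grading a b)).left :=
  QuasiCompact.compactSpace_of_compactSpace (projOver (grading a b)).hom

/-- The chart where `x p ≠ 0`, as a morphism of schemes. -/
abbrev affineChart (p : Fin 3 × Fin 3) :
    Spec (.of (AddMonoidAlgebra ℂ (chartMonoid a b p))) ⟶ (projOver (grading a b)).left :=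
  (chart a b p).left

instance (p : Fin 3 × Fin 3) : IsOpenImmersion (affineChart a b p) :=
  inferInstanceAs (IsOpenImmersion (chart a b p).left)

theorem image_affineChart (p : Fin 3 × Fin 3) :
    affineChart a b p ''ᵁ ⊤ = Proj.basicOpen (grading a b) (coord p) :=
  (Scheme.Hom.image_top_eq_opensRange _).trans (opensRange_chart a b p)

instance (p : Fin 3 × Fin 3) : IsDomain (AddMonoidAlgebra ℂ (chartMonoid a b p)) :=
  isDomain_of_injective (h.out.chartExpo_injective p)

/-- The direction is reversed: `Proj` is of finite type over `ℂ`, hence locally Noetherian, and its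
chart rings inherit this without a separate study of the monoid. -/
instance (p : Fin 3 × Fin 3) : IsNoetherianRing (AddMonoidAlgebra ℂ (chartMonoid a b p)) :=
  have : IsNoetherianRing Γ((projOver (grading a b)).left, affineChart a b p ''ᵁ ⊤) :=
    IsLocallyNoetherian.component_noetherian ⟨_, isAffineOpen_image_top (affineChart a b p)⟩
  isNoetherianRing_of_ringEquiv _ (chartSection (affineChart a b p)).symm

theorem chartAlgebra_properties (p : Fin 3 × Fin 3) :
    IsIntegrallyClosed (AddMonoidAlgebra ℂ (chartMonoid a b p)) ∧
      HasPrincipalDivisors (AddMonoidAlgebra ℂ (chartMonoid a b p)) ∧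
      ringKrullDim (AddMonoidAlgebra ℂ (chartMonoid a b p)) = 4 := by
  have : NeZero (wt a b p) := ⟨(wt_pos' a b p).ne'⟩
  obtain ⟨h₁, h₂, h₃⟩ := cyclicQuotient_properties (chartWeight a b p)
    (h.out.chartExpo_injective p) (h.out.mem_range_chartExpo p)
  refine ⟨h₁, h₂, ?_⟩
  rw [h₃, card_chartIndex]
  rfl

instance (p : Fin 3 × Fin 3) : IsIntegrallyClosed (AddMonoidAlgebra ℂ (chartMonoid a b p)) :=
  (chartAlgebra_properties a b p).1

theorem isNormal_proj : IsNormal (projOver (grading a b)).left :=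
  isNormal_of_charts (affineChart a b) (exists_mem_range_chart a b)

theorem topologicalKrullDim_proj : topologicalKrullDim (projOver (grading a b)).left = 4 :=
  topologicalKrullDim_eq_of_charts (affineChart a b) (exists_mem_range_chart a b)
    fun p ↦ (chartAlgebra_properties a b p).2.2

instance : IsIntegral (projOver (grading a b)).left := by
  obtain ⟨n, j, α, hj, hjα⟩ := exists_torus_embedding a b
  have hne : Nonempty (torus n).left :=
    inferInstanceAs (Nonempty (PrimeSpectrum (AddMonoidAlgebra ℂ (Fin n → ℤ))))
  refine isIntegral_of_charts (affineChart a b) (exists_mem_range_chart a b)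
    (W := j.left.opensRange) (Set.range_nonempty j.left) fun p ↦ ?_
  rintro _ ⟨x, rfl⟩
  have := congrArg (fun f : torus n ⟶ projOver (grading a b) ↦ f.left x) (hjα p)
  exact ⟨(affineToricMap (α p)).left x, this⟩

theorem isVariety_proj : IsVariety (projOver (grading a b)) :=
  ⟨inferInstance, inferInstance, inferInstance, inferInstance⟩

theorem isToric_proj : IsToric (projOver (grading a b)) := by
  refine ⟨isVariety_proj a b, isNormal_proj a b, ?_⟩
  obtain ⟨n, j, α, hj, hjα⟩ := exists_torus_embedding a b
  have hne : Nonempty (torus n).left :=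
    inferInstanceAs (Nonempty (PrimeSpectrum (AddMonoidAlgebra ℂ (Fin n → ℤ))))
  have hdense : Dense (Set.range j.left) :=
    j.left.isOpenEmbedding.isOpen_range.dense (Set.range_nonempty _)
  have : IsDominant j.left := ⟨hdense⟩
  obtain ⟨act, h₁, h₂, h₃⟩ := exists_torus_action j α (chart a b) (exists_mem_range_chart a b) hjα
  exact ⟨n, j, act, hj, hdense, h₁, h₂, h₃⟩

theorem hasTorsionClassGroup_proj (p : Fin 3 × Fin 3) :
    HasTorsionClassGroup (affineChart a b p ''ᵁ ⊤) :=
  hasTorsionClassGroup_of_chart _ (isNormal_proj a b) (chartAlgebra_properties a b p).2.1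

theorem exists_mem_image_affineChart (x : (projOver (grading a b)).left) :
    ∃ p, x ∈ affineChart a b p ''ᵁ ⊤ := by
  obtain ⟨p, y, hy⟩ := exists_mem_range_chart a b x
  exact ⟨p, y, trivial, hy⟩

theorem isQFactorial_proj : IsQFactorial (projOver (grading a b)).left :=
  isQFactorial_of_hasTorsionClassGroup (isNormal_proj a b) (exists_mem_image_affineChart a b)
    (hasTorsionClassGroup_proj a b)

end Structure

/-! ### Specialization and codimension on `Proj` -/

section ProjPoints

open HomogeneousLocalization Order

variable {R : Type} [CommRing R] [Algebra ℂ R] {𝒜 : ℕ → Submodule ℂ R} [GradedAlgebra 𝒜]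

theorem proj_specializes_iff {x y : Proj 𝒜} :
    x ⤳ y ↔ x.asHomogeneousIdeal.toIdeal ≤ y.asHomogeneousIdeal.toIdeal :=
  (specializes_iff_mem_closure (x := x) (y := y)).trans
    (ProjectiveSpectrum.le_iff_mem_closure 𝒜 x y).symm

/-- Krull's principal ideal theorem on `Proj`. -/
theorem proj_coheight_le_one {f g : R} {m m' : ℕ} (hf : f ∈ 𝒜 m) (hm : 0 < m) (hg : g ∈ 𝒜 m')
    (hm' : 0 < m') [IsNoetherianRing (Away 𝒜 f)] {y : Proj 𝒜} (hyf : y ∈ Proj.basicOpen 𝒜 f)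
    (hyg : y ∉ Proj.basicOpen 𝒜 g)
    (hmin : ∀ z ∈ Proj.basicOpen 𝒜 f, z ∉ Proj.basicOpen 𝒜 g → z ⤳ y → y ⤳ z) :
    coheight y ≤ 1 := by
  rw [← Proj.opensRange_awayι 𝒜 f hf hm] at hyf hmin
  obtain ⟨P, rfl⟩ := hyf
  have key (Q : Spec (.of (Away 𝒜 f))) : Proj.awayι 𝒜 f hf hm Q ∈ Proj.basicOpen 𝒜 g ↔
      Away.isLocalizationElem hf hg ∉ Q.asIdeal :=
    Eq.to_iff congr(Q ∈ $(Proj.awayι_preimage_basicOpen 𝒜 hf hm hg hm'))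
  have hP : P.asIdeal.IsPrime := P.2
  have hPg : Away.isLocalizationElem hf hg ∈ P.asIdeal := by
    by_contra h
    exact hyg ((key P).2 h)
  refine (coheight_eq_height_of_chart (Proj.awayι 𝒜 f hf hm) P).trans_le
    (Ideal.height_le_one_of_isPrincipal_of_mem_minimalPrimes
      (Ideal.span {Away.isLocalizationElem hf hg}) _
      ⟨⟨hP, (Ideal.span_singleton_le_iff_mem _).2 hPg⟩, ?_⟩)
  rintro Q ⟨hQ, hgQ⟩ hQP
  let q : Spec (.of (Away 𝒜 f)) := ⟨Q, hQ⟩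
  have hqP : q ⤳ P := (PrimeSpectrum.le_iff_specializes q P).1 hQP
  have h1 := hmin (Proj.awayι 𝒜 f hf hm q) ⟨q, rfl⟩
    (fun h ↦ (key q).1 h ((Ideal.span_singleton_le_iff_mem _).1 hgQ))
    (hqP.map (Proj.awayι 𝒜 f hf hm).continuous)
  exact (PrimeSpectrum.le_iff_specializes P q).2
    ((Proj.awayι 𝒜 f hf hm).isOpenEmbedding.isInducing.specializes_iff.1 h1)

end ProjPoints

/-! ### Prime divisors where a row or a column vanishes -/

section Retraction

/-- A set of positions in the matrix such that the `2 × 2` minors are compatible with replacing the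
entries in these positions by zero. -/
def IsLine (E : Set (Fin 3 × Fin 3)) : Prop :=
  ∀ i k j l, (i, j) ∈ E ∨ (k, l) ∈ E ↔ (i, l) ∈ E ∨ (k, j) ∈ E

theorem isLine_row (i : Fin 3) : IsLine {p | p.1 = i} := fun _ _ _ _ ↦ Iff.rfl

theorem isLine_column (j : Fin 3) : IsLine {p | p.2 = j} := fun _ _ _ _ ↦ or_comm

variable {E : Set (Fin 3 × Fin 3)} (hE : IsLine E)

open Classical in
/-- The retraction of the coordinate ring that replaces the coordinates in `E` by zero. -/
def retraction : CoordRing →ₐ[ℂ] CoordRing :=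
  Ideal.Quotient.liftₐ minorsIdeal
    (MvPolynomial.aeval fun p ↦ if p ∈ E then 0 else coord p) fun f hf ↦ by
    suffices minorsIdeal ≤ RingHom.ker
      (MvPolynomial.aeval (R := ℂ) fun p ↦ if p ∈ E then 0 else coord p) from this hf
    refine Ideal.span_le.2 ?_
    rintro _ ⟨i, k, j, l, rfl⟩
    have key (p q : Fin 3 × Fin 3) : (if p ∈ E then 0 else coord p) *
        (if q ∈ E then 0 else coord q) = if p ∈ E ∨ q ∈ E then 0 else coord p * coord q := by
      by_cases hp : p ∈ E <;> by_cases hq : q ∈ E <;> simp [hp, hq]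
    simp [key, hE i k j l, coord_mul_coord i k j l]

open Classical in
theorem retraction_coord (p : Fin 3 × Fin 3) :
    retraction hE (coord p) = if p ∈ E then 0 else coord p :=
  MvPolynomial.aeval_X _ _

/-- The retraction is the identity modulo the coordinates in `E`, so its kernel is the ideal they
generate. That ideal is then prime because `CoordRing` is a domain. -/
theorem sub_retraction_mem (x : CoordRing) : x - retraction hE x ∈ Ideal.span (coord '' E) := by
  obtain ⟨f, rfl⟩ := Ideal.Quotient.mk_surjective x
  induction f using MvPolynomial.induction_on with
  | C c =>
    have : retraction hE (algebraMap ℂ CoordRing c) = algebraMap ℂ CoordRing c :=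
      AlgHom.commutes _ _
    change algebraMap ℂ CoordRing c - retraction hE (algebraMap ℂ CoordRing c) ∈ _
    rw [this, sub_self]
    exact zero_mem _
  | add f g hf hg =>
    rw [map_add, map_add, add_sub_add_comm]
    exact add_mem hf hg
  | mul_X f p hf =>
    rw [map_mul, map_mul]
    change _ * coord p - _ * retraction hE (coord p) ∈ _
    rw [retraction_coord]
    split_ifs with hp
    · rw [mul_zero, sub_zero]
      exact Ideal.mul_mem_left _ _ (Ideal.subset_span ⟨p, hp, rfl⟩)
    · rw [← sub_mul]
      exact Ideal.mul_mem_right _ _ hf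

theorem ker_retraction : RingHom.ker (retraction hE) = Ideal.span (coord '' E) := by
  refine le_antisymm (fun x hx ↦ ?_) (Ideal.span_le.2 ?_)
  · have := sub_retraction_mem hE x
    rwa [(RingHom.mem_ker).1 hx, sub_zero] at this
  · rintro _ ⟨p, hp, rfl⟩
    change retraction hE (coord p) = 0
    rw [retraction_coord, if_pos hp]

include hE in
theorem isPrime_span_coord : (Ideal.span (coord '' E)).IsPrime := by
  rw [← ker_retraction hE]
  exact RingHom.ker_isPrime _

include hE in
theorem coord_mem_span_iff (p : Fin 3 × Fin 3) : coord p ∈ Ideal.span (coord '' E) ↔ p ∈ E := by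
  refine ⟨fun h ↦ ?_, fun h ↦ Ideal.subset_span ⟨p, h, rfl⟩⟩
  by_contra hp
  rw [← ker_retraction hE] at h
  have : retraction hE (coord p) = 0 := h
  rw [retraction_coord, if_neg hp] at this
  exact coord_ne_zero p this

variable (a b : Fin 3 → ℚ) [h : Fact (IsFormat a b)]

/-- The generic point of the closed subset where the coordinates in `E` vanish. -/
def boundaryPoint {q : Fin 3 × Fin 3} (hq : q ∉ E) : Proj (grading a b) where
  asHomogeneousIdeal := ⟨Ideal.span (coord '' E), Ideal.homogeneous_span _ _ (by
    rintro _ ⟨p, -, rfl⟩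
    exact ⟨_, coord_mem p⟩)⟩
  isPrime := isPrime_span_coord hE
  not_irrelevant_le hle := hq <| (coord_mem_span_iff hE q).1 <| hle <| by
    rw [HomogeneousIdeal.mem_irrelevant_iff]
    exact DirectSum.decompose_of_mem_ne _ (coord_mem q) (wt_pos' a b q).ne'

theorem boundaryPoint_mem_basicOpen_iff {q : Fin 3 × Fin 3} (hq : q ∉ E) (p : Fin 3 × Fin 3) :
    boundaryPoint hE a b hq ∈ Proj.basicOpen (grading a b) (coord p) ↔ p ∉ E :=
  not_congr (coord_mem_span_iff hE p)

theorem boundaryPoint_specializes {q : Fin 3 × Fin 3} (hq : q ∉ E) {y : Proj (grading a b)}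
    (hy : ∀ p ∈ E, y ∉ Proj.basicOpen (grading a b) (coord p)) :
    boundaryPoint hE a b hq ⤳ y := by
  rw [proj_specializes_iff]
  refine Ideal.span_le.2 ?_
  rintro _ ⟨p, hp, rfl⟩
  exact not_not.1 (hy p hp)

variable {a b} in
-- If `x i l` and `x k j` were both nonzero at `y`, so would be their product `x i j * x k l`.
theorem row_or_column {y : Proj (grading a b)} {i j : Fin 3}
    (hy : y ∉ Proj.basicOpen (grading a b) (coord (i, j))) :
    (∀ p ∈ {p : Fin 3 × Fin 3 | p.1 = i}, y ∉ Proj.basicOpen (grading a b) (coord p)) ∨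
      ∀ p ∈ {p : Fin 3 × Fin 3 | p.2 = j}, y ∉ Proj.basicOpen (grading a b) (coord p) := by
  have hprime := y.isPrime
  by_contra! hc
  obtain ⟨⟨⟨i', l⟩, hi, hl⟩, ⟨⟨k, j'⟩, hj, hk⟩⟩ := hc
  obtain rfl : i' = i := hi
  obtain rfl : j' = j := hj
  have : coord (i', l) * coord (k, j') ∈ y.asHomogeneousIdeal.toIdeal := by
    rw [← coord_mul_coord]
    exact Ideal.mul_mem_right _ _ (not_not.1 hy)
  exact (hprime.mem_or_mem this).elim hl hk

open Order in
-- On `x k l ≠ 0` the single equation `x i j = 0` cuts out exactly the locus of `E`, so Krull's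
-- theorem gives the upper bound. The lower bound is strict specialization from the generic point.
theorem coheight_boundaryPoint {i j k l : Fin 3} (hij : (i, j) ∈ E) (hkl : (k, l) ∉ E)
    (hmin : ∀ y ∈ Proj.basicOpen (grading a b) (coord (k, l)),
      y ∉ Proj.basicOpen (grading a b) (coord (i, j)) →
        ∀ p ∈ E, y ∉ Proj.basicOpen (grading a b) (coord p)) :
    coheight (boundaryPoint hE a b hkl) = 1 := by
  have hnoeth : IsNoetherianRing (HomogeneousLocalization.Away (grading a b) (coord (k, l))) :=
    isNoetherianRing_of_ringEquiv _ (chartEquiv a b (k, l))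
  have hij' : boundaryPoint hE a b hkl ∉ Proj.basicOpen (grading a b) (coord (i, j)) := by
    rw [boundaryPoint_mem_basicOpen_iff]
    exact not_not.2 hij
  refine le_antisymm (proj_coheight_le_one (coord_mem (k, l)) (wt_pos' a b _) (coord_mem (i, j))
    (wt_pos' a b _) ((boundaryPoint_mem_basicOpen_iff hE a b hkl _).2 hkl) hij'
    fun z hz hz' _ ↦ boundaryPoint_specializes hE a b hkl (hmin z hz hz')) ?_
  have : IsIntegral (Proj (grading a b)) :=
    inferInstanceAs (IsIntegral (projOver (grading a b)).left)
  have hne : ((Proj.basicOpen (grading a b) (coord (i, j)) : (Proj (grading a b)).Opens) :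
      Set (Proj (grading a b))).Nonempty := by
    rw [← opensRange_chart]
    exact Set.range_nonempty (affineChart a b (i, j))
  have hgen : genericPoint (Proj (grading a b)) ∈ Proj.basicOpen (grading a b) (coord (i, j)) :=
    (genericPoint_spec _).mem_open_set_iff (Proj.basicOpen (grading a b) (coord (i, j))).2 |>.2
      (by simpa using hne)
  have hlt : boundaryPoint hE a b hkl < genericPoint (Proj (grading a b)) := by
    refine lt_of_le_not_ge (genericPoint_specializes _) fun hle ↦ hij' ?_
    exact (show _ ⤳ _ from hle).mem_open (Proj.basicOpen (grading a b) (coord (i, j))).2 hgen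
  exact le_trans (by simp) (coheight_add_one_le hlt)

end Retraction

/-! ### The Picard rank -/

section PicardRank

variable (a b : Fin 3 → ℚ) [h : Fact (IsFormat a b)]

theorem picardRank_proj : picardRank (projOver (grading a b)).left = 2 := by
  have h10 : ((1, 0) : Fin 3 × Fin 3) ∉ {p : Fin 3 × Fin 3 | p.1 = 0} := by simp
  have h01 : ((0, 1) : Fin 3 × Fin 3) ∉ {p : Fin 3 × Fin 3 | p.2 = 0} := by simp
  let η₁ := boundaryPoint (isLine_row 0) a b h10
  let η₂ := boundaryPoint (isLine_column 0) a b h01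
  have hU : affineChart a b (0, 0) ''ᵁ ⊤ = Proj.basicOpen (grading a b) (coord (0, 0)) :=
    image_affineChart a b (0, 0)
  -- Where `x₁₀ ≠ 0`, column 0 cannot vanish identically, so `x₀₀ = 0` forces row 0 to vanish; `(0,
  -- 1)` plays the symmetric role for column 0.
  have h₁ : Order.coheight η₁ = 1 :=
    coheight_boundaryPoint (i := 0) (j := 0) _ a b (by simp) h10 fun y hy hy' ↦
      (row_or_column hy').resolve_right fun hc ↦ hc (1, 0) rfl hy
  have h₂ : Order.coheight η₂ = 1 :=
    coheight_boundaryPoint (i := 0) (j := 0) _ a b (by simp) h01 fun y hy hy' ↦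
      (row_or_column hy').resolve_left fun hc ↦ hc (0, 1) rfl hy
  have hne {E : Set (Fin 3 × Fin 3)} (hE : IsLine E) {q : Fin 3 × Fin 3} (hq : q ∉ E)
      (hE0 : (0, 0) ∈ E) : boundaryPoint hE a b hq ∉ affineChart a b (0, 0) ''ᵁ ⊤ := by
    rw [hU]
    exact fun h ↦ (boundaryPoint_mem_basicOpen_iff hE a b hq (0, 0)).1 h hE0
  have hgen {E : Set (Fin 3 × Fin 3)} (hE : IsLine E) {q : Fin 3 × Fin 3} (hq : q ∉ E)
      (h1 : Order.coheight (boundaryPoint hE a b hq) = 1) :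
      boundaryPoint hE a b hq ≠ genericPoint (projOver (grading a b)).left := by
    intro h
    rw [h] at h1
    exact zero_ne_one ((Order.coheight_top (α := (projOver (grading a b)).left)).symm.trans h1)
  refine picardRank_eq_two (isNormal_proj a b) (exists_mem_image_affineChart a b)
    (hasTorsionClassGroup_proj a b) (0, 0)
    (divHom_eq_zero_of_chart (affineChart a b (0, 0)) (isNormal_proj a b)
      (projOver (grading a b)).hom (Over.w (chart a b (0, 0)))
      fun x hx ↦ exists_eq_single_of_isUnit (h.out.chartExpo_injective (0, 0)) hx)
    (p := η₁) (q := η₂) (fun h ↦ ?_) h₁ h₂ (hne _ _ (by simp)) (hne _ _ (by simp))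
    fun y hy hyU ↦ ?_
  · have h1 : η₁ ∈ Proj.basicOpen (grading a b) (coord (1, 0)) :=
      (boundaryPoint_mem_basicOpen_iff _ a b h10 _).2 h10
    have h2 : η₂ ∉ Proj.basicOpen (grading a b) (coord (1, 0)) := fun h ↦
      (boundaryPoint_mem_basicOpen_iff _ a b h01 _).1 h rfl
    rw [h] at h1
    exact h2 h1
  · rw [hU] at hyU
    rcases row_or_column hyU with hy' | hy'
    · exact .inl (eq_of_specializes_of_coheight_eq_one hy
        (boundaryPoint_specializes (isLine_row 0) a b h10 hy') (hgen _ _ h₁)).symm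
    · exact .inr (eq_of_specializes_of_coheight_eq_one hy
        (boundaryPoint_specializes (isLine_column 0) a b h01 hy') (hgen _ _ h₂)).symm

end PicardRank

/-! ### A chartwise criterion for closed immersions -/

section ClosedImmersion

/-- A proper morphism is a closed immersion if it restricts to closed immersions of affine charts
which are preimages of open subsets of the target. -/
theorem isClosedImmersion_of_charts {X Y S : Scheme.{0}} (f : X ⟶ Y) (s : Y ⟶ S)
    [IsProper (f ≫ s)] [IsSeparated s] {I : Type} {U V : I → Scheme.{0}} (κ : ∀ i, U i ⟶ X)
    [∀ i, IsOpenImmersion (κ i)] (hκ : ∀ x, ∃ i, x ∈ Set.range (κ i)) (ν : ∀ i, V i ⟶ Y)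
    [∀ i, IsOpenImmersion (ν i)] (g : ∀ i, U i ⟶ V i) [∀ i, IsClosedImmersion (g i)]
    (hfac : ∀ i, κ i ≫ f = g i ≫ ν i)
    (hpre : ∀ i x, f x ∈ Set.range (ν i) → x ∈ Set.range (κ i)) : IsClosedImmersion f := by
  have hproper : IsProper f := .of_comp f s
  have : MorphismProperty.RespectsRight @IsImmersion @IsOpenImmersion :=
    ⟨fun i (_ : IsOpenImmersion i) f (_ : IsImmersion f) ↦ inferInstanceAs (IsImmersion (f ≫ i))⟩
  have : MorphismProperty.HasOfPostcompProperty @IsImmersion @IsOpenImmersion :=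
    ⟨fun f i (_ : IsOpenImmersion i) (_ : IsImmersion (f ≫ i)) ↦ IsImmersion.of_comp f i⟩
  -- By `hpre`, over the image of `ν i` the map `f` is a restriction of `g i` followed by an open
  -- immersion, hence an immersion. A proper monomorphism is then a closed immersion.
  have himm : IsImmersion f := by
    refine IsZariskiLocalAtTarget.of_forall_source_exists_preimage f fun x ↦ ?_
    obtain ⟨i, y, rfl⟩ := hκ x
    refine ⟨(ν i).opensRange, ⟨g i y, ?_⟩, ?_⟩
    · exact congr($(hfac i) y).symm
    · have hrange : Set.range (f ⁻¹ᵁ (ν i).opensRange).ι ⊆ Set.range (κ i) := by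
        rw [Scheme.Opens.range_ι]
        exact fun z hz ↦ hpre i z hz
      have hl := IsOpenImmersion.lift_fac (κ i) (f ⁻¹ᵁ (ν i).opensRange).ι hrange
      have : IsImmersion (IsOpenImmersion.lift (κ i) (f ⁻¹ᵁ (ν i).opensRange).ι hrange ≫ κ i) := by
        rw [hl]; infer_instance
      have := IsImmersion.of_comp (IsOpenImmersion.lift (κ i) (f ⁻¹ᵁ (ν i).opensRange).ι hrange) (κ i)
      rw [← hl, Category.assoc, hfac]
      infer_instance
  exact IsClosedImmersion.iff_isProper_and_mono f |>.2 ⟨hproper, inferInstance⟩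

end ClosedImmersion

/-! ### Factoring a ring homomorphism through an injection -/

section Lifting

theorem exists_surjective_of_range_eq {A B L : Type} [CommRing A] [CommRing B] [CommRing L]
    {φ : A →+* L} (hφ : Function.Injective φ) (ψ : B →+* L) (h : φ.range = ψ.range) :
    ∃ g : B →+* A, Function.Surjective g ∧ ∀ x, φ (g x) = ψ x := by
  let e := RingEquiv.ofBijective φ.rangeRestrict
    ⟨fun x y h ↦ hφ (congrArg Subtype.val h), φ.rangeRestrict_surjective⟩
  refine ⟨e.symm.toRingHom.comp (ψ.codRestrict φ.range fun x ↦ h ▸ ⟨x, rfl⟩), fun x ↦ ?_,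
    fun x ↦ ?_⟩
  · obtain ⟨y, hy⟩ : φ x ∈ ψ.range := h ▸ ⟨x, rfl⟩
    refine ⟨y, (e.symm_apply_eq).2 (Subtype.ext hy)⟩
  · exact congrArg Subtype.val (e.apply_symm_apply (ψ.codRestrict φ.range _ x))

end Lifting

/-! ### Monomial maps to projective space on charts -/

section ToProjectiveSpace

open MvPolynomial HomogeneousLocalization

instance (n : ℕ) : GradedAlgebra (homogeneousSubmodule (Fin (n + 1)) ℂ) :=
  MvPolynomial.gradedAlgebra

variable {n : ℕ} {Λ : Type} [AddCommGroup Λ] (ν : Fin (n + 1) → Λ)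

/-- The ring homomorphism from the homogeneous coordinate ring of `ℙⁿ` to a Laurent polynomial ring
given by a family of monomials. -/
def monomialHom : MvPolynomial (Fin (n + 1)) ℂ →ₐ[ℂ] AddMonoidAlgebra ℂ Λ :=
  aeval fun i ↦ AddMonoidAlgebra.single (ν i) 1

theorem monomialHom_X (i : Fin (n + 1)) : monomialHom ν (X i) = AddMonoidAlgebra.single (ν i) 1 :=
  aeval_X _ _

theorem monomialHom_monomial (e : Fin (n + 1) →₀ ℕ) (c : ℂ) :
    monomialHom ν (monomial e c) = AddMonoidAlgebra.single (e.sum fun i k ↦ k • ν i) c := by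
  rw [monomialHom, aeval_monomial]
  have h : (e.prod fun i k ↦ (AddMonoidAlgebra.single (ν i) (1 : ℂ)) ^ k) =
      AddMonoidAlgebra.single (e.sum fun i k ↦ k • ν i) 1 := by
    simp only [Finsupp.prod, AddMonoidAlgebra.single_pow, one_pow]
    exact (map_prod (AddMonoidAlgebra.of ℂ Λ)
      (fun i ↦ Multiplicative.ofAdd (e i • ν i)) e.support).symm
  rw [h, AddMonoidAlgebra.coe_algebraMap]
  change AddMonoidAlgebra.single 0 c * _ = _
  rw [AddMonoidAlgebra.single_mul_single, zero_add, _root_.mul_one]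

theorem isUnit_monomialHom_X (i : Fin (n + 1)) : IsUnit ((monomialHom ν).toRingHom (X i)) := by
  change IsUnit (monomialHom ν (X i))
  rw [monomialHom_X]
  refine .of_mul_eq_one (AddMonoidAlgebra.single (-ν i) 1) ?_
  rw [AddMonoidAlgebra.single_mul_single, add_neg_cancel, _root_.mul_one]
  rfl

theorem X_mem (i : Fin (n + 1)) : X i ∈ homogeneousSubmodule (Fin (n + 1)) ℂ 1 :=
  isHomogeneous_X _ _

/-- The restriction of a monomial map to an affine chart of `ℙⁿ`. -/
abbrev awayMonomialHom (i : Fin (n + 1)) :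
    Away (homogeneousSubmodule (Fin (n + 1)) ℂ) (X i) →+* AddMonoidAlgebra ℂ Λ :=
  awayHom (homogeneousSubmodule (Fin (n + 1)) ℂ) (monomialHom ν).toRingHom
    (isUnit_monomialHom_X ν i)

theorem awayMonomialHom_mk (i : Fin (n + 1)) (k : ℕ) (x : MvPolynomial (Fin (n + 1)) ℂ)
    (hx : x ∈ homogeneousSubmodule (Fin (n + 1)) ℂ (k • 1)) :
    awayMonomialHom ν i (Away.mk _ (X_mem i) k x hx) =
      monomialHom ν x * AddMonoidAlgebra.single (-(k • ν i)) 1 := by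
  have h := awayHom_mk_mul (homogeneousSubmodule (Fin (n + 1)) ℂ) (isUnit_monomialHom_X ν i)
    (X_mem i) k x hx
  change _ * monomialHom ν (X i) ^ k = monomialHom ν x at h
  rw [← h, monomialHom_X, AddMonoidAlgebra.single_pow, _root_.mul_assoc,
    AddMonoidAlgebra.single_mul_single, add_neg_cancel, one_pow, _root_.mul_one]
  exact (_root_.mul_one _).symm

/-- The chart ring of `ℙⁿ` is generated by the quotients `X j / X i`, which map to the monomials of
exponent `ν j - ν i`. -/
theorem range_awayMonomialHom (i : Fin (n + 1)) (S : AddSubmonoid Λ)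
    (hS : S = AddSubmonoid.closure (Set.range fun j ↦ ν j - ν i)) :
    (AddMonoidAlgebra.mapDomainRingHom ℂ S.subtype).range = (awayMonomialHom ν i).range := by
  have hconst (c : ℂ) : AddMonoidAlgebra.single 0 c ∈ (awayMonomialHom ν i).range := by
    have hc : C c ∈ homogeneousSubmodule (Fin (n + 1)) ℂ (0 • 1) := by
      rw [zero_smul]
      exact isHomogeneous_C _ c
    refine ⟨Away.mk _ (X_mem i) 0 (C c) hc, ?_⟩
    rw [awayMonomialHom_mk, ← monomial_zero', monomialHom_monomial,
      AddMonoidAlgebra.single_mul_single]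
    simp
  refine le_antisymm ?_ ?_
  · rintro _ ⟨x, rfl⟩
    induction x using AddMonoidAlgebra.induction_linear with
    | zero => rw [map_zero]; exact zero_mem _
    | add x y hx hy => rw [map_add]; exact add_mem hx hy
    | single s c =>
      change AddMonoidAlgebra.mapDomain S.subtype (AddMonoidAlgebra.single s c) ∈ _
      rw [AddMonoidAlgebra.mapDomain_single]
      have hmem : ∀ m ∈ AddSubmonoid.closure (Set.range fun j ↦ ν j - ν i),
          (AddMonoidAlgebra.single m 1 : AddMonoidAlgebra ℂ Λ) ∈ (awayMonomialHom ν i).range := by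
        intro m hm
        induction hm using AddSubmonoid.closure_induction with
        | mem m hm =>
          obtain ⟨j, rfl⟩ := hm
          have hj : X j ∈ homogeneousSubmodule (Fin (n + 1)) ℂ (1 • 1) := by
            rw [one_smul]
            exact X_mem j
          refine ⟨Away.mk _ (X_mem i) 1 (X j) hj, ?_⟩
          rw [awayMonomialHom_mk, monomialHom_X, AddMonoidAlgebra.single_mul_single, one_smul,
            _root_.mul_one, ← sub_eq_add_neg]
        | zero => exact one_mem _
        | add m m' _ _ h h' =>
          have := mul_mem h h'
          rwa [AddMonoidAlgebra.single_mul_single, _root_.mul_one] at this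
      have := mul_mem (hconst c) (hmem s (hS ▸ s.2))
      rwa [AddMonoidAlgebra.single_mul_single, zero_add, _root_.mul_one] at this
  · rintro _ ⟨z, rfl⟩
    obtain ⟨k, x, hx, rfl⟩ := Away.mk_surjective _ (X_mem i) z
    rw [awayMonomialHom_mk, x.as_sum, map_sum, Finset.sum_mul]
    refine sum_mem fun e he ↦ ?_
    rw [monomialHom_monomial, AddMonoidAlgebra.single_mul_single, _root_.mul_one]
    have hk : e.sum (fun _ k ↦ k) = k := by
      have := hx (mem_support_iff.1 he)
      rw [Finsupp.weight_apply] at this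
      simpa using this
    have hsum : e.sum (fun j k ↦ k • ν j) + -(k • ν i) = e.sum fun j k ↦ k • (ν j - ν i) := by
      rw [← hk]
      simp only [Finsupp.sum, smul_sub, Finset.sum_sub_distrib, Finset.sum_smul]
      exact (sub_eq_add_neg _ _).symm
    have hs : e.sum (fun j k ↦ k • (ν j - ν i)) ∈ S := by
      rw [hS]
      exact sum_mem fun j _ ↦ nsmul_mem (AddSubmonoid.subset_closure (Set.mem_range_self j)) _
    refine ⟨AddMonoidAlgebra.single (⟨_, hs⟩ : S) (x.coeff e), ?_⟩
    rw [hsum]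
    exact AddMonoidAlgebra.mapDomain_single

end ToProjectiveSpace

/-! ### A degree whose monomials generate every chart -/

section Degree

variable {a b : Fin 3 → ℚ} [h : Fact (IsFormat a b)]

variable (a b) in
-- Finite type of the chart ring comes from that of `Proj`, and a monoid whose algebra is of finite
-- type is finitely generated.
theorem fg_chartMonoid (p : Fin 3 × Fin 3) : AddMonoid.FG (chartMonoid a b p) := by
  have h1 : affineChart a b p ≫ (projOver (grading a b)).hom =
      Spec.map (CommRingCat.ofHom (algebraMap ℂ (AddMonoidAlgebra ℂ (chartMonoid a b p)))) :=
    Over.w (chart a b p)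
  have h2 : LocallyOfFiniteType
      (Spec.map (CommRingCat.ofHom (algebraMap ℂ (AddMonoidAlgebra ℂ (chartMonoid a b p))))) := by
    rw [← h1]
    infer_instance
  have h3 : Algebra.FiniteType ℂ (AddMonoidAlgebra ℂ (chartMonoid a b p)) :=
    RingHom.finiteType_algebraMap.1 ((HasRingHomProperty.Spec_iff (P := @LocallyOfFiniteType)).1 h2)
  exact AddMonoidAlgebra.fg_of_finiteType (R := ℂ)

theorem add_nsmul_unitExpo_mem {m : Expo} {n : ℕ} (hm : m ∈ monomialSet a b n)
    (p : Fin 3 × Fin 3) (k : ℕ) : m + k • unitExpo p ∈ monomialSet a b (n + k • wt a b p) := by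
  obtain ⟨e, he, rfl⟩ := h.out.mem_monomialSet.1 hm
  refine h.out.mem_monomialSet.2 ⟨e + .single p k, ?_, ?_⟩
  · rw [map_add, he, Finsupp.weight_single]
  · rw [map_add, margins_single]

/-- Each of finitely many generators becomes a genuine monomial after multiplication by some power
of `x p`, and higher powers work too; take the largest exponent for `K`. -/
theorem exists_closure_eq (p : Fin 3 × Fin 3) : ∃ K : ℕ, ∀ d ≥ K, chartMonoid a b p =
    AddSubmonoid.closure ((fun m ↦ m - d • unitExpo p) '' monomialSet a b (d • wt a b p)) := by
  obtain ⟨T, hT⟩ := (AddMonoid.fg_def.1 (fg_chartMonoid a b p))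
  choose k hk using fun s : chartMonoid a b p ↦ (h.out.mem_chartMonoid p).1 s.2
  refine ⟨T.sup k, fun d hd ↦ le_antisymm ?_ (AddSubmonoid.closure_le.2 ?_)⟩
  · intro m hm
    have hmT : (⟨m, hm⟩ : chartMonoid a b p) ∈ AddSubmonoid.closure (T : Set (chartMonoid a b p)) :=
      hT ▸ trivial
    have := AddSubmonoid.mem_map_of_mem (chartMonoid a b p).subtype hmT
    rw [AddMonoidHom.map_mclosure] at this
    refine AddSubmonoid.closure_mono ?_ this
    rintro _ ⟨s, hs, rfl⟩
    have hsd : k s ≤ d := (Finset.le_sup hs).trans hd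
    have := add_nsmul_unitExpo_mem (hk s) p (d - k s)
    rw [_root_.add_assoc, ← add_smul, ← add_smul, Nat.add_sub_cancel' hsd] at this
    exact ⟨_, this, add_sub_cancel_right _ _⟩
  · rintro _ ⟨m, hm, rfl⟩
    exact (h.out.mem_chartMonoid p).2 ⟨d, by rwa [sub_add_cancel]⟩

variable (a b) in
/-- A Veronese degree: the monomials of this degree generate all the charts. -/
theorem exists_degree : ∃ (D : ℕ) (d : Fin 3 × Fin 3 → ℕ), 0 < D ∧ (∀ p, d p • wt a b p = D) ∧
    ∀ p, chartMonoid a b p =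
      AddSubmonoid.closure ((fun m ↦ m - d p • unitExpo p) '' monomialSet a b D) := by
  choose K hK using exists_closure_eq (a := a) (b := b)
  let N : ℕ := Finset.univ.sup K + 1
  have hpos (s : Finset (Fin 3 × Fin 3)) : 0 < ∏ q ∈ s, wt a b q :=
    Finset.prod_pos fun q _ ↦ wt_pos' a b q
  have hd (p : Fin 3 × Fin 3) : (N * ∏ q ∈ Finset.univ.erase p, wt a b q) • wt a b p =
      N * ∏ q, wt a b q := by
    rw [smul_eq_mul, _root_.mul_assoc, Finset.prod_erase_mul _ _ (Finset.mem_univ p)]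
  -- `D` must be a multiple of every weight, with every quotient `d p = D / wt p` at least `K p`;
  -- the `+ 1` in `N` keeps `D` positive.
  refine ⟨N * ∏ q, wt a b q, fun p ↦ N * ∏ q ∈ Finset.univ.erase p, wt a b q,
    Nat.mul_pos (Nat.succ_pos _) (hpos _), hd, fun p ↦ ?_⟩
  have := hK p (N * ∏ q ∈ Finset.univ.erase p, wt a b q)
    ((Finset.le_sup (Finset.mem_univ p)).trans ((Nat.le_succ _).trans
      (Nat.le_mul_of_pos_right _ (hpos _))))
  rwa [hd] at this

theorem nsmul_unitExpo_mem (p : Fin 3 × Fin 3) (k : ℕ) :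
    k • unitExpo p ∈ monomialSet a b (k • wt a b p) :=
  h.out.mem_monomialSet.2 ⟨.single p k, Finsupp.weight_single _ _ _, margins_single p k⟩

variable (a b) in
theorem exists_range_eq_monomialSet {D : ℕ} (hne : (monomialSet a b D).Nonempty) :
    ∃ (n : ℕ) (ν : Fin (n + 1) → Expo), Set.range ν = monomialSet a b D := by
  have hfin : (monomialSet a b D).Finite := by
    refine ((Finsupp.finite_of_nat_weight_le (wt a b) (fun p ↦ (wt_pos' a b p).ne') D).image
      margins).subset fun m hm ↦ ?_
    obtain ⟨e, he, rfl⟩ := h.out.mem_monomialSet.1 hm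
    exact ⟨e, he.le, rfl⟩
  have := hfin.to_subtype
  have := hne.to_subtype
  obtain ⟨n, ⟨ε⟩⟩ := Finite.exists_equiv_fin (monomialSet a b D)
  cases n with
  | zero => exact (ε (Classical.arbitrary _)).elim0
  | succ n => exact ⟨n, fun i ↦ ε.symm i, by
      rw [← Function.comp_def, ε.symm.surjective.range_comp, Subtype.range_coe]⟩

end Degree

/-! ### The closed embedding into projective space -/

section Embedding

open HomogeneousLocalization

variable (a b : Fin 3 → ℚ) [h : Fact (IsFormat a b)]

instance (n : ℕ) : IsSeparated (projectiveSpace n).hom := by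
  change IsSeparated (Proj.toSpecZero (MvPolynomial.homogeneousSubmodule (Fin (n + 1)) ℂ) ≫
    Spec.map _)
  infer_instance

omit h in
theorem mapDomain_subtype_injective (p : Fin 3 × Fin 3) : Function.Injective
    (AddMonoidAlgebra.mapDomainRingHom ℂ (chartMonoid a b p).subtype) :=
  AddMonoidAlgebra.mapDomain_injective Subtype.val_injective

/-- The big torus of the affine cone, mapping to a chart. -/
def coneTorusMap (p : Fin 3 × Fin 3) : Spec (.of (AddMonoidAlgebra ℂ Expo)) ⟶
    Spec (.of (AddMonoidAlgebra ℂ (chartMonoid a b p))) :=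
  Spec.map (CommRingCat.ofHom (AddMonoidAlgebra.mapDomainRingHom ℂ (chartMonoid a b p).subtype))

/-- The torus of the cone inverts all coordinates, so its map to `Proj` does not depend on the chart
used. It serves as the dense part along which the map to `ℙⁿ` is glued. -/
theorem coneTorusMap_affineChart (p q : Fin 3 × Fin 3) :
    coneTorusMap a b p ≫ affineChart a b p = coneTorusMap a b q ≫ affineChart a b q := by
  have key (p : Fin 3 × Fin 3) : coneTorusMap a b p ≫ affineChart a b p =
      Spec.map (CommRingCat.ofHom (awayHom (grading a b) paramHom (isUnit_param_coord p))) ≫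
        Proj.awayι (grading a b) (coord p) (coord_mem p) (wt_pos' a b p) := by
    have h1 : coneTorusMap a b p ≫ Spec.map (CommRingCat.ofHom (chartEquiv a b p).symm.toRingHom) =
        Spec.map (CommRingCat.ofHom (awayHom (grading a b) paramHom (isUnit_param_coord p))) := by
      rw [coneTorusMap, ← Spec.map_comp]
      congr 1
      refine CommRingCat.hom_ext (RingHom.ext fun x ↦ ?_)
      change AddMonoidAlgebra.mapDomainRingHom ℂ (chartMonoid a b p).subtype
        ((chartEquiv a b p).symm x) = _
      rw [← awayHom_chartEquiv, RingEquiv.apply_symm_apply]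
      rfl
    exact (Category.assoc _ _ _).symm.trans
      (congrArg (· ≫ Proj.awayι (grading a b) (coord p) (coord_mem p) (wt_pos' a b p)) h1)
  rw [key, key]
  exact SpecMap_awayHom_awayι (grading a b) (coord_mem p) _ (coord_mem q) _ _ _

omit h in
theorem isDominant_coneTorusMap (p : Fin 3 × Fin 3) : IsDominant (coneTorusMap a b p) := by
  refine ⟨(PrimeSpectrum.denseRange_comap_iff_ker_le_nilRadical _).2 ?_⟩
  exact ((RingHom.injective_iff_ker_eq_bot _).1 (mapDomain_subtype_injective a b p)).trans_le bot_le

theorem isDominant_affineChart (p : Fin 3 × Fin 3) : IsDominant (affineChart a b p) :=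
  ⟨(affineChart a b p).isOpenEmbedding.isOpen_range.dense (Set.range_nonempty _)⟩

theorem affineChart_mem_basicOpen_iff (p q : Fin 3 × Fin 3)
    (z : Spec (.of (AddMonoidAlgebra ℂ (chartMonoid a b q)))) :
    affineChart a b q z ∈ Proj.basicOpen (grading a b) (coord p) ↔
      (chartEquiv a b q).symm (Away.isLocalizationElem (coord_mem q) (coord_mem p)) ∉ z.asIdeal :=
  Eq.to_iff congr(
    (Spec.map (CommRingCat.ofHom (chartEquiv a b q).symm.toRingHom) z) ∈
    $(Proj.awayι_preimage_basicOpen (grading a b) (coord_mem q) (wt_pos' a b q) (coord_mem p)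
      (wt_pos' a b p)))

theorem mapDomain_chartEquiv_symm (p q : Fin 3 × Fin 3) :
    AddMonoidAlgebra.mapDomainRingHom ℂ (chartMonoid a b q).subtype
      ((chartEquiv a b q).symm (Away.isLocalizationElem (coord_mem q) (coord_mem p))) =
    AddMonoidAlgebra.single (wt a b q • unitExpo p - wt a b p • unitExpo q) 1 := by
  rw [← awayHom_chartEquiv, RingEquiv.apply_symm_apply]
  apply ((isUnit_param_coord q).pow (wt a b p)).mul_right_cancel
  rw [awayHom_mk_mul]
  change param _ = _ * param (coord q) ^ wt a b p
  rw [map_pow, param_coord, param_coord, AddMonoidAlgebra.single_pow, AddMonoidAlgebra.single_pow,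
    AddMonoidAlgebra.single_mul_single, sub_add_cancel]
  simp

theorem isProjective_proj : IsProjective (projOver (grading a b)) := by
  obtain ⟨D, d, hD, hdD, hgen⟩ := exists_degree a b
  have hmem (p : Fin 3 × Fin 3) : d p • unitExpo p ∈ monomialSet a b D := by
    rw [← hdD p]
    exact nsmul_unitExpo_mem p (d p)
  obtain ⟨n, ν, hν⟩ := exists_range_eq_monomialSet a b ⟨_, hmem 0⟩
  -- `X (i p)` is the coordinate of `ℙⁿ` that pulls back to the pure power `x p ^ d p`.
  choose i hi using fun p ↦ hν.symm ▸ hmem p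
  let 𝒮 := MvPolynomial.homogeneousSubmodule (Fin (n + 1)) ℂ
  have hrange (p : Fin 3 × Fin 3) :
      (AddMonoidAlgebra.mapDomainRingHom ℂ (chartMonoid a b p).subtype).range =
        (awayMonomialHom ν (i p)).range := by
    apply range_awayMonomialHom
    rw [hgen p, ← hν, ← Set.range_comp, hi p]
    rfl
  choose g hgs hg using fun p ↦ exists_surjective_of_range_eq (mapDomain_subtype_injective a b p)
    (awayMonomialHom ν (i p)) (hrange p)
  let ι₀ (p : Fin 3 × Fin 3) := Proj.awayι 𝒮 (MvPolynomial.X (i p)) (X_mem (i p)) one_pos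
  have hι₀ (p : Fin 3 × Fin 3) : IsOpenImmersion (Y := (projectiveSpace n).left) (ι₀ p) :=
    inferInstanceAs (IsOpenImmersion (Proj.awayι ..))
  let gS (p : Fin 3 × Fin 3) := Spec.map (CommRingCat.ofHom (g p))
  have hgclosed (p : Fin 3 × Fin 3) : IsClosedImmersion (gS p) := .spec_of_surjective _ (hgs p)
  have hover (p : Fin 3 × Fin 3) : (gS p ≫ ι₀ p) ≫ (projectiveSpace n).hom =
      affineChart a b p ≫ (projOver (grading a b)).hom := by
    refine Eq.trans ?_ (Over.w (chart a b p)).symm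
    change (_ ≫ _) ≫ Proj.toSpecZero 𝒮 ≫ _ = Spec.map _
    rw [Category.assoc, Proj.awayι_toSpecZero_assoc, ← Spec.map_comp, ← Spec.map_comp]
    congr 1
    refine CommRingCat.hom_ext (RingHom.ext fun c ↦ ?_)
    apply mapDomain_subtype_injective a b p
    change AddMonoidAlgebra.mapDomainRingHom ℂ (chartMonoid a b p).subtype
      (g p (fromZeroRingHom 𝒮 _ (algebraMap ℂ (𝒮 0) c))) = _
    rw [hg, awayHom_fromZeroRingHom]
    change monomialHom ν (algebraMap ℂ _ c) = AddMonoidAlgebra.mapDomain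
      (chartMonoid a b p).subtype (AddMonoidAlgebra.single 0 c)
    rw [AlgHom.commutes, AddMonoidAlgebra.mapDomain_single, map_zero]
    rfl
  let 𝒰 : (projOver (grading a b)).left.OpenCover := .mkOfCovers (Fin 3 × Fin 3) _
    (affineChart a b) (exists_mem_range_chart a b) (fun p ↦ inferInstance)
  have hcompat (p q : Fin 3 × Fin 3) :
      coneTorusMap a b p ≫ gS p ≫ ι₀ p = coneTorusMap a b q ≫ gS q ≫ ι₀ q := by
    have key (p : Fin 3 × Fin 3) : coneTorusMap a b p ≫ gS p ≫ ι₀ p =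
        Spec.map (CommRingCat.ofHom (awayMonomialHom ν (i p))) ≫ ι₀ p := by
      rw [← Category.assoc, coneTorusMap, ← Spec.map_comp]
      congr 2
      exact CommRingCat.hom_ext (RingHom.ext fun x ↦ hg p x)
    rw [key, key]
    exact SpecMap_awayHom_awayι 𝒮 (X_mem (i p)) _ (X_mem (i q)) _ _ _
  have hdom : IsDominant (coneTorusMap a b 0 ≫ affineChart a b 0) :=
    have := isDominant_coneTorusMap a b 0
    have := isDominant_affineChart a b 0
    inferInstance
  obtain ⟨f, hf⟩ := exists_hom_of_isDominant 𝒰 (projectiveSpace n).hom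
    (fun p : Fin 3 × Fin 3 ↦ gS p ≫ ι₀ p) (projOver (grading a b)).hom hover
    (coneTorusMap a b 0 ≫ affineChart a b 0) (coneTorusMap a b)
    (fun p ↦ coneTorusMap_affineChart a b p 0) (coneTorusMap a b 0 ≫ gS 0 ≫ ι₀ 0)
    (fun p ↦ hcompat p 0)
  have hf' (p : Fin 3 × Fin 3) : affineChart a b p ≫ f = gS p ≫ ι₀ p := hf p
  have hfw : f ≫ (projectiveSpace n).hom = (projOver (grading a b)).hom :=
    𝒰.hom_ext _ _ fun p : Fin 3 × Fin 3 ↦ (Category.assoc _ _ _).symm.trans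
      ((congrArg (· ≫ (projectiveSpace n).hom) (hf' p)).trans (hover p))
  have hproper : IsProper (f ≫ (projectiveSpace n).hom) := hfw ▸ inferInstance
  refine ⟨n, Over.homMk f hfw, isClosedImmersion_of_charts f (projectiveSpace n).hom
    (affineChart a b) (exists_mem_range_chart a b) ι₀ gS hf' fun p x hx ↦ ?_⟩
  obtain ⟨q, z, rfl⟩ := exists_mem_range_chart a b x
  refine (SetLike.ext_iff.1 (opensRange_chart a b p) _).2 ?_
  refine (affineChart_mem_basicOpen_iff a b p q z).2 fun hz ↦ ?_
  have hx' : ι₀ q (gS q z) ∈ Proj.basicOpen 𝒮 (MvPolynomial.X (i p)) := by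
    rw [← Proj.opensRange_awayι 𝒮 (MvPolynomial.X (i p)) (X_mem (i p)) one_pos]
    exact congr($(hf' q) z) ▸ hx
  have hx'' : g q (Away.isLocalizationElem (X_mem (i q)) (X_mem (i p))) ∉ z.asIdeal :=
    (Eq.to_iff congr(gS q z ∈ $(Proj.awayι_preimage_basicOpen 𝒮 (X_mem (i q)) one_pos
      (X_mem (i p)) one_pos))).1 hx'
  have hz' : z.asIdeal.IsPrime := z.2
  refine hx'' (hz'.mem_of_pow_mem (wt a b q * wt a b p) ?_)
  -- Since `d p * wt p = D = d q * wt q`, the quotient `x p ^ d p / x q ^ d q` raised to `wt q * wt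
  -- p` is `x p ^ wt q / x q ^ wt p` raised to `D`. So the preimage of `X (i p) ≠ 0` lies in `x p ≠
  -- 0`.
  have hpow : g q (Away.isLocalizationElem (X_mem (i q)) (X_mem (i p))) ^
      (wt a b q * wt a b p) = (chartEquiv a b q).symm
        (Away.isLocalizationElem (coord_mem q) (coord_mem p)) ^ D := by
    apply mapDomain_subtype_injective a b q
    rw [map_pow, map_pow, mapDomain_chartEquiv_symm, hg, Away.isLocalizationElem,
      awayMonomialHom_mk, pow_one, monomialHom_X, AddMonoidAlgebra.single_mul_single, hi, hi,
      AddMonoidAlgebra.single_pow, AddMonoidAlgebra.single_pow]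
    congr 1
    · rw [one_smul, ← sub_eq_add_neg, smul_sub, smul_sub, ← mul_smul, ← mul_smul, ← mul_smul,
        ← mul_smul, ← hdD p]
      congr 2
      · simp only [smul_eq_mul]; ring
      · rw [hdD p, ← hdD q]
        simp only [smul_eq_mul]; ring
    · simp
  rw [hpow]
  exact Ideal.pow_mem_of_mem _ hz D hD

end Embedding

end WeightedP2P2

end

open WeightedP2P2 in
theorem proposition2p1 (a b : Fin 3 → ℚ) (h : IsFormat a b) :
    topologicalKrullDim (V h).left = 4 ∧
    IsQFactorial (V h).left ∧
    IsProjective (V h) ∧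
    IsToric (V h) ∧
    picardRank (V h).left = 2 := by
  have : Fact (IsFormat a b) := ⟨h⟩
  exact ⟨topologicalKrullDim_proj a b, isQFactorial_proj a b, isProjective_proj a b,
    isToric_proj a b, picardRank_proj a b⟩
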